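/- **Theorem (general regret bound for BoBW-RealFTRL).** *Setting.* Let $K\ge 2$, $d\ge 1$, $T\ge 2$. Let $\mathcal D$ be a probability distribution on $\mathbb R^d$ with $\|x\|_2\le C_{\mathcal X}$ for $\mathcal D$-almost every $x$, and suppose $\Sigma=\mathbb E_{X\sim\mathcal D}[XX^\top]$ is positive definite with smallest eigenvalue $\lambda_{\min}>0$. In each round $t=1,\dots,T$: 1. the environment chooses parameters $\theta_t(a)\in\mathbb R^d$, $a\in[K]$, with $\|\theta_t(a)\|_2\le C_\Theta$, in an arbitrary, possibly randomized way depending on the past; 2. a context $X_t\sim\mathcal D$ is drawn independently of the past and of this choice; 3. the learner draws $A_t\in[K]$ from $\pi_t(\cdot\mid X_t)$ and incurs and observes $\ell_t(A_t,X_t)$, where $\ell_t(a,X_t)=\langle X_t,\theta_t(a)\rangle+\varepsilon_t(a)$. Here $|\varepsilon_t(a)|\le C_{\mathcal E}$, and $\varepsilon_t(a)$ has conditional mean zero given the past, the $\theta_t(\cdot)$, $X_t$ and $A_t$. Let $C_\ell\ge C_{\mathcal X}/2$ be a constant with $|\ell_t(a,X_t)|\le C_\ell$ almost surely for all $t,a$.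 The regret is $$R_T=\max_{\rho:\mathbb R^d\to[K]\text{ measurable}}\ \mathbb E\Big[\sum_{t=1}^T\{\ell_t(A_t,X_t)-\ell_t(\rho(X_t),X_t)\}\Big].$$ Let $a^*$ be measurable with $a^*(x)\in\arg\min_{a}\sum_{t=1}^T\langle x,\mathbb E[\theta_t(a)]\rangle$ for all $x$, and let $\overline Q(a^*)=\mathbb E\big[\sum_{t=1}^T\{1-\pi_t(a^*(X_0)\mid X_0)\}\big]$ with $X_0\sim\mathcal D$ independent of the trial. The environment satisfies a *self-bounding constraint* if $R_T\ge\Delta_*\overline Q(a^*)-C$ for some $\Delta_*>0$, $C\ge0$. *Algorithm (BoBW-RealFTRL).* Put $\delta=1/(2C_\ell C_{\mathcal X})$ and let $H(p)=\sum_a p(a)\log(1/p(a))$. Given an initial learning rate $\beta_1>0$, let $q_1(x)$ be uniform on $[K]$ and, for $t\ge2$, let $q_t(x)$ minimize $$\sum_{s<t}\sum_{a\in[K]}\langle x,\hat\theta_s(a)\rangle\, p(a)-\beta_tH(p)$$ over probability vectors $p$ on $[K]$. Further, $$\beta_{t+1}=\beta_t+\frac{\beta_1}{\sqrt{1+(\log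 K)^{-1}\sum_{s\le t}H(q_s(X_s))}},\qquad \gamma_t=\frac{K\log T}{2\delta\lambda_{\min}\beta_t},\qquad \pi_t(a\mid x)=(1-\gamma_t)q_t(a\mid x)+\frac{\gamma_t}{K},$$ and $\hat\theta_t(a)=\hat\Sigma^\dagger_{t,a}\mathbf 1[A_t=a]X_t\ell_t(A_t,X_t)$. The matrix $\hat\Sigma^\dagger_{t,a}$ is computed by Matrix Geometric Resampling: for each arm $a$, conditionally on the past and on $X_t$, $A_t$, $\varepsilon_t(\cdot)$, pairs $(X(k),V(k))$ are simulated i.i.d. with $X(k)\sim\mathcal D$ and $V(k)\sim\pi_t(\cdot\mid X(k))$, and with $M_t=\max\{0,\lceil 2\beta_t-1\rceil\}$, $$\hat\Sigma^\dagger_{t,a}=\delta I+\delta\sum_{k=1}^{M_t}\prod_{j=1}^k\big(I-\delta\mathbf 1[V(j)=a]X(j)X(j)^\top\big).$$ *Claim.* For all positive $C_{\mathcal X},C_\Theta,C_{\mathcal E}$ and every $C_\ell\ge C_{\mathcal X}/2$ there is a constant $c_0>0$, depending only on these four numbers, such that in every setting as above (with any $K\ge2$, $d\ge1$, $T\ge2$,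 any $\mathcal D$ and any environment), for every $\beta_1>0$ with $\gamma_1\le1$ (so that the $\pi_t$ are probability vectors), every such $a^*$ and all $\Delta_*>0$, $C\ge0$ for which the self-bounding constraint holds, the regret is finite and $$R_T\le c_0\left(\frac{K\log T}{\beta_1}\Big(\frac{\log T}{\delta\lambda_{\min}\log K}+d\Big)+\beta_1\sqrt{\log K}\right)\sqrt{\log(KT)}\;\max\big\{\overline Q(a^*)^{1/2},1\big\}.$$ -/

import Mathlib

open MeasureTheory ProbabilityTheory

namespace BoBW

/-- Contexts and regression parameters: `ℝ^d` with the Euclidean norm and inner product. -/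
abbrev Ctx (d : ℕ) : Type := EuclideanSpace ℝ (Fin d)

/-! ## The context distribution -/

/-- The second-moment matrix `Σ = E[X Xᵀ]` of a context distribution. -/
noncomputable def secondMoment {d : ℕ} (D : Measure (Ctx d)) : Matrix (Fin d) (Fin d) ℝ :=
  Matrix.of fun i j => ∫ x, x i * x j ∂D

/-- The smallest eigenvalue of `Σ = E[X Xᵀ]`. -/
noncomputable def lambdaMin {d : ℕ} (D : Measure (Ctx d)) : ℝ :=
  sInf (spectrum ℝ (secondMoment D))

/-! ## Follow-the-regularized-leader with Shannon entropy -/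

/-- Shannon entropy `H(p) = ∑ₐ p(a) log (1 / p(a))` (with `0 log (1/0) = 0`). -/
noncomputable def entropy {K : ℕ} (p : Fin K → ℝ) : ℝ :=
  ∑ a, p a * Real.log (1 / p a)

/-- The objective `⟨L, p⟩ + ψ(p)`, `ψ(p) = - β H(p)`, for a vector `L` of cumulative losses. -/
noncomputable def ftrlObjective {K : ℕ} (β : ℝ) (L p : Fin K → ℝ) : ℝ :=
  ∑ a, L a * p a + -(β * entropy p)

/-- `p` minimizes the objective over the probability simplex. -/
def IsFTRL {K : ℕ} (β : ℝ) (L p : Fin K → ℝ) : Prop :=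
  p ∈ stdSimplex ℝ (Fin K) ∧ IsMinOn (ftrlObjective β L) (stdSimplex ℝ (Fin K)) p

/-- A minimizer of the objective over the probability simplex. -/
noncomputable def ftrl {K : ℕ} (β : ℝ) (L : Fin K → ℝ) : Fin K → ℝ :=
  Classical.epsilon (IsFTRL β L)

theorem ftrl_spec {K : ℕ} (hK : 0 < K) (β : ℝ) (L : Fin K → ℝ) : IsFTRL β L (ftrl β L) := by
  have hcont : Continuous (ftrlObjective (K := K) β L) := by
    have h : ftrlObjective (K := K) β L
        = fun p => ∑ a, L a * p a + -(β * ∑ a, Real.negMulLog (p a)) := by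
      funext p
      simp [ftrlObjective, entropy, Real.negMulLog]
    rw [h]
    have := Real.continuous_negMulLog
    fun_prop
  have hne : (stdSimplex ℝ (Fin K)).Nonempty := ⟨_, single_mem_stdSimplex ℝ (⟨0, hK⟩ : Fin K)⟩
  obtain ⟨p, hp, hmin⟩ :=
    (isCompact_stdSimplex ℝ (Fin K)).exists_isMinOn hne hcont.continuousOn
  exact Classical.epsilon_spec (p := IsFTRL β L) ⟨p, hp, hmin⟩

/-! ## Matrix geometric resampling -/

/-- `W = 1[v = a] x xᵀ`. -/
noncomputable def mgrW {K d : ℕ} (a : Fin K) (x : Ctx d) (v : Fin K) :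
    Matrix (Fin d) (Fin d) ℝ :=
  if v = a then Matrix.vecMulVec x.ofLp x.ofLp else 0

/-- `V_k = ∏_{j=1}^{k} (I - δ W_j)`; the `j`-th simulated pair is `(xs (j-1), vs (j-1))`. -/
noncomputable def mgrV {K d : ℕ} (δ : ℝ) (a : Fin K) (xs : ℕ → Ctx d) (vs : ℕ → Fin K) :
    ℕ → Matrix (Fin d) (Fin d) ℝ
  | 0 => 1
  | k + 1 => mgrV δ a xs vs k * (1 - δ • mgrW a (xs k) (vs k))

/-- `Σ̂† = δ I + δ ∑_{k=1}^{M} V_k`. -/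
noncomputable def mgr {K d : ℕ} (δ : ℝ) (M : ℕ) (a : Fin K) (xs : ℕ → Ctx d)
    (vs : ℕ → Fin K) : Matrix (Fin d) (Fin d) ℝ :=
  δ • (1 : Matrix (Fin d) (Fin d) ℝ) + δ • ∑ k ∈ Finset.Icc 1 M, mgrV δ a xs vs k

/-! ## The algorithm

Rounds are numbered from `0`: index `t` is the `(t+1)`-st round, so that `β 0` is the initial
learning rate `β₁`. -/

/-- Inputs of the algorithm: horizon `T`, resampling step `δ`, smallest eigenvalue `λ_min`,
initial learning rate `β₁`. -/
structure Params where
  T : ℕ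
  delta : ℝ
  lam : ℝ
  beta1 : ℝ

/-- Everything the algorithm sees in one round: context, drawn arm, incurred loss, and for every
arm the sequence of simulated context-arm pairs. -/
structure RoundData (K d : ℕ) where
  ctx : Ctx d
  arm : Fin K
  loss : ℝ
  simCtx : Fin K → ℕ → Ctx d
  simArm : Fin K → ℕ → Fin K

/-- What the algorithm stores before round `t`: the sums `∑_{s<t} θ̂_s(a)`, the number
`∑_{s<t} H(q_s(X_s))`, and `β_t`. -/
structure State (K d : ℕ) where
  thetaSum : Fin K → Ctx d
  entSum : ℝ
  beta : ℝ

/-- `q_t(x)`: uniform in the first round, afterwards the minimizer over the simplex of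
`∑_{s<t} ⟨ℓ̂_s(x), q⟩ - β_t H(q)`, where `ℓ̂_s(a, x) = ⟨x, θ̂_s(a)⟩`. -/
noncomputable def qOf {K d : ℕ} (t : ℕ) (st : State K d) (x : Ctx d) : Fin K → ℝ :=
  if t = 0 then fun _ => 1 / (K : ℝ)
  else ftrl st.beta fun a => inner ℝ x (st.thetaSum a)

/-- The exploration rate `γ = K log T / (2 δ λ_min β)`. -/
noncomputable def gammaOf (K : ℕ) (P : Params) (β : ℝ) : ℝ :=
  (K : ℝ) * Real.log P.T / (2 * P.delta * P.lam * β)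

/-- The number of resampling steps, `2 β - 1` rounded up. -/
noncomputable def stepsOf (β : ℝ) : ℕ := ⌈2 * β - 1⌉₊

/-- `θ̂(a) = Σ̂†_a 1[A = a] X ℓ(A, X)`. -/
noncomputable def thetaHat {K d : ℕ} (P : Params) (β : ℝ) (r : RoundData K d) (a : Fin K) :
    Ctx d :=
  if r.arm = a then
    r.loss • WithLp.toLp 2
      ((mgr P.delta (stepsOf β) a (r.simCtx a) (r.simArm a)).mulVec r.ctx.ofLp)
  else 0

/-- The state before round `t`, computed from the data `h s` of the rounds `s < t`. -/
noncomputable def stateAt {K d : ℕ} (P : Params) (h : ℕ → RoundData K d) : ℕ → State K d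
  | 0 => { thetaSum := fun _ => 0, entSum := 0, beta := P.beta1 }
  | t + 1 =>
    { thetaSum := fun a =>
        (stateAt P h t).thetaSum a + thetaHat P (stateAt P h t).beta (h t) a
      entSum := (stateAt P h t).entSum + entropy (qOf t (stateAt P h t) (h t).ctx)
      beta := (stateAt P h t).beta + P.beta1 / Real.sqrt (1 + (Real.log K)⁻¹ *
        ((stateAt P h t).entSum + entropy (qOf t (stateAt P h t) (h t).ctx))) }

/-- `β_t`. -/
noncomputable def betaAt {K d : ℕ} (P : Params) (h : ℕ → RoundData K d) (t : ℕ) : ℝ :=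
  (stateAt P h t).beta

/-- `q_t(a ∣ x)`. -/
noncomputable def qAt {K d : ℕ} (P : Params) (h : ℕ → RoundData K d) (t : ℕ) (x : Ctx d) :
    Fin K → ℝ :=
  qOf t (stateAt P h t) x

/-- `π_t(a ∣ x) = (1 - γ_t) q_t(a ∣ x) + γ_t / K`. -/
noncomputable def policyAt {K d : ℕ} (P : Params) (h : ℕ → RoundData K d) (t : ℕ) (x : Ctx d)
    (a : Fin K) : ℝ :=
  (1 - gammaOf K P (betaAt P h t)) * qAt P h t x a + gammaOf K P (betaAt P h t) / K

theorem entSum_eq {K d : ℕ} (P : Params) (h : ℕ → RoundData K d) (t : ℕ) :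
    (stateAt P h t).entSum = ∑ s ∈ Finset.range t, entropy (qAt P h s (h s).ctx) := by
  induction t with
  | zero => simp [stateAt]
  | succ t ih => rw [Finset.sum_range_succ, ← ih]; rfl

theorem thetaSum_eq {K d : ℕ} (P : Params) (h : ℕ → RoundData K d) (t : ℕ) (a : Fin K) :
    (stateAt P h t).thetaSum a = ∑ s ∈ Finset.range t, thetaHat P (betaAt P h s) (h s) a := by
  induction t with
  | zero => simp [stateAt]
  | succ t ih => rw [Finset.sum_range_succ, ← ih]; rfl

/-- The entropy-adaptive learning rate:
`β_{t+1} = β_t + β₁ / √(1 + (log K)⁻¹ ∑_{s ≤ t} H(q_s(X_s)))`. -/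
theorem betaAt_succ {K d : ℕ} (P : Params) (h : ℕ → RoundData K d) (t : ℕ) :
    betaAt P h (t + 1) = betaAt P h t + P.beta1 / Real.sqrt (1 + (Real.log K)⁻¹ *
      ∑ s ∈ Finset.range (t + 1), entropy (qAt P h s (h s).ctx)) := by
  rw [← entSum_eq]; rfl

/-! ## Interaction with the environment -/

/-- The random variables of a trial: contexts `X t`, arms `A t`, loss parameters `θ t a`, errors
`ε t a`, and the pairs `(simX t a k, simA t a k)` simulated in round `t` for arm `a`. -/
structure Trial (Ω : Type*) (K d : ℕ) where
  X : ℕ → Ω → Ctx d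
  A : ℕ → Ω → Fin K
  θ : ℕ → Fin K → Ω → Ctx d
  ε : ℕ → Fin K → Ω → ℝ
  simX : ℕ → Fin K → ℕ → Ω → Ctx d
  simA : ℕ → Fin K → ℕ → Ω → Fin K

namespace Trial

variable {Ω : Type*} {K d : ℕ}

/-- The linear loss `ℓ_t(a, X_t) = ⟨X_t, θ_t(a)⟩ + ε_t(a)`. -/
noncomputable def loss (R : Trial Ω K d) (t : ℕ) (a : Fin K) (ω : Ω) : ℝ :=
  inner ℝ (R.X t ω) (R.θ t a ω) + R.ε t a ω

/-- The data seen by the algorithm; of the losses only `ℓ_t(A_t, X_t)`. -/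
noncomputable def data (R : Trial Ω K d) (ω : Ω) (t : ℕ) : RoundData K d where
  ctx := R.X t ω
  arm := R.A t ω
  loss := R.loss t (R.A t ω) ω
  simCtx := fun a k => R.simX t a k ω
  simArm := fun a k => R.simA t a k ω

/-- The policy `π_t(a ∣ x)` played in round `t`. -/
noncomputable def policy (R : Trial Ω K d) (P : Params) (t : ℕ) (ω : Ω) (x : Ctx d)
    (a : Fin K) : ℝ :=
  policyAt P (R.data ω) t x a

/-- `R` is a trial of BoBW-RealFTRL with contexts drawn i.i.d. from `D`, under the probability
measure `μ`. Here `G t` contains all that happened before round `t`, including the environment's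
(possibly randomized and history-dependent) choice of `θ t`. -/
structure IsBoBWRealFTRL {mΩ : MeasurableSpace Ω} (R : Trial Ω K d) (P : Params)
    (D : Measure (Ctx d)) (G : Filtration ℕ mΩ) (μ : Measure Ω) : Prop where
  /-- the outcome of round `t` is part of the history of the later rounds -/
  past_X : ∀ t < P.T, Measurable[G (t + 1)] (R.X t)
  past_A : ∀ t < P.T, Measurable[G (t + 1)] (R.A t)
  past_ε : ∀ t < P.T, ∀ a, Measurable[G (t + 1)] (R.ε t a)
  past_simX : ∀ t < P.T, ∀ a k, Measurable[G (t + 1)] (R.simX t a k)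
  past_simA : ∀ t < P.T, ∀ a k, Measurable[G (t + 1)] (R.simA t a k)
  /-- the environment chooses `θ t` before the context is drawn -/
  choice_θ : ∀ t < P.T, ∀ a, Measurable[G t] (R.θ t a)
  /-- the context is drawn from `D`, independently of the past -/
  law_X : ∀ t < P.T, μ.map (R.X t) = D
  indep_X : ∀ t < P.T, Indep (MeasurableSpace.comap (R.X t) inferInstance) (G t) μ
  /-- given the past and the context, the arm is drawn from `π_t(· ∣ X_t)` -/
  law_A : ∀ t < P.T, ∀ a,
    μ[Set.indicator {ω | R.A t ω = a} (fun _ => (1 : ℝ)) |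
        G t ⊔ MeasurableSpace.comap (R.X t) inferInstance]
      =ᵐ[μ] fun ω => R.policy P t ω (R.X t ω) a
  /-- the error has mean zero given the past, the context and the arm -/
  mean_ε : ∀ t < P.T, ∀ a,
    μ[R.ε t a | G t ⊔ MeasurableSpace.comap (R.X t) inferInstance
        ⊔ MeasurableSpace.comap (R.A t) inferInstance] =ᵐ[μ] 0
  /-- for every arm `a`, given the past and the current context, arm and errors, the simulated
  pairs are i.i.d., with contexts drawn from `D` and arms drawn from `π_t` at these contexts -/
  law_sim : ∀ t < P.T, ∀ (a : Fin K) (n : ℕ) (B : ℕ → Set (Ctx d)) (b : ℕ → Fin K),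
    (∀ k, MeasurableSet (B k)) →
    μ[Set.indicator {ω | ∀ k < n, R.simX t a k ω ∈ B k ∧ R.simA t a k ω = b k}
          (fun _ => (1 : ℝ)) |
        G t ⊔ MeasurableSpace.comap (R.X t) inferInstance
          ⊔ MeasurableSpace.comap (R.A t) inferInstance
          ⊔ ⨆ a', MeasurableSpace.comap (R.ε t a') inferInstance]
      =ᵐ[μ] fun ω => ∏ k ∈ Finset.range n, ∫ x in B k, R.policy P t ω x (b k) ∂D

/-- Expected cumulative loss of the algorithm minus that of the fixed classifier `ρ`. -/
noncomputable def regretAgainst [MeasurableSpace Ω] (R : Trial Ω K d) (T : ℕ) (μ : Measure Ω)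
    (ρ : Ctx d → Fin K) : ℝ :=
  ∫ ω, ∑ t ∈ Finset.range T, (R.loss t (R.A t ω) ω - R.loss t (ρ (R.X t ω)) ω) ∂μ

/-- The set of values over which the maximum in the definition of the regret is taken. -/
def regretSet [MeasurableSpace Ω] (R : Trial Ω K d) (T : ℕ) (μ : Measure Ω) : Set ℝ :=
  {r | ∃ ρ : Ctx d → Fin K, Measurable ρ ∧ r = R.regretAgainst T μ ρ}

/-- The regret `R_T`. -/
noncomputable def regret [MeasurableSpace Ω] (R : Trial Ω K d) (T : ℕ) (μ : Measure Ω) : ℝ :=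
  sSup (R.regretSet T μ)

/-- `a*(x) ∈ argmin_a ∑_t ⟨x, E[θ_t(a)]⟩` for every `x`. -/
def IsOptimal [MeasurableSpace Ω] (R : Trial Ω K d) (T : ℕ) (μ : Measure Ω)
    (astar : Ctx d → Fin K) : Prop :=
  Measurable astar ∧ ∀ x a,
    ∑ t ∈ Finset.range T, inner ℝ x (∫ ω, R.θ t (astar x) ω ∂μ)
      ≤ ∑ t ∈ Finset.range T, inner ℝ x (∫ ω, R.θ t a ω ∂μ)

/-- `Q̄(a*) = E[∑_t (1 - π_t(a*(X₀) ∣ X₀))]`, where `X₀ ∼ D` is independent of the trial. -/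
noncomputable def Qbar [MeasurableSpace Ω] (R : Trial Ω K d) (P : Params) (D : Measure (Ctx d))
    (μ : Measure Ω) (astar : Ctx d → Fin K) : ℝ :=
  ∫ ω, ∫ x, ∑ t ∈ Finset.range P.T, (1 - R.policy P t ω x (astar x)) ∂D ∂μ

/-- The adversarial regime with a `(Δ, C, T)` self-bounding constraint. -/
def SelfBounding [MeasurableSpace Ω] (R : Trial Ω K d) (P : Params) (D : Measure (Ctx d))
    (μ : Measure Ω) (astar : Ctx d → Fin K) (Δ C : ℝ) : Prop :=
  Δ * R.Qbar P D μ astar - C ≤ R.regret P.T μ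

end Trial

end BoBW

/-!
The algorithm plays exponential weights, since the minimizer of a linear function minus `β` times the
entropy is the Gibbs distribution (`ftrl_eq_softmax`). For a fixed context, the usual potential
argument (`ftrl_regret_le`) bounds the regret measured with the estimated losses by a penalty, the sum
of `(β_{t+1} - β_t) H(q_{t+1})`, and a stability term, the sum of the second moments of the estimated
losses divided by `β_t`. Averaging over a fresh context (`sum_regretDir_le`) makes this a statement
about the parameter estimates, tested against the directions `E[(q_t(a ∣ X) - 1[a*(X) = a]) X]`, which
depend on the history only. It suffices to compare with `a*`, which has the smallest expected loss among
all classifiers, as `θ_t` is chosen before the context is drawn (`sum_loss_optimal_le`).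

The estimates are handled by conditioning. The hypotheses on conditional laws identify the joint law of
the history, the context, the arm and the simulated pairs (`map_pair_eq_compProd`,
`map_seq_eq_compProd`), so that the random variables of a round can be integrated out one after the
other (`integral_freeze`). With `Σ_a = E[π(a ∣ X) X Xᵀ]`, the resampling estimator `Σ̂†` satisfies
`E[Σ̂†] Σ_a = 1 - (1 - δ Σ_a)^{M+1}`. Exploration gives `Σ_a ≥ (γ / K) λ_min`, and the choice of `γ` and
`M` makes the remainder at most `1 / T` (`norm_bias_le`); thus the bias costs a constant times `K` in
total (`integral_inner_θ_le`). For the variance, `q ≤ 2 K π` reduces the stability term to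
`E[tr (Σ_a Σ̂† Σ_a Σ̂†ᵀ)]`. This is at most `2 d` however large `M` is, because the factors
`B = 1 - δ 1[V = a] X Xᵀ` of the resampling satisfy `0 ≤ B ≤ 1`, hence `B² ≤ B`, which makes the traces
of the iterates of `C ↦ E[B C B]` telescope (`trace_second_moment_le`).

The learning rate turns these terms into the total entropy `S = ∑_t H(q_t(X_t))`: the penalty is at
most `2 β₁ √(log K) √S` (`sum_div_sqrt_le`), and `∑_t 1 / β_t` is at most
`(1 + log T) / β₁ · √(1 + S / log K)` (`sum_inv_le`), which also controls the cost of exploration, as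
`γ_t ≤ β₁ / β_t`. The entropy of a distribution is controlled by its mass off a fixed arm
(`entropy_le_mass`), so that `E[S]` is at most `2 (log (K T) + 1) Q̄(a*) + 1`
(`integral_totalEntropy_le`). Finally, `γ₁ ≤ 1` says that `K log T ≤ 2 δ λ_min β₁`, and since
`δ λ_min d ≤ 1`, it follows that `K d log T ≤ 2 β₁` (`K_d_log_le`). Hence the variance, bias and
exploration terms are all at most a constant times
`β₁ √(log K) √(log (K T)) max {√Q̄(a*), 1}`, which is part of the asserted bound.
-/

namespace BoBW

open scoped Matrix.Norms.L2Operator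

/-! ### Exponential weights and follow-the-regularized-leader -/

section FTRL

variable {K : ℕ}

/-- The partition function `∑ₐ exp (-L(a) / β)`. -/
noncomputable def partition (β : ℝ) (L : Fin K → ℝ) : ℝ := ∑ a, Real.exp (-L a / β)

/-- The exponential weights `exp (-L(a) / β) / ∑_b exp (-L(b) / β)`. -/
noncomputable def softmax (β : ℝ) (L : Fin K → ℝ) (a : Fin K) : ℝ :=
  Real.exp (-L a / β) / partition β L

theorem partition_pos [NeZero K] (β : ℝ) (L : Fin K → ℝ) : 0 < partition β L :=
  Finset.sum_pos (fun _ _ => Real.exp_pos _) Finset.univ_nonempty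

theorem softmax_pos [NeZero K] (β : ℝ) (L : Fin K → ℝ) (a : Fin K) : 0 < softmax β L a :=
  div_pos (Real.exp_pos _) (partition_pos β L)

theorem sum_softmax [NeZero K] (β : ℝ) (L : Fin K → ℝ) : ∑ a, softmax β L a = 1 := by
  unfold softmax
  rw [← Finset.sum_div]
  exact div_self (partition_pos β L).ne'

theorem softmax_mem_stdSimplex [NeZero K] (β : ℝ) (L : Fin K → ℝ) :
    softmax β L ∈ stdSimplex ℝ (Fin K) :=
  ⟨fun a => (softmax_pos β L a).le, sum_softmax β L⟩

theorem softmax_le_one [NeZero K] (β : ℝ) (L : Fin K → ℝ) (a : Fin K) : softmax β L a ≤ 1 := by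
  rw [← sum_softmax β L]
  exact Finset.single_le_sum (fun b _ => (softmax_pos β L b).le) (Finset.mem_univ a)

theorem softmax_zero (β : ℝ) (a : Fin K) : softmax β 0 a = 1 / (K : ℝ) := by
  simp [softmax, partition]

theorem log_softmax [NeZero K] (β : ℝ) (L : Fin K → ℝ) (a : Fin K) :
    Real.log (softmax β L a) = -L a / β - Real.log (partition β L) := by
  rw [softmax, Real.log_div (Real.exp_pos _).ne' (partition_pos β L).ne', Real.log_exp]

/-- The Gibbs variational formula: the objective exceeds `-β log Z` by `β` times the relative
entropy with respect to the exponential weights. -/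
theorem ftrlObjective_eq [NeZero K] {β : ℝ} (hβ : 0 < β) (L : Fin K → ℝ) {p : Fin K → ℝ}
    (hp : p ∈ stdSimplex ℝ (Fin K)) :
    ftrlObjective β L p = -β * Real.log (partition β L)
      + β * ∑ a, p a * (Real.log (p a) - Real.log (softmax β L a)) := by
  simp_rw [log_softmax]
  have h1 : ∀ a, p a * (Real.log (p a) - (-L a / β - Real.log (partition β L)))
      = p a * Real.log (p a) + (p a * L a) / β + p a * Real.log (partition β L) := by
    intro a; ring
  simp_rw [h1, Finset.sum_add_distrib, ← Finset.sum_mul, hp.2, ← Finset.sum_div]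
  unfold ftrlObjective entropy
  simp only [one_div, Real.log_inv, mul_neg, Finset.sum_neg_distrib]
  simp_rw [mul_comm (L _)]
  field_simp
  ring

theorem sub_le_mul_log_sub {p s : ℝ} (hp : 0 ≤ p) (hs : 0 < s) :
    p - s ≤ p * (Real.log p - Real.log s) := by
  rcases hp.eq_or_lt with rfl | hp
  · simp [hs.le]
  · have h := Real.log_le_sub_one_of_pos (div_pos hs hp)
    rw [Real.log_div hs.ne' hp.ne'] at h
    have := mul_le_mul_of_nonneg_left h hp.le
    have e : p * (s / p - 1) = s - p := by field_simp
    linarith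

theorem sub_lt_mul_log_sub {p s : ℝ} (hp : 0 ≤ p) (hs : 0 < s) (hne : p ≠ s) :
    p - s < p * (Real.log p - Real.log s) := by
  rcases hp.eq_or_lt with rfl | hp
  · simp [hs]
  · have h := Real.log_lt_sub_one_of_pos (div_pos hs hp)
      (fun h => hne ((div_eq_one_iff_eq hp.ne').1 h).symm)
    rw [Real.log_div hs.ne' hp.ne'] at h
    have := mul_lt_mul_of_pos_left h hp
    have e : p * (s / p - 1) = s - p := by field_simp
    linarith

theorem relEntropy_nonneg [NeZero K] (β : ℝ) (L : Fin K → ℝ) {p : Fin K → ℝ}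
    (hp : p ∈ stdSimplex ℝ (Fin K)) :
    0 ≤ ∑ a, p a * (Real.log (p a) - Real.log (softmax β L a)) := by
  have h : ∑ a, (p a - softmax β L a)
      ≤ ∑ a, p a * (Real.log (p a) - Real.log (softmax β L a)) :=
    Finset.sum_le_sum fun a _ => sub_le_mul_log_sub (hp.1 a) (softmax_pos β L a)
  rwa [Finset.sum_sub_distrib, hp.2, sum_softmax, sub_self] at h

theorem neg_mul_log_partition_le [NeZero K] {β : ℝ} (hβ : 0 < β) (L : Fin K → ℝ)
    {p : Fin K → ℝ} (hp : p ∈ stdSimplex ℝ (Fin K)) :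
    -β * Real.log (partition β L) ≤ ftrlObjective β L p := by
  rw [ftrlObjective_eq hβ L hp]
  have := mul_nonneg hβ.le (relEntropy_nonneg β L hp)
  linarith

theorem ftrlObjective_softmax [NeZero K] {β : ℝ} (hβ : 0 < β) (L : Fin K → ℝ) :
    ftrlObjective β L (softmax β L) = -β * Real.log (partition β L) := by
  rw [ftrlObjective_eq hβ L (softmax_mem_stdSimplex β L)]
  simp

/-- The minimizer is unique and given by the exponential weights. -/
theorem ftrl_eq_softmax [NeZero K] {β : ℝ} (hβ : 0 < β) (L : Fin K → ℝ) :
    ftrl β L = softmax β L := by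
  obtain ⟨hp, hmin⟩ := ftrl_spec (Nat.pos_of_ne_zero (NeZero.ne K)) β L
  by_contra hne
  obtain ⟨b, hb⟩ := Function.ne_iff.1 hne
  have h1 : ∑ a, (ftrl β L a - softmax β L a)
      < ∑ a, ftrl β L a * (Real.log (ftrl β L a) - Real.log (softmax β L a)) :=
    Finset.sum_lt_sum (fun a _ => sub_le_mul_log_sub (hp.1 a) (softmax_pos β L a))
      ⟨b, Finset.mem_univ b, sub_lt_mul_log_sub (hp.1 b) (softmax_pos β L b) hb⟩
  rw [Finset.sum_sub_distrib, hp.2, sum_softmax, sub_self] at h1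
  have h2 : ftrlObjective β L (ftrl β L) ≤ ftrlObjective β L (softmax β L) :=
    hmin (softmax_mem_stdSimplex β L)
  rw [ftrlObjective_eq hβ L hp, ftrlObjective_softmax hβ] at h2
  have := mul_pos hβ h1
  linarith

theorem abs_exp_sub_one_sub_le (x : ℝ) : |Real.exp x - 1 - x| ≤ x ^ 2 * Real.exp |x| := by
  have h := Complex.norm_exp_sub_sum_le_norm_mul_exp (x : ℂ) 2
  simp only [Finset.sum_range_succ, Finset.range_zero, Finset.sum_empty, pow_zero,
    Nat.factorial_zero, Nat.cast_one, div_one, zero_add, pow_one, Nat.factorial_one,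
    Complex.norm_real, Real.norm_eq_abs, sq_abs] at h
  rw [← Complex.ofReal_exp, ← Complex.ofReal_one, ← Complex.ofReal_add, ← Complex.ofReal_sub,
    Complex.norm_real, Real.norm_eq_abs] at h
  rwa [sub_sub]

/-- Effect of one more loss vector on the minimal value `-β log Z` of the objective: it grows at
least by the loss of the exponential weights, up to a second-order term. -/
theorem log_partition_step [NeZero K] {β b : ℝ} (hβ : 0 < β) (L l : Fin K → ℝ)
    (hl : ∀ a, |l a| ≤ b * β) :
    -β * Real.log (partition β L) + ∑ a, softmax β L a * l a
        - Real.exp b * (1 / β * ∑ a, softmax β L a * l a ^ 2)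
      ≤ -β * Real.log (partition β (L + l)) := by
  have hZ : partition β (L + l)
      = partition β L * ∑ a, softmax β L a * Real.exp (-l a / β) := by
    rw [Finset.mul_sum]
    refine Finset.sum_congr rfl fun a _ => ?_
    have e : -(L + l) a / β = -L a / β + -l a / β := by simp only [Pi.add_apply]; ring
    rw [e, Real.exp_add, softmax, ← mul_assoc, mul_div_cancel₀ _ (partition_pos β L).ne']
  have hpos : 0 < ∑ a, softmax β L a * Real.exp (-l a / β) :=
    Finset.sum_pos (fun a _ => mul_pos (softmax_pos β L a) (Real.exp_pos _))
      Finset.univ_nonempty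
  have hstep : ∀ a, softmax β L a * Real.exp (-l a / β)
      ≤ softmax β L a - softmax β L a * l a / β
        + Real.exp b * (softmax β L a * l a ^ 2) / β ^ 2 := by
    intro a
    have h1 : |-l a / β| ≤ b := by
      rw [abs_div, abs_neg, abs_of_pos hβ, div_le_iff₀ hβ]; exact hl a
    have h2 := (le_abs_self _).trans (abs_exp_sub_one_sub_le (-l a / β))
    have h3 : (-l a / β) ^ 2 * Real.exp |-l a / β| ≤ (-l a / β) ^ 2 * Real.exp b := by gcongr
    have h4 : Real.exp (-l a / β) ≤ 1 - l a / β + Real.exp b * l a ^ 2 / β ^ 2 := by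
      have : (-l a / β) ^ 2 * Real.exp b = Real.exp b * l a ^ 2 / β ^ 2 := by
        rw [div_pow, neg_sq]; ring
      have h5 : -l a / β = -(l a / β) := by ring
      linarith
    have := mul_le_mul_of_nonneg_left h4 (softmax_pos β L a).le
    refine this.trans (le_of_eq ?_)
    ring
  have hsum : ∑ a, softmax β L a * Real.exp (-l a / β)
      ≤ 1 - (∑ a, softmax β L a * l a) / β
        + Real.exp b * (∑ a, softmax β L a * l a ^ 2) / β ^ 2 := by
    refine (Finset.sum_le_sum fun a _ => hstep a).trans (le_of_eq ?_)
    rw [Finset.sum_add_distrib, Finset.sum_sub_distrib, sum_softmax, ← Finset.sum_div,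
      ← Finset.sum_div, ← Finset.mul_sum]
  have hlog := Real.log_le_sub_one_of_pos hpos
  rw [hZ, Real.log_mul (partition_pos β L).ne' hpos.ne']
  have h6 : Real.log (∑ a, softmax β L a * Real.exp (-l a / β))
      ≤ - (∑ a, softmax β L a * l a) / β
        + Real.exp b * (∑ a, softmax β L a * l a ^ 2) / β ^ 2 := by
    have : -(∑ a, softmax β L a * l a) / β = -((∑ a, softmax β L a * l a) / β) := by ring
    linarith
  have h7 := mul_le_mul_of_nonneg_left h6 hβ.le
  have h8 : β * (-(∑ a, softmax β L a * l a) / β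
        + Real.exp b * (∑ a, softmax β L a * l a ^ 2) / β ^ 2)
      = -(∑ a, softmax β L a * l a)
        + Real.exp b * (1 / β * ∑ a, softmax β L a * l a ^ 2) := by
    field_simp
  linarith

theorem entropy_le_log [NeZero K] {p : Fin K → ℝ} (hp : p ∈ stdSimplex ℝ (Fin K)) :
    entropy p ≤ Real.log K := by
  have h := neg_mul_log_partition_le one_pos (0 : Fin K → ℝ) hp
  simp [partition, ftrlObjective] at h
  exact h

theorem entropy_nonneg {p : Fin K → ℝ} (hp : p ∈ stdSimplex ℝ (Fin K)) : 0 ≤ entropy p := by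
  refine Finset.sum_nonneg fun a _ => ?_
  have h1 : p a ≤ 1 := by
    rw [← hp.2]; exact Finset.single_le_sum (fun b _ => hp.1 b) (Finset.mem_univ a)
  have := Real.negMulLog_nonneg (hp.1 a) h1
  simpa [Real.negMulLog] using this

/-- The entropy is controlled by the mass off one fixed arm `a₀`: the function `-u log u` lies below
its tangent at `1 / (K T)`, used for the other arms, and below its tangent at `1`, used for `a₀`. -/
theorem entropy_le_mass {T : ℕ} (hT : 1 ≤ T) (hK : 1 ≤ K) {p : Fin K → ℝ}
    (hp : p ∈ stdSimplex ℝ (Fin K)) (a₀ : Fin K) :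
    entropy p ≤ (1 - p a₀) * (Real.log (K * T) + 1) + 1 / T := by
  have hT' : (0 : ℝ) < T := by exact_mod_cast hT
  have hK' : (0 : ℝ) < K := by exact_mod_cast hK
  have htan : ∀ a, p a * Real.log (1 / p a) ≤ p a * Real.log (K * T) + 1 / (K * T) := by
    intro a
    have h := sub_le_mul_log_sub (hp.1 a) (s := 1 / ((K : ℝ) * T)) (by positivity)
    rw [one_div, Real.log_inv] at h ⊢
    have := hp.1 a
    have e : (K * T : ℝ)⁻¹ = 1 / (K * T) := by rw [one_div]
    rw [e] at h
    linarith
  have h0 : p a₀ * Real.log (1 / p a₀) ≤ 1 - p a₀ := by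
    have h := sub_le_mul_log_sub (hp.1 a₀) one_pos
    rw [one_div, Real.log_inv]
    simp only [Real.log_one] at h
    linarith
  unfold entropy
  rw [← Finset.add_sum_erase _ _ (Finset.mem_univ a₀)]
  have h1 : ∑ a ∈ Finset.univ.erase a₀, p a * Real.log (1 / p a)
      ≤ ∑ a ∈ Finset.univ.erase a₀, (p a * Real.log (K * T) + 1 / (K * T)) :=
    Finset.sum_le_sum fun a _ => htan a
  have h2 : ∑ a ∈ Finset.univ.erase a₀, p a = 1 - p a₀ := by
    rw [← hp.2, ← Finset.add_sum_erase _ _ (Finset.mem_univ a₀)]; ring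
  rw [Finset.sum_add_distrib, ← Finset.sum_mul, h2, Finset.sum_const, nsmul_eq_mul] at h1
  have h3 : ((Finset.univ.erase a₀).card : ℝ) * (1 / (K * T)) ≤ 1 / T := by
    have : ((Finset.univ.erase a₀).card : ℝ) ≤ K := by
      exact_mod_cast (Finset.card_le_univ _).trans (by simp)
    calc ((Finset.univ.erase a₀).card : ℝ) * (1 / (K * T)) ≤ K * (1 / (K * T)) := by gcongr
      _ = 1 / T := by field_simp
  linarith

theorem ftrlObjective_change (β β' : ℝ) (L p : Fin K → ℝ) :
    ftrlObjective β' L p = ftrlObjective β L p - (β' - β) * entropy p := by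
  unfold ftrlObjective; ring

/-- Regret of follow-the-regularized-leader with Shannon entropy and varying learning rates,
against a fixed arm, over the `n + 1` rounds `0, …, n`. -/
theorem ftrl_regret_le [NeZero K] {b : ℝ} (β : ℕ → ℝ) (l : ℕ → Fin K → ℝ)
    (hβ : ∀ t, 0 < β t) (n : ℕ) (hl : ∀ t ≤ n, ∀ a, |l t a| ≤ b * β t) (a₀ : Fin K) :
    ∑ t ∈ Finset.range (n + 1),
        (∑ a, softmax (β t) (∑ s ∈ Finset.range t, l s) a * l t a - l t a₀)
      ≤ β 0 * Real.log K
        + ∑ t ∈ Finset.range n, (β (t + 1) - β t)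
            * entropy (softmax (β (t + 1)) (∑ s ∈ Finset.range (t + 1), l s))
        + Real.exp b * ∑ t ∈ Finset.range (n + 1),
            1 / β t * ∑ a, softmax (β t) (∑ s ∈ Finset.range t, l s) a * l t a ^ 2 := by
  -- the potential is the minimal value `-β_m log Z_m`; after a change of the learning rate, the new
  -- minimizer is a competitor for the old objective, which costs the entropy of that minimizer
  have key : ∀ m ≤ n, ∑ t ∈ Finset.range (m + 1),
        ∑ a, softmax (β t) (∑ s ∈ Finset.range t, l s) a * l t a
      ≤ β 0 * Real.log K
        + ∑ t ∈ Finset.range m, (β (t + 1) - β t)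
            * entropy (softmax (β (t + 1)) (∑ s ∈ Finset.range (t + 1), l s))
        + Real.exp b * ∑ t ∈ Finset.range (m + 1),
            1 / β t * ∑ a, softmax (β t) (∑ s ∈ Finset.range t, l s) a * l t a ^ 2
        + -β m * Real.log (partition (β m) (∑ s ∈ Finset.range (m + 1), l s)) := by
    intro m
    induction m with
    | zero =>
      intro hm
      have h := log_partition_step (hβ 0) 0 (l 0) (hl 0 hm)
      simp only [zero_add, Finset.range_one, Finset.sum_singleton, Finset.range_zero,
        Finset.sum_empty, add_zero]
      simp only [zero_add] at h
      have : partition (β 0) (0 : Fin K → ℝ) = K := by simp [partition]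
      rw [this] at h
      linarith
    | succ m ih =>
      intro hm
      have h1 := ih (by omega)
      have h2 := log_partition_step (hβ (m + 1)) (∑ s ∈ Finset.range (m + 1), l s) (l (m + 1))
        (hl (m + 1) hm)
      rw [← Finset.sum_range_succ (fun s => l s) (m + 1)] at h2
      have h3 := neg_mul_log_partition_le (hβ m) (∑ s ∈ Finset.range (m + 1), l s)
        (softmax_mem_stdSimplex (β (m + 1)) (∑ s ∈ Finset.range (m + 1), l s))
      have h4 := ftrlObjective_softmax (hβ (m + 1)) (∑ s ∈ Finset.range (m + 1), l s)
      rw [ftrlObjective_change (β m)] at h4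
      rw [Finset.sum_range_succ (fun t => ∑ a, softmax (β t) (∑ s ∈ Finset.range t, l s) a * l t a)
        (m + 1), Finset.sum_range_succ (fun t => (β (t + 1) - β t)
          * entropy (softmax (β (t + 1)) (∑ s ∈ Finset.range (t + 1), l s))) m,
        Finset.sum_range_succ (fun t =>
          1 / β t * ∑ a, softmax (β t) (∑ s ∈ Finset.range t, l s) a * l t a ^ 2) (m + 1)]
      linarith
  -- in the end, compare the minimal value with the objective at the vertex `a₀`
  have h1 := key n le_rfl
  have h2 := neg_mul_log_partition_le (hβ n) (∑ s ∈ Finset.range (n + 1), l s)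
    (single_mem_stdSimplex ℝ a₀)
  have h3 : ftrlObjective (β n) (∑ s ∈ Finset.range (n + 1), l s) (Pi.single a₀ 1)
      = ∑ s ∈ Finset.range (n + 1), l s a₀ := by
    have : entropy (Pi.single a₀ 1 : Fin K → ℝ) = 0 := by
      refine Finset.sum_eq_zero fun a _ => ?_
      by_cases h : a = a₀
      · subst h; simp
      · simp [h]
    simp [ftrlObjective, this, Pi.single_apply]
  rw [Finset.sum_sub_distrib]
  linarith

end FTRL

/-! ### The entropy-adaptive learning rate -/

section LearningRate

/-- The sum `∑ h_{t+1} / √(1 + (h_0 + ⋯ + h_t) / ℓ)` telescopes against `2 √(ℓ S)`. The summand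
`1` under the root makes up for the missing last entropy `h_{t+1} ≤ ℓ`. -/
theorem sum_div_sqrt_le {h : ℕ → ℝ} {ℓ : ℝ} (hℓ : 0 < ℓ) (h0 : ∀ t, 0 ≤ h t)
    (h1 : ∀ t, h t ≤ ℓ) (n : ℕ) :
    ∑ t ∈ Finset.range n,
        h (t + 1) / Real.sqrt (1 + ℓ⁻¹ * ∑ s ∈ Finset.range (t + 1), h s)
      ≤ 2 * Real.sqrt ℓ * Real.sqrt (∑ s ∈ Finset.range (n + 1), h s) := by
  induction n with
  | zero => simp; positivity
  | succ n ih =>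
    rw [Finset.sum_range_succ]
    set S := ∑ s ∈ Finset.range (n + 1), h s with hS
    have hS0 : 0 ≤ S := Finset.sum_nonneg fun s _ => h0 s
    have hS' : ∑ s ∈ Finset.range (n + 1 + 1), h s = S + h (n + 1) := Finset.sum_range_succ _ _
    rw [hS']
    suffices h (n + 1) / Real.sqrt (1 + ℓ⁻¹ * S)
        ≤ 2 * Real.sqrt ℓ * (Real.sqrt (S + h (n + 1)) - Real.sqrt S) by linarith
    rcases (h0 (n + 1)).eq_or_lt with hz | hz
    · simp [← hz]
    · have hp : 0 < Real.sqrt (S + h (n + 1)) := Real.sqrt_pos.2 (by linarith)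
      have a1 : Real.sqrt (S + h (n + 1)) ≤ Real.sqrt ℓ * Real.sqrt (1 + ℓ⁻¹ * S) := by
        rw [← Real.sqrt_mul hℓ.le]
        refine Real.sqrt_le_sqrt ?_
        rw [mul_add, mul_inv_cancel_left₀ hℓ.ne']
        linarith [h1 (n + 1)]
      have hq : 0 < Real.sqrt (1 + ℓ⁻¹ * S) := Real.sqrt_pos.2 (by positivity)
      rw [div_le_iff₀ hq]
      have a2 : Real.sqrt S ≤ Real.sqrt (S + h (n + 1)) := Real.sqrt_le_sqrt (by linarith)
      have a3 := Real.sq_sqrt hS0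
      have a4 := Real.sq_sqrt (show 0 ≤ S + h (n + 1) by linarith)
      have a5 : h (n + 1) ≤ 2 * Real.sqrt (S + h (n + 1))
          * (Real.sqrt (S + h (n + 1)) - Real.sqrt S) := by nlinarith
      have a6 := mul_le_mul_of_nonneg_right a1 (sub_nonneg.2 a2)
      nlinarith

/-- If the learning rate starts at `B` and grows by at least `B / r` per round, then its inverses sum
to at most a logarithm. -/
theorem sum_inv_le {β : ℕ → ℝ} {B r : ℝ} (hB : 0 < B) (hr : 1 ≤ r) (T : ℕ)
    (h0 : β 0 = B) (hβ : ∀ t, t + 1 < T → β t + B / r ≤ β (t + 1)) :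
    ∑ t ∈ Finset.range T, 1 / β t ≤ r / B * (1 + Real.log T) := by
  have hr0 : 0 < r := by linarith
  have hlow : ∀ t, t < T → B / r * (t + 1) ≤ β t := by
    intro t
    induction t with
    | zero =>
      intro _
      rw [h0]
      simp only [Nat.cast_zero, zero_add, mul_one]
      exact div_le_self hB.le hr
    | succ t ih =>
      intro ht
      have := ih (by omega)
      have := hβ t ht
      push_cast
      linarith
  have h1 : ∀ t ∈ Finset.range T, 1 / β t ≤ r / B * ((t : ℝ) + 1)⁻¹ := by
    intro t ht
    have h2 := hlow t (Finset.mem_range.1 ht)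
    have h3 : 0 < B / r * ((t : ℝ) + 1) := by positivity
    calc 1 / β t ≤ 1 / (B / r * (t + 1)) := one_div_le_one_div_of_le h3 h2
      _ = r / B * ((t : ℝ) + 1)⁻¹ := by field_simp
  refine (Finset.sum_le_sum h1).trans ?_
  rw [← Finset.mul_sum]
  have h4 := harmonic_le_one_add_log T
  have h5 : ((harmonic T : ℚ) : ℝ) = ∑ t ∈ Finset.range T, ((t : ℝ) + 1)⁻¹ := by
    simp [harmonic]
  rw [h5] at h4
  gcongr

/-- A square root lies below its tangents. -/
theorem sqrt_le_tangent {x m : ℝ} (hx : 0 ≤ x) (hm : 0 < m) :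
    Real.sqrt x ≤ (x / Real.sqrt m + Real.sqrt m) / 2 := by
  have h1 := Real.sqrt_pos.2 hm
  have h2 := Real.sq_sqrt hx
  have h3 : x / Real.sqrt m * Real.sqrt m = x := by field_simp
  have h4 := sq_nonneg (Real.sqrt x - Real.sqrt m)
  rw [← mul_le_mul_iff_left₀ h1]
  nlinarith

end LearningRate

/-! ### Traces of products of positive semidefinite matrices -/

section PosSemidef

variable {n : Type*} [Fintype n] [DecidableEq n]

open scoped MatrixOrder in
theorem trace_mul_nonneg_of_posSemidef {A C : Matrix n n ℝ} (hA : A.PosSemidef)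
    (hC : C.PosSemidef) : 0 ≤ (A * C).trace := by
  obtain ⟨B, rfl⟩ := CStarAlgebra.nonneg_iff_eq_star_mul_self.1 hA.nonneg
  rw [Matrix.trace_mul_cycle, Matrix.trace_mul_cycle]
  exact (hC.mul_mul_conjTranspose_same B).trace_nonneg

/-- If `0 ≤ A ≤ r`, then `A (r - A) ≥ 0`, by the identity
`r A (r - A) = A (r - A) A + (r - A) A (r - A)`. -/
theorem posSemidef_mul_sub_self {A : Matrix n n ℝ} {r : ℝ} (hr : 0 < r) (hA : A.PosSemidef)
    (hA' : (r • (1 : Matrix n n ℝ) - A).PosSemidef) : (A * (r • (1 : Matrix n n ℝ) - A)).PosSemidef := by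
  have h1 := hA'.mul_mul_conjTranspose_same A
  have h2 := hA.mul_mul_conjTranspose_same (r • (1 : Matrix n n ℝ) - A)
  rw [hA.isHermitian.eq] at h1
  rw [hA'.isHermitian.eq] at h2
  have h3 := (h1.add h2).smul (inv_nonneg.2 hr.le)
  have : r⁻¹ • (A * (r • (1 : Matrix n n ℝ) - A) * A
      + (r • (1 : Matrix n n ℝ) - A) * A * (r • (1 : Matrix n n ℝ) - A))
      = A * (r • (1 : Matrix n n ℝ) - A) := by
    have : A * (r • (1 : Matrix n n ℝ) - A) * A
      + (r • (1 : Matrix n n ℝ) - A) * A * (r • (1 : Matrix n n ℝ) - A)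
      = r • (A * (r • (1 : Matrix n n ℝ) - A)) := by
      simp only [mul_sub, sub_mul, Matrix.mul_smul, Matrix.smul_mul, mul_one, one_mul, smul_sub]
      abel
    rw [this, smul_smul, inv_mul_cancel₀ hr.ne', one_smul]
  rwa [this] at h3

theorem norm_le_of_posSemidef {A : Matrix n n ℝ} {r : ℝ} (hr : 0 < r) (hA : A.PosSemidef)
    (hA' : (r • (1 : Matrix n n ℝ) - A).PosSemidef) : ‖A‖ ≤ r := by
  rw [Matrix.l2_opNorm_def]
  refine ContinuousLinearMap.opNorm_le_bound _ hr.le fun x => ?_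
  have h1 := (posSemidef_mul_sub_self hr hA hA').dotProduct_mulVec_nonneg x.ofLp
  have h2 := hA'.dotProduct_mulVec_nonneg x.ofLp
  have e1 : x.ofLp ⬝ᵥ x.ofLp = ‖x‖ ^ 2 := by
    rw [EuclideanSpace.real_norm_sq_eq]; simp [dotProduct, sq]
  have e2 : (A.mulVec x.ofLp) ⬝ᵥ (A.mulVec x.ofLp)
      = ‖(Matrix.toEuclideanLin A).toContinuousLinearMap x‖ ^ 2 := by
    rw [EuclideanSpace.real_norm_sq_eq]; simp [dotProduct, sq, Matrix.toLpLin_apply]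
  have e3 : x.ofLp ⬝ᵥ ((A * A).mulVec x.ofLp) = (A.mulVec x.ofLp) ⬝ᵥ (A.mulVec x.ofLp) := by
    rw [← Matrix.mulVec_mulVec, Matrix.dotProduct_mulVec, ← Matrix.mulVec_transpose]
    have : A.transpose = A := by simpa using hA.isHermitian.eq
    rw [this]
  simp only [star_trivial, mul_sub, Matrix.mul_smul, mul_one, Matrix.sub_mulVec, Matrix.smul_mulVec,
    dotProduct_sub, dotProduct_smul, e3, e2, Matrix.one_mulVec, e1, smul_eq_mul] at h1 h2
  refine le_of_sq_le_sq ?_ (by positivity)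
  rw [mul_pow]
  have h3 := mul_nonneg hr.le h2
  change ‖(Matrix.toEuclideanLin A).toContinuousLinearMap x‖ ^ 2 ≤ _
  nlinarith

end PosSemidef

/-! ### Products of i.i.d. random matrices -/

section Resample

variable {Z : Type*} [MeasurableSpace Z]

theorem measurable_update_prod (k : ℕ) :
    Measurable fun p : (ℕ → Z) × Z => Function.update p.1 k p.2 := by
  rw [measurable_pi_iff]
  intro j
  by_cases h : j = k
  · subst h; simpa using measurable_snd
  · simp only [Function.update_of_ne h]
    exact (measurable_pi_apply (X := fun _ : ℕ => Z) j).comp measurable_fst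

variable (ν : Measure Z) [IsProbabilityMeasure ν]

/-- Resampling one coordinate of an i.i.d. sequence does not change its law. -/
theorem map_update_infinitePi (k : ℕ) :
    ((Measure.infinitePi fun _ : ℕ => ν).prod ν).map (fun p => Function.update p.1 k p.2)
      = Measure.infinitePi fun _ : ℕ => ν := by
  have hm := measurable_update_prod (Z := Z) k
  refine Measure.eq_infinitePi _ fun s t ht => ?_
  rw [Measure.map_apply hm (MeasurableSet.pi s.countable_toSet fun i _ => ht i)]
  have : (fun p : (ℕ → Z) × Z => Function.update p.1 k p.2) ⁻¹' ((s : Set ℕ).pi t)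
      = (((s.erase k : Finset ℕ) : Set ℕ).pi t) ×ˢ (if k ∈ s then t k else Set.univ) := by
    ext ⟨z, w⟩
    simp only [Set.mem_preimage, Set.mem_pi, Set.mem_prod, Finset.coe_erase, Set.mem_sdiff,
      Finset.mem_coe, Set.mem_singleton_iff]
    constructor
    · intro h
      refine ⟨fun i hi => by simpa [Function.update_of_ne hi.2] using h i hi.1, ?_⟩
      split_ifs with hk
      · simpa using h k hk
      · trivial
    · rintro ⟨h1, h2⟩ i hi
      by_cases hik : i = k
      · subst hik; simpa [hi] using h2
      · simpa [Function.update_of_ne hik] using h1 i ⟨hi, hik⟩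
  rw [this, Measure.prod_prod, Measure.infinitePi_pi _ fun i _ => ht i]
  split_ifs with hk
  · rw [Finset.prod_erase_mul _ _ hk]
  · rw [Finset.erase_eq_of_notMem hk]; simp

theorem integral_resample {E : Type*} [NormedAddCommGroup E] [NormedSpace ℝ E] (k : ℕ)
    {f : (ℕ → Z) → E} (hf : Integrable f (Measure.infinitePi fun _ : ℕ => ν)) :
    ∫ z, f z ∂(Measure.infinitePi fun _ : ℕ => ν)
      = ∫ z, ∫ w, f (Function.update z k w) ∂ν ∂(Measure.infinitePi fun _ : ℕ => ν) := by
  have hm := measurable_update_prod (Z := Z) k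
  have h1 := map_update_infinitePi ν k
  have hf' : Integrable f
      (((Measure.infinitePi fun _ : ℕ => ν).prod ν).map fun p => Function.update p.1 k p.2) := by
    rwa [h1]
  rw [← integral_prod (fun p : (ℕ → Z) × Z => f (Function.update p.1 k p.2))
    ((integrable_map_measure hf'.1 hm.aemeasurable).1 hf')]
  conv_lhs => rw [← h1]
  exact integral_map hm.aemeasurable hf'.1

theorem ae_infinitePi_forall {p : Z → Prop} (hp : ∀ᵐ w ∂ν, p w) :
    ∀ᵐ z ∂(Measure.infinitePi fun _ : ℕ => ν), ∀ k, p (z k) := by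
  rw [ae_all_iff]
  intro k
  exact (measurePreserving_eval_infinitePi (fun _ : ℕ => ν) k).quasiMeasurePreserving.ae hp

end Resample

section MatrixProd

variable {Z : Type*} {n : Type*} [Fintype n] [DecidableEq n]

/-- The ordered product `B (z 0) B (z 1) ⋯ B (z (k-1))`. -/
def seqProd (B : Z → Matrix n n ℝ) (z : ℕ → Z) : ℕ → Matrix n n ℝ
  | 0 => 1
  | k + 1 => seqProd B z k * B (z k)

theorem seqProd_update (B : Z → Matrix n n ℝ) (z : ℕ → Z) {k j : ℕ} (h : k ≤ j) (w : Z) :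
    seqProd B (Function.update z j w) k = seqProd B z k := by
  induction k with
  | zero => rfl
  | succ k ih =>
    rw [seqProd, seqProd, ih (by omega), Function.update_of_ne (by omega)]

theorem seqProd_update_succ (B : Z → Matrix n n ℝ) (z : ℕ → Z) (j : ℕ) (w : Z) :
    seqProd B (Function.update z j w) (j + 1) = seqProd B z j * B w := by
  rw [seqProd, seqProd_update B z le_rfl, Function.update_self]

theorem norm_one_matrix_le : ‖(1 : Matrix n n ℝ)‖ ≤ 1 := by
  refine norm_le_of_posSemidef one_pos Matrix.PosSemidef.one ?_
  simpa using Matrix.PosSemidef.zero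

theorem norm_seqProd_le {B : Z → Matrix n n ℝ} {z : ℕ → Z} (h : ∀ k, ‖B (z k)‖ ≤ 1) (k : ℕ) :
    ‖seqProd B z k‖ ≤ 1 := by
  induction k with
  | zero => exact norm_one_matrix_le
  | succ k ih =>
    rw [seqProd]
    exact (norm_mul_le _ _).trans (mul_le_one₀ ih (norm_nonneg _) (h k))

theorem stronglyMeasurable_seqProd [MeasurableSpace Z] {B : Z → Matrix n n ℝ}
    (hB : StronglyMeasurable B) (k : ℕ) : StronglyMeasurable fun z => seqProd B z k := by
  induction k with
  | zero => exact stronglyMeasurable_const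
  | succ k ih => exact ih.mul (hB.comp_measurable (measurable_pi_apply k))

end MatrixProd

/-! ### Moments of the geometric resampling estimator

`B` is a random matrix with `0 ≤ B ≤ 1` and `Ψ = E[B]`; the estimator is
`∑_{k ≤ M} B₁ ⋯ B_k`, an unbiased estimator of the truncated Neumann series of `(1 - Ψ)⁻¹`. -/

section Moments

variable {Z : Type*} [MeasurableSpace Z] {n : Type*} [Fintype n] [DecidableEq n]

/-- `B` is a measurable random matrix with `0 ≤ B ≤ 1` almost surely. -/
structure IsContraction (ν : Measure Z) (B : Z → Matrix n n ℝ) : Prop where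
  meas : StronglyMeasurable B
  psd : ∀ᵐ w ∂ν, (B w).PosSemidef
  le_one : ∀ᵐ w ∂ν, (1 - B w).PosSemidef

namespace IsContraction

variable {ν : Measure Z} {B : Z → Matrix n n ℝ}

theorem ae_norm_le (h : IsContraction ν B) : ∀ᵐ w ∂ν, ‖B w‖ ≤ 1 := by
  filter_upwards [h.psd, h.le_one] with w h1 h2
  exact norm_le_of_posSemidef one_pos h1 (by simpa using h2)

/-- A linear functional commutes with the expectation of a random matrix. -/
theorem integral_linear {E : Type*} [MeasurableSpace E] {ρ : Measure E} {f : E → Matrix n n ℝ}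
    {F : Type*} [NormedAddCommGroup F] [NormedSpace ℝ F] [CompleteSpace F]
    (hf : Integrable f ρ) (L : Matrix n n ℝ →ₗ[ℝ] F) :
    ∫ w, L (f w) ∂ρ = L (∫ w, f w ∂ρ) :=
  (LinearMap.toContinuousLinearMap L).integral_comp_comm hf

theorem integrable_linear {E : Type*} [MeasurableSpace E] {ρ : Measure E} {f : E → Matrix n n ℝ}
    {F : Type*} [NormedAddCommGroup F] [NormedSpace ℝ F]
    (hf : Integrable f ρ) (L : Matrix n n ℝ →ₗ[ℝ] F) : Integrable (fun w => L (f w)) ρ :=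
  (LinearMap.toContinuousLinearMap L).integrable_comp hf

theorem posSemidef_integral {f : Z → Matrix n n ℝ} (hf : Integrable f ν)
    (hp : ∀ᵐ w ∂ν, (f w).PosSemidef) : (∫ w, f w ∂ν).PosSemidef := by
  have ht : (∫ w, f w ∂ν).transpose = ∫ w, f w ∂ν := by
    have := integral_linear hf (Matrix.transposeLinearEquiv n n ℝ ℝ).toLinearMap
    change ∫ w, (f w).transpose ∂ν = (∫ w, f w ∂ν).transpose at this
    rw [← this]
    refine integral_congr_ae ?_
    filter_upwards [hp] with w hw
    simpa using hw.isHermitian.eq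
  refine Matrix.PosSemidef.of_dotProduct_mulVec_nonneg (by simpa [Matrix.IsHermitian] using ht) ?_
  intro x
  let L : Matrix n n ℝ →ₗ[ℝ] ℝ :=
    { toFun := fun V => star x ⬝ᵥ V.mulVec x
      map_add' := fun V W => by simp [Matrix.add_mulVec, dotProduct_add]
      map_smul' := fun c V => by simp [Matrix.smul_mulVec, dotProduct_smul] }
  have := integral_linear hf L
  change 0 ≤ L _
  rw [← this]
  refine integral_nonneg_of_ae ?_
  filter_upwards [hp] with w hw using hw.dotProduct_mulVec_nonneg x

variable [IsProbabilityMeasure ν]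

theorem ae_norm_seqProd_le (h : IsContraction ν B) :
    ∀ᵐ z ∂(Measure.infinitePi fun _ : ℕ => ν), ∀ k, ‖seqProd B z k‖ ≤ 1 := by
  filter_upwards [ae_infinitePi_forall ν h.ae_norm_le] with z hz k
  exact norm_seqProd_le hz k

theorem integrable (h : IsContraction ν B) : Integrable B ν :=
  Integrable.of_bound h.meas.aestronglyMeasurable 1 h.ae_norm_le

theorem integrable_seqProd (h : IsContraction ν B) (k : ℕ) :
    Integrable (fun z => seqProd B z k) (Measure.infinitePi fun _ : ℕ => ν) := by
  refine Integrable.of_bound (stronglyMeasurable_seqProd h.meas k).aestronglyMeasurable 1 ?_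
  filter_upwards [h.ae_norm_seqProd_le] with z hz using hz k

theorem integral_seqProd (h : IsContraction ν B) (k : ℕ) :
    ∫ z, seqProd B z k ∂(Measure.infinitePi fun _ : ℕ => ν) = (∫ w, B w ∂ν) ^ k := by
  induction k with
  | zero => simp [seqProd]
  | succ k ih =>
    rw [integral_resample ν k (h.integrable_seqProd (k + 1))]
    simp_rw [seqProd_update_succ]
    have h1 : ∀ z, ∫ w, seqProd B z k * B w ∂ν = seqProd B z k * ∫ w, B w ∂ν := fun z =>
      integral_linear h.integrable (LinearMap.mulLeft ℝ (seqProd B z k))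
    simp_rw [h1]
    rw [pow_succ, ← ih]
    exact integral_linear (h.integrable_seqProd k) (LinearMap.mulRight ℝ (∫ w, B w ∂ν))

theorem psd_mean (h : IsContraction ν B) : (∫ w, B w ∂ν).PosSemidef :=
  posSemidef_integral h.integrable h.psd

theorem psd_one_sub_mean (h : IsContraction ν B) : (1 - ∫ w, B w ∂ν).PosSemidef := by
  have : 1 - ∫ w, B w ∂ν = ∫ w, (1 - B w) ∂ν := by
    rw [integral_sub (integrable_const _) h.integrable]; simp
  rw [this]
  exact posSemidef_integral ((integrable_const _).sub h.integrable) h.le_one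

/-- The functional `X ↦ tr (A V X U)`. -/
def traceLin (A V U : Matrix n n ℝ) : Matrix n n ℝ →ₗ[ℝ] ℝ where
  toFun X := (A * V * X * U).trace
  map_add' X Y := by simp [mul_add, add_mul]
  map_smul' c X := by simp

theorem integrable_trace (h : IsContraction ν B) (A C : Matrix n n ℝ) (j k : ℕ) :
    Integrable (fun z => (A * seqProd B z j * C * (seqProd B z k).transpose).trace)
      (Measure.infinitePi fun _ : ℕ => ν) := by
  have hm : StronglyMeasurable
      fun z => (A * seqProd B z j * C * (seqProd B z k).transpose) := by
    have h1 := stronglyMeasurable_seqProd h.meas j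
    have h2 := stronglyMeasurable_seqProd h.meas k
    have h3 : StronglyMeasurable fun z => (seqProd B z k).transpose :=
      (continuous_id.matrix_transpose).comp_stronglyMeasurable h2
    exact ((h1.const_mul A).mul_const C).mul h3
  refine integrable_linear (Integrable.of_bound hm.aestronglyMeasurable (‖A‖ * ‖C‖) ?_)
    (Matrix.traceLinearMap n ℝ ℝ)
  filter_upwards [h.ae_norm_seqProd_le] with z hz
  have h1 : ‖(seqProd B z k).transpose‖ ≤ 1 := by
    have := Matrix.l2_opNorm_conjTranspose (seqProd B z k)
    rw [Matrix.conjTranspose_eq_transpose_of_trivial] at this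
    exact this.trans_le (hz k)
  calc ‖A * seqProd B z j * C * (seqProd B z k).transpose‖
      ≤ ‖A‖ * ‖seqProd B z j‖ * ‖C‖ * ‖(seqProd B z k).transpose‖ := by
        refine (norm_mul_le _ _).trans (mul_le_mul_of_nonneg_right ?_ (norm_nonneg _))
        refine (norm_mul_le _ _).trans (mul_le_mul_of_nonneg_right ?_ (norm_nonneg _))
        exact norm_mul_le _ _
    _ ≤ ‖A‖ * 1 * ‖C‖ * 1 := by gcongr; exact hz j
    _ = ‖A‖ * ‖C‖ := by ring

/-- The expectation of `tr (A V_j C V_kᵀ)`. -/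
noncomputable def crossMoment (ν : Measure Z) [IsProbabilityMeasure ν] (B : Z → Matrix n n ℝ)
    (A C : Matrix n n ℝ) (j k : ℕ) : ℝ :=
  ∫ z, (A * seqProd B z j * C * (seqProd B z k).transpose).trace
    ∂(Measure.infinitePi fun _ : ℕ => ν)

/-- Averaging over the last factor of the longer product, which the shorter one does not involve. -/
theorem crossMoment_succ_left (h : IsContraction ν B) (A C : Matrix n n ℝ) {j k : ℕ}
    (hkj : k ≤ j) : crossMoment ν B A C (j + 1) k = crossMoment ν B A ((∫ w, B w ∂ν) * C) j k := by
  unfold crossMoment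
  rw [integral_resample ν j (h.integrable_trace A C (j + 1) k)]
  refine integral_congr_ae (Filter.Eventually.of_forall fun z => ?_)
  simp only [seqProd_update_succ, seqProd_update B z hkj]
  have := integral_linear h.integrable (traceLin A (seqProd B z j) (C * (seqProd B z k).transpose))
  simpa [traceLin, mul_assoc] using this

theorem crossMoment_add_left (h : IsContraction ν B) (A C : Matrix n n ℝ) (i k : ℕ) :
    crossMoment ν B A C (k + i) k = crossMoment ν B A ((∫ w, B w ∂ν) ^ i * C) k k := by
  induction i generalizing C with
  | zero => simp
  | succ i ih =>
    rw [← add_assoc, h.crossMoment_succ_left A C (by omega), ih, pow_succ, mul_assoc]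

/-- The map `Φ(C) = E[B C B]`. -/
noncomputable def sandwich (ν : Measure Z) (B : Z → Matrix n n ℝ) (C : Matrix n n ℝ) :
    Matrix n n ℝ := ∫ w, B w * C * B w ∂ν

theorem integrable_sandwich (h : IsContraction ν B) (C : Matrix n n ℝ) :
    Integrable (fun w => B w * C * B w) ν := by
  refine Integrable.of_bound ((h.meas.mul_const C).mul h.meas).aestronglyMeasurable ‖C‖ ?_
  filter_upwards [h.ae_norm_le] with w hw
  calc ‖B w * C * B w‖ ≤ ‖B w‖ * ‖C‖ * ‖B w‖ := by
        refine (norm_mul_le _ _).trans (mul_le_mul_of_nonneg_right ?_ (norm_nonneg _))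
        exact norm_mul_le _ _
    _ ≤ 1 * ‖C‖ * 1 := by gcongr
    _ = ‖C‖ := by ring

theorem posSemidef_sandwich (h : IsContraction ν B) {C : Matrix n n ℝ} (hC : C.PosSemidef) :
    (sandwich ν B C).PosSemidef := by
  refine posSemidef_integral (h.integrable_sandwich C) ?_
  filter_upwards [h.psd] with w hw
  have := hC.mul_mul_conjTranspose_same (B w)
  rwa [hw.isHermitian.eq] at this

/-- Since `B² ≤ B`, one resampling step shrinks the trace: `tr Φ(C) ≤ tr (Ψ C)`. -/
theorem trace_sandwich_le (h : IsContraction ν B) {C : Matrix n n ℝ} (hC : C.PosSemidef) :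
    (sandwich ν B C).trace ≤ ((∫ w, B w ∂ν) * C).trace := by
  have h1 := integral_linear (h.integrable_sandwich C) (Matrix.traceLinearMap n ℝ ℝ)
  have h2 := integral_linear h.integrable (traceLin 1 1 C)
  simp only [Matrix.traceLinearMap_apply, traceLin, LinearMap.coe_mk, AddHom.coe_mk, one_mul]
    at h1 h2
  rw [sandwich, ← h1, ← h2]
  refine integral_mono_ae (integrable_linear (h.integrable_sandwich C) (Matrix.traceLinearMap n ℝ ℝ))
    (by simpa [traceLin] using integrable_linear h.integrable (traceLin 1 1 C)) ?_
  filter_upwards [h.psd, h.le_one] with w h3 h4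
  have h5 := posSemidef_mul_sub_self one_pos h3 (by simpa using h4)
  have h6 := trace_mul_nonneg_of_posSemidef h5 hC
  have h7 : (B w * C * B w).trace = (B w * B w * C).trace := by
    rw [Matrix.trace_mul_cycle]
  simp only [one_smul, mul_sub, mul_one, sub_mul, Matrix.trace_sub] at h6
  rw [h7]; linarith

/-- Averaging over the last factor of both products. -/
theorem crossMoment_succ_succ (h : IsContraction ν B) (A C : Matrix n n ℝ) (k : ℕ) :
    crossMoment ν B A C (k + 1) (k + 1) = crossMoment ν B A (sandwich ν B C) k k := by
  unfold crossMoment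
  rw [integral_resample ν k (h.integrable_trace A C (k + 1) (k + 1))]
  refine integral_congr_ae (Filter.Eventually.of_forall fun z => ?_)
  simp only [seqProd_update_succ]
  have := integral_linear (h.integrable_sandwich C)
    (traceLin A (seqProd B z k) ((seqProd B z k).transpose))
  simp only [traceLin, LinearMap.coe_mk, AddHom.coe_mk] at this
  rw [sandwich, ← this]
  refine integral_congr_ae ?_
  filter_upwards [h.psd] with w hw
  have : (B w).transpose = B w := by simpa using hw.isHermitian.eq
  simp only [Matrix.transpose_mul, this, mul_assoc]

theorem crossMoment_diag (h : IsContraction ν B) (A C : Matrix n n ℝ) (k : ℕ) :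
    crossMoment ν B A C k k = (A * (sandwich ν B)^[k] C).trace := by
  induction k generalizing C with
  | zero => simp [crossMoment, seqProd]
  | succ k ih => rw [h.crossMoment_succ_succ, ih, Function.iterate_succ_apply]

theorem posSemidef_iterate_sandwich (h : IsContraction ν B) {C : Matrix n n ℝ}
    (hC : C.PosSemidef) (k : ℕ) : ((sandwich ν B)^[k] C).PosSemidef := by
  induction k with
  | zero => exact hC
  | succ k ih => rw [Function.iterate_succ_apply']; exact h.posSemidef_sandwich ih

theorem crossMoment_add (h : IsContraction ν B) (A C C' : Matrix n n ℝ) (j k : ℕ) :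
    crossMoment ν B A (C + C') j k = crossMoment ν B A C j k + crossMoment ν B A C' j k := by
  unfold crossMoment
  rw [← integral_add (h.integrable_trace A C j k) (h.integrable_trace A C' j k)]
  simp [mul_add, add_mul]

theorem crossMoment_sum (h : IsContraction ν B) (A : Matrix n n ℝ) {ι : Type*} (s : Finset ι)
    (C : ι → Matrix n n ℝ) (j k : ℕ) :
    crossMoment ν B A (∑ i ∈ s, C i) j k = ∑ i ∈ s, crossMoment ν B A (C i) j k := by
  classical
  induction s using Finset.induction_on with
  | empty => simp [crossMoment]
  | insert i s hi ih => rw [Finset.sum_insert hi, Finset.sum_insert hi, h.crossMoment_add, ih]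

theorem crossMoment_diag_nonneg (h : IsContraction ν B) {A C : Matrix n n ℝ}
    (hA : A.PosSemidef) (hC : C.PosSemidef) (k : ℕ) : 0 ≤ crossMoment ν B A C k k := by
  rw [h.crossMoment_diag]
  exact trace_mul_nonneg_of_posSemidef hA (h.posSemidef_iterate_sandwich hC k)

theorem crossMoment_comm {A C : Matrix n n ℝ} (hA : A.transpose = A)
    (hC : C.transpose = C) (j k : ℕ) : crossMoment ν B A C j k = crossMoment ν B A C k j := by
  unfold crossMoment
  refine integral_congr_ae (Filter.Eventually.of_forall fun z => ?_)
  simp only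
  rw [← Matrix.trace_transpose]
  simp only [Matrix.transpose_mul, Matrix.transpose_transpose, hA, hC]
  rw [← mul_assoc, ← mul_assoc, Matrix.trace_mul_comm, mul_assoc, mul_assoc, mul_assoc]

/-- Summing the geometric series in the later index removes one factor `1 - Ψ`. -/
theorem sum_crossMoment_le (h : IsContraction ν B) {A : Matrix n n ℝ} (hA : A.PosSemidef)
    (k m : ℕ) :
    ∑ i ∈ Finset.range m, crossMoment ν B A (1 - ∫ w, B w ∂ν) (k + i) k
      ≤ crossMoment ν B A 1 k k := by
  simp_rw [h.crossMoment_add_left]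
  rw [← h.crossMoment_sum, ← Finset.sum_mul, geom_sum_mul_neg]
  have h1 := h.crossMoment_add A (1 - (∫ w, B w ∂ν) ^ m) ((∫ w, B w ∂ν) ^ m) k k
  have h2 := h.crossMoment_diag_nonneg hA (h.psd_mean.pow m) k
  simp only [sub_add_cancel] at h1
  linarith

/-- Telescoping of the traces `tr Φᵏ(1)`. -/
theorem sum_crossMoment_diag_le (h : IsContraction ν B) (m : ℕ) :
    ∑ k ∈ Finset.range m, crossMoment ν B (1 - ∫ w, B w ∂ν) 1 k k ≤ Fintype.card n := by
  suffices ∑ k ∈ Finset.range m, crossMoment ν B (1 - ∫ w, B w ∂ν) 1 k k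
      ≤ Fintype.card n - ((sandwich ν B)^[m] 1).trace by
    have := (h.posSemidef_iterate_sandwich Matrix.PosSemidef.one m).trace_nonneg
    linarith
  induction m with
  | zero => simp [Matrix.trace_one]
  | succ m ih =>
    rw [Finset.sum_range_succ, h.crossMoment_diag, Function.iterate_succ_apply']
    have := h.trace_sandwich_le (h.posSemidef_iterate_sandwich Matrix.PosSemidef.one m)
    rw [sub_mul, one_mul, Matrix.trace_sub]
    linarith

/-- A symmetric double sum is at most twice its part on and below the diagonal. -/
theorem sum_sum_le_two_mul_of_symm {c : ℕ → ℕ → ℝ} (hs : ∀ j k, c j k = c k j)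
    (h0 : ∀ k, 0 ≤ c k k) (m : ℕ) :
    ∑ j ∈ Finset.range m, ∑ k ∈ Finset.range m, c j k
      ≤ 2 * ∑ k ∈ Finset.range m, ∑ i ∈ Finset.range (m - k), c (k + i) k := by
  induction m with
  | zero => simp
  | succ m ih =>
    have e1 : ∑ j ∈ Finset.range (m + 1), ∑ k ∈ Finset.range (m + 1), c j k
        = ∑ j ∈ Finset.range m, ∑ k ∈ Finset.range m, c j k
          + 2 * ∑ k ∈ Finset.range m, c m k + c m m := by
      rw [Finset.sum_range_succ]
      simp_rw [Finset.sum_range_succ _ m]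
      rw [Finset.sum_add_distrib]
      have : ∑ j ∈ Finset.range m, c j m = ∑ k ∈ Finset.range m, c m k :=
        Finset.sum_congr rfl fun j _ => hs j m
      rw [this]; ring
    have e2 : ∑ k ∈ Finset.range (m + 1), ∑ i ∈ Finset.range (m + 1 - k), c (k + i) k
        = ∑ k ∈ Finset.range m, ∑ i ∈ Finset.range (m - k), c (k + i) k
          + ∑ k ∈ Finset.range m, c m k + c m m := by
      rw [Finset.sum_range_succ, ← Finset.sum_add_distrib]
      congr 1
      · refine Finset.sum_congr rfl fun k hk => ?_
        have hk' := Finset.mem_range.1 hk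
        rw [Nat.sub_add_comm hk'.le, Finset.sum_range_succ, Nat.add_sub_cancel' hk'.le]
      · simp
    rw [e1, e2]
    have := h0 m
    linarith

/-- The second moment of the resampling estimator `S = ∑_{k < m} V_k`:
`E[tr ((1-Ψ) S (1-Ψ) Sᵀ)] ≤ 2 dim`, whatever `m` is. By symmetry it suffices to bound the pairs
`(k + i, k)`; summing over `i` removes one factor `1 - Ψ`, and the sum over `k` telescopes. -/
theorem trace_second_moment_le (h : IsContraction ν B) (m : ℕ) :
    ∫ z, ((1 - ∫ w, B w ∂ν) * (∑ k ∈ Finset.range m, seqProd B z k) * (1 - ∫ w, B w ∂ν)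
      * (∑ k ∈ Finset.range m, seqProd B z k).transpose).trace
      ∂(Measure.infinitePi fun _ : ℕ => ν) ≤ 2 * Fintype.card n := by
  set A := 1 - ∫ w, B w ∂ν with hAdef
  have hA : A.PosSemidef := h.psd_one_sub_mean
  have hAt : A.transpose = A := by simpa using hA.isHermitian.eq
  have e : ∀ z, (A * (∑ k ∈ Finset.range m, seqProd B z k) * A
      * (∑ k ∈ Finset.range m, seqProd B z k).transpose).trace
      = ∑ j ∈ Finset.range m, ∑ k ∈ Finset.range m,
        (A * seqProd B z j * A * (seqProd B z k).transpose).trace := by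
    intro z
    simp only [Matrix.transpose_sum, Finset.mul_sum, Finset.sum_mul, Matrix.trace_sum]
    rw [Finset.sum_comm]
  simp_rw [e]
  rw [integral_finsetSum _ fun j _ => integrable_finsetSum _ fun k _ => h.integrable_trace A A j k]
  have e2 : ∀ j ∈ Finset.range m, ∫ z, ∑ k ∈ Finset.range m,
      (A * seqProd B z j * A * (seqProd B z k).transpose).trace
        ∂(Measure.infinitePi fun _ : ℕ => ν) = ∑ k ∈ Finset.range m, crossMoment ν B A A j k := by
    intro j _
    rw [integral_finsetSum _ fun k _ => h.integrable_trace A A j k]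
    rfl
  rw [Finset.sum_congr rfl e2]
  refine (sum_sum_le_two_mul_of_symm (fun j k => crossMoment_comm hAt hAt j k)
    (fun k => h.crossMoment_diag_nonneg hA hA k) m).trans ?_
  have : ∑ k ∈ Finset.range m, ∑ i ∈ Finset.range (m - k), crossMoment ν B A A (k + i) k
      ≤ Fintype.card n :=
    (Finset.sum_le_sum fun k _ => h.sum_crossMoment_le hA k (m - k)).trans
      (h.sum_crossMoment_diag_le m)
  linarith

end IsContraction

end Moments

/-! ### Joint laws from conditional laws -/

section PairLaw

variable {X : Type*} [MeasurableSpace X] {K : ℕ}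

/-- The law of a pair `(x, a)` with `x ∼ D` and `a ∼ p(· ∣ x)`. -/
noncomputable def pairLaw (D : Measure X) (p : X → Fin K → ℝ) : Measure (X × Fin K) :=
  ∑ a, (D.withDensity fun x => ENNReal.ofReal (p x a)).map fun x => (x, a)

/-- A measurable stochastic policy. -/
structure IsPolicy (p : X → Fin K → ℝ) : Prop where
  meas : ∀ a, Measurable fun x => p x a
  mem : ∀ x, p x ∈ stdSimplex ℝ (Fin K)

theorem IsPolicy.le_one {p : X → Fin K → ℝ} (hp : IsPolicy p) (x : X) (a : Fin K) : p x a ≤ 1 := by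
  rw [← (hp.mem x).2]
  exact Finset.single_le_sum (fun b _ => (hp.mem x).1 b) (Finset.mem_univ a)

theorem pairLaw_apply (D : Measure X) (p : X → Fin K → ℝ)
    {s : Set (X × Fin K)} (hs : MeasurableSet s) :
    pairLaw D p s
      = ∑ a, ∫⁻ x, s.indicator (fun z => ENNReal.ofReal (p z.1 z.2)) (x, a) ∂D := by
  rw [pairLaw, Measure.finsetSum_apply]
  refine Finset.sum_congr rfl fun a _ => ?_
  have hm : Measurable fun x : X => (x, a) := measurable_prodMk_right
  rw [Measure.map_apply hm hs, withDensity_apply _ (hm hs), ← lintegral_indicator (hm hs)]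
  rfl

theorem pairLaw_prod_singleton (D : Measure X) (p : X → Fin K → ℝ) {s : Set X}
    (hs : MeasurableSet s) (b : Fin K) :
    pairLaw D p (s ×ˢ {b}) = ∫⁻ x in s, ENNReal.ofReal (p x b) ∂D := by
  rw [pairLaw_apply D p (hs.prod (measurableSet_singleton b)), Finset.sum_eq_single b]
  · rw [← lintegral_indicator hs]
    refine lintegral_congr fun x => ?_
    by_cases h : x ∈ s <;> simp [h]
  · intro a _ hab
    simp [hab]
  · simp

variable (D : Measure X)

theorem isProbabilityMeasure_pairLaw [IsProbabilityMeasure D] {p : X → Fin K → ℝ} (hp : IsPolicy p) :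
    IsProbabilityMeasure (pairLaw D p) := by
  constructor
  rw [pairLaw_apply D p MeasurableSet.univ]
  simp only [Set.indicator_univ]
  rw [← lintegral_finsetSum _ fun a _ => (hp.meas a).ennreal_ofReal]
  have : ∀ x, ∑ a, ENNReal.ofReal (p x a) = 1 := by
    intro x
    rw [← ENNReal.ofReal_sum_of_nonneg fun a _ => (hp.mem x).1 a, (hp.mem x).2, ENNReal.ofReal_one]
  simp [this]

theorem integral_pairLaw {E : Type*} [NormedAddCommGroup E] [NormedSpace ℝ E]
    {p : X → Fin K → ℝ} (hp : IsPolicy p) {f : X × Fin K → E} (hf : StronglyMeasurable f)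
    (hi : Integrable f (pairLaw D p)) :
    ∫ z, f z ∂(pairLaw D p) = ∑ a, ∫ x, p x a • f (x, a) ∂D := by
  unfold pairLaw at hi ⊢
  rw [integral_finsetSum_measure fun a ha => hi.mono_measure (Finset.single_le_sum
    (f := fun a => (D.withDensity fun x => ENNReal.ofReal (p x a)).map fun x => (x, a))
    (fun _ _ => Measure.zero_le _) ha)]
  refine Finset.sum_congr rfl fun a _ => ?_
  rw [integral_map measurable_prodMk_right.aemeasurable hf.aestronglyMeasurable,
    integral_withDensity_eq_integral_toReal_smul (hp.meas a).ennreal_ofReal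
      (Filter.Eventually.of_forall fun _ => ENNReal.ofReal_lt_top)]
  refine integral_congr_ae (Filter.Eventually.of_forall fun x => ?_)
  simp only
  rw [ENNReal.toReal_ofReal ((hp.mem x).1 a)]

theorem ae_pairLaw {p : X → Fin K → ℝ} {q : X → Prop}
    (hq : ∀ᵐ x ∂D, q x) : ∀ᵐ z ∂(pairLaw D p), q z.1 := by
  unfold pairLaw
  rw [ae_iff, Measure.finsetSum_apply, Finset.sum_eq_zero]
  intro a _
  have h1 : ∀ᵐ x ∂(D.withDensity fun x => ENNReal.ofReal (p x a)), q x :=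
    withDensity_absolutelyContinuous _ _ hq
  obtain ⟨s, hs1, hs2, hs3⟩ := exists_measurable_superset_of_null (ae_iff.1 h1)
  have h2 : MeasurableSet (Prod.fst ⁻¹' s : Set (X × Fin K)) := measurable_fst hs2
  refine measure_mono_null (t := Prod.fst ⁻¹' s) (fun z hz => hs1 hz) ?_
  rw [Measure.map_apply measurable_prodMk_right h2]
  exact hs3

variable [IsProbabilityMeasure D]

theorem measurable_pairLaw {Y : Type*} [MeasurableSpace Y] {p : Y → X → Fin K → ℝ}
    (hm : ∀ a, Measurable fun q : Y × X => p q.1 q.2 a) :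
    Measurable fun y => pairLaw D (p y) := by
  refine Measure.measurable_of_measurable_coe _ fun s hs => ?_
  simp_rw [fun y => pairLaw_apply D (p y) hs]
  refine Finset.measurable_sum _ fun a _ => ?_
  have hprod : Measurable fun q : Y × X => s.indicator
      (fun z => ENNReal.ofReal (p q.1 z.1 z.2)) (q.2, a) := by
    have h1 : MeasurableSet {q : Y × X | (q.2, a) ∈ s} :=
      (measurable_snd.prodMk measurable_const) hs
    have h2 := (hm a).ennreal_ofReal.indicator h1
    exact h2
  exact hprod.lintegral_prod_right'

/-- The law of an i.i.d. sequence of pairs, as a function of the policy. -/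
theorem measurable_infinitePi_pairLaw {Y : Type*} [MeasurableSpace Y] {p : Y → X → Fin K → ℝ}
    (hp : ∀ y, IsPolicy (p y)) (hm : ∀ a, Measurable fun q : Y × X => p q.1 q.2 a) :
    Measurable fun y => Measure.infinitePi fun _ : ℕ => pairLaw D (p y) := by
  have := fun y => isProbabilityMeasure_pairLaw D (hp y)
  refine Measurable.measure_of_isPiSystem_of_isProbabilityMeasure
    (generateFrom_squareCylinders (ι := ℕ) (α := fun _ => X × Fin K)).symm
    (isPiSystem_squareCylinders (fun _ => MeasurableSpace.isPiSystem_measurableSet) (by simp)) ?_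
  rintro s ⟨I, t, ht, rfl⟩
  have ht' : ∀ i ∈ I, MeasurableSet (t i) := fun i _ => by simpa using ht i (Set.mem_univ i)
  simp_rw [fun y => Measure.infinitePi_pi (fun _ : ℕ => pairLaw D (p y)) ht']
  exact Finset.measurable_prod _ fun i hi =>
    (Measure.measurable_coe (ht' i hi)).comp (measurable_pairLaw D hm)

/-- The kernel `y ↦` law of `(x, a)`, `x ∼ D`, `a ∼ p_y(· ∣ x)`. -/
noncomputable def pairKernel {Y : Type*} [MeasurableSpace Y] {p : Y → X → Fin K → ℝ}
    (_hp : ∀ y, IsPolicy (p y)) (hm : ∀ a, Measurable fun q : Y × X => p q.1 q.2 a) :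
    Kernel Y (X × Fin K) := ⟨_, measurable_pairLaw D hm⟩

instance {Y : Type*} [MeasurableSpace Y] {p : Y → X → Fin K → ℝ}
    (hp : ∀ y, IsPolicy (p y)) (hm : ∀ a, Measurable fun q : Y × X => p q.1 q.2 a) :
    IsMarkovKernel (pairKernel D hp hm) := ⟨fun y => isProbabilityMeasure_pairLaw D (hp y)⟩

/-- The kernel `y ↦` law of an i.i.d. sequence of such pairs. -/
noncomputable def seqKernel {Y : Type*} [MeasurableSpace Y] {p : Y → X → Fin K → ℝ}
    (hp : ∀ y, IsPolicy (p y)) (hm : ∀ a, Measurable fun q : Y × X => p q.1 q.2 a) :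
    Kernel Y (ℕ → X × Fin K) := ⟨_, measurable_infinitePi_pairLaw D hp hm⟩

instance {Y : Type*} [MeasurableSpace Y] {p : Y → X → Fin K → ℝ}
    (hp : ∀ y, IsPolicy (p y)) (hm : ∀ a, Measurable fun q : Y × X => p q.1 q.2 a) :
    IsMarkovKernel (seqKernel D hp hm) := by
  refine ⟨fun y => ?_⟩
  have := isProbabilityMeasure_pairLaw D (hp y)
  exact inferInstanceAs (IsProbabilityMeasure (Measure.infinitePi fun _ : ℕ => pairLaw D (p y)))

end PairLaw

section Freeze

variable {Ω Ω' S : Type*} {mΩ : MeasurableSpace Ω} [MeasurableSpace Ω'] [mS : MeasurableSpace S]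
  {μ : Measure Ω} [IsProbabilityMeasure μ]

/-- A conditional law known on a π-system determines the joint law. -/
theorem map_prodMk_eq_compProd {Y : Ω → Ω'} {Z : Ω → S} (hY : Measurable Y) (hZ : Measurable Z)
    (κ : Kernel Ω' S) [IsMarkovKernel κ] (C : Set (Set S))
    (hC : mS = MeasurableSpace.generateFrom C) (hpi : IsPiSystem C)
    (h : ∀ A, MeasurableSet A → ∀ c ∈ C,
      μ (Y ⁻¹' A ∩ Z ⁻¹' c) = ∫⁻ ω in Y ⁻¹' A, κ (Y ω) c ∂μ) :
    μ.map (fun ω => (Y ω, Z ω)) = (μ.map Y) ⊗ₘ κ := by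
  have hYZ : Measurable fun ω => (Y ω, Z ω) := hY.prodMk hZ
  have : IsProbabilityMeasure (μ.map fun ω => (Y ω, Z ω)) :=
    Measure.isProbabilityMeasure_map hYZ.aemeasurable
  have : IsProbabilityMeasure (μ.map Y) := Measure.isProbabilityMeasure_map hY.aemeasurable
  refine Measure.ext_prod fun {A c} hA hc => ?_
  rw [Measure.map_apply hYZ (hA.prod hc), Measure.compProd_apply_prod hA hc,
    setLIntegral_map hA (κ.measurable_coe hc) hY]
  have e1 : (fun ω => (Y ω, Z ω)) ⁻¹' (A ×ˢ c) = Y ⁻¹' A ∩ Z ⁻¹' c := rfl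
  rw [e1]
  have hκY : Measurable fun ω => κ (Y ω) := κ.measurable.comp hY
  have key : (μ.restrict (Y ⁻¹' A)).map Z = (μ.restrict (Y ⁻¹' A)).bind (fun ω => κ (Y ω)) := by
    refine ext_of_generate_finite C hC hpi (fun s hs => ?_) ?_
    · have hsm : MeasurableSet s := by rw [hC]; exact MeasurableSpace.measurableSet_generateFrom hs
      rw [Measure.map_apply hZ hsm, Measure.restrict_apply (hZ hsm),
        Measure.bind_apply hsm hκY.aemeasurable, Set.inter_comm]
      exact h A hA s hs
    · rw [Measure.map_apply hZ MeasurableSet.univ,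
        Measure.bind_apply MeasurableSet.univ hκY.aemeasurable]
      simp
  have h2 := congrArg (fun ρ : Measure S => ρ c) key
  rw [Measure.map_apply hZ hc, Measure.restrict_apply (hZ hc),
    Measure.bind_apply hc hκY.aemeasurable, Set.inter_comm] at h2
  exact h2

/-- Integrating out `Z` given `Y`: the kernel `κ` is the conditional law of `Z`, and `Y` is kept
fixed in the inner integral. -/
theorem integral_freeze {E : Type*} [NormedAddCommGroup E] [NormedSpace ℝ E] {Y : Ω → Ω'}
    {Z : Ω → S} (hY : Measurable Y) (hZ : Measurable Z) {κ : Kernel Ω' S} [IsMarkovKernel κ]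
    (hlaw : μ.map (fun ω => (Y ω, Z ω)) = (μ.map Y) ⊗ₘ κ) {F : Ω' → S → E}
    (hF : StronglyMeasurable (Function.uncurry F)) (hi : Integrable (fun ω => F (Y ω) (Z ω)) μ) :
    ∫ ω, F (Y ω) (Z ω) ∂μ = ∫ ω, ∫ z, F (Y ω) z ∂(κ (Y ω)) ∂μ := by
  have hYZ : Measurable fun ω => (Y ω, Z ω) := hY.prodMk hZ
  have : IsProbabilityMeasure (μ.map Y) := Measure.isProbabilityMeasure_map hY.aemeasurable
  have h1 : ∫ ω, F (Y ω) (Z ω) ∂μ = ∫ q, Function.uncurry F q ∂(μ.map fun ω => (Y ω, Z ω)) :=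
    (integral_map hYZ.aemeasurable hF.aestronglyMeasurable).symm
  have h2 : Integrable (Function.uncurry F) (μ.map fun ω => (Y ω, Z ω)) :=
    (integrable_map_measure hF.aestronglyMeasurable hYZ.aemeasurable).2 hi
  rw [h1, hlaw, Measure.integral_compProd (hlaw ▸ h2)]
  exact integral_map hY.aemeasurable
    (StronglyMeasurable.integral_kernel_prod_right' hF).aestronglyMeasurable

theorem ae_freeze {Y : Ω → Ω'}
    {Z : Ω → S} (hY : Measurable Y) (hZ : Measurable Z) {κ : Kernel Ω' S} [IsMarkovKernel κ]
    (hlaw : μ.map (fun ω => (Y ω, Z ω)) = (μ.map Y) ⊗ₘ κ) {s : Set S} (hs : MeasurableSet s)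
    (h : ∀ y, ∀ᵐ z ∂(κ y), z ∈ s) : ∀ᵐ ω ∂μ, Z ω ∈ s := by
  have hYZ : Measurable fun ω => (Y ω, Z ω) := hY.prodMk hZ
  have : IsProbabilityMeasure (μ.map Y) := Measure.isProbabilityMeasure_map hY.aemeasurable
  have h1 : μ (Z ⁻¹' sᶜ) = ((μ.map Y) ⊗ₘ κ) (Set.univ ×ˢ sᶜ) := by
    rw [← hlaw, Measure.map_apply hYZ (MeasurableSet.univ.prod hs.compl)]
    congr 1
    ext ω; simp
  rw [Measure.compProd_apply_prod MeasurableSet.univ hs.compl] at h1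
  have h2 : ∀ y, κ y sᶜ = 0 := fun y => ae_iff.1 (h y)
  simp only [h2, lintegral_const, zero_mul] at h1
  exact ae_iff.2 h1

end Freeze

section Laws

variable {Ω Ω' X : Type*} {m mΩ : MeasurableSpace Ω} [MeasurableSpace Ω'] [MeasurableSpace X] {K : ℕ}
  {μ : Measure Ω} [IsProbabilityMeasure μ] {D : Measure X}

/-- The joint law of past information `Y` and an independent context. -/
theorem map_ctx_eq_prod (hm : m ≤ mΩ) {Y : Ω → Ω'}
    (hY : Measurable[m] Y) {ξ : Ω → X} (hξ : Measurable ξ) (hlaw : μ.map ξ = D)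
    (hind : Indep (MeasurableSpace.comap ξ inferInstance) m μ) :
    μ.map (fun ω => (Y ω, ξ ω)) = (μ.map Y).prod D := by
  have h1 : IndepFun Y ξ μ := by
    rw [IndepFun_iff_Indep]
    exact indep_of_indep_of_le_left hind.symm hY.comap_le
  rw [(indepFun_iff_map_prod_eq_prod_map_map (hY.mono hm le_rfl).aemeasurable
    hξ.aemeasurable).1 h1, hlaw]

variable [IsProbabilityMeasure D] {p : Ω' → X → Fin K → ℝ}

/-- The cylinders on which the law of a sequence of context-arm pairs is prescribed. -/
def pairCylinders (X : Type*) [MeasurableSpace X] (K : ℕ) : Set (Set (ℕ → X × Fin K)) :=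
  {c | ∃ (n : ℕ) (B : ℕ → Set X) (b : ℕ → Fin K), (∀ k, MeasurableSet (B k)) ∧
    c = {z | ∀ k < n, (z k).1 ∈ B k ∧ (z k).2 = b k}}

theorem isPiSystem_pairCylinders : IsPiSystem (pairCylinders X K) := by
  classical
  rintro _ ⟨n, B, b, hB, rfl⟩ _ ⟨m, B', b', hB', rfl⟩ ⟨z, hz1, hz2⟩
  refine ⟨max n m, fun k => (if k < n then B k else Set.univ) ∩ (if k < m then B' k else Set.univ),
    fun k => (z k).2, fun k => ?_, ?_⟩
  · refine MeasurableSet.inter ?_ ?_ <;> split_ifs <;> first | exact hB k | exact hB' k | simp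
  · ext w
    simp only [Set.mem_inter_iff, Set.mem_ofPred_eq] at hz1 hz2 ⊢
    constructor
    · rintro ⟨h1, h2⟩ k hk
      refine ⟨⟨?_, ?_⟩, ?_⟩
      · split_ifs with h
        · exact (h1 k h).1
        · trivial
      · split_ifs with h
        · exact (h2 k h).1
        · trivial
      · rcases lt_max_iff.1 hk with h | h
        · rw [(h1 k h).2, (hz1 k h).2]
        · rw [(h2 k h).2, (hz2 k h).2]
    · intro h
      refine ⟨fun k hk => ?_, fun k hk => ?_⟩
      · have := h k (lt_max_of_lt_left hk)
        simp only [hk, if_true] at this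
        exact ⟨this.1.1, this.2.trans (hz1 k hk).2⟩
      · have := h k (lt_max_of_lt_right hk)
        simp only [hk, if_true] at this
        exact ⟨this.1.2, this.2.trans (hz2 k hk).2⟩

theorem measurableSet_pairCylinder {n : ℕ} {B : ℕ → Set X} {b : ℕ → Fin K}
    (hB : ∀ k, MeasurableSet (B k)) :
    MeasurableSet {z : ℕ → X × Fin K | ∀ k < n, (z k).1 ∈ B k ∧ (z k).2 = b k} := by
  have : {z : ℕ → X × Fin K | ∀ k < n, (z k).1 ∈ B k ∧ (z k).2 = b k}
      = ((Finset.range n : Finset ℕ) : Set ℕ).pi fun k => B k ×ˢ {b k} := by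
    ext z; simp [Set.mem_pi]
  rw [this]
  exact MeasurableSet.pi (Finset.countable_toSet _)
    fun k _ => (hB k).prod (measurableSet_singleton _)

theorem generateFrom_pairCylinders :
    (MeasurableSpace.pi : MeasurableSpace (ℕ → X × Fin K))
      = MeasurableSpace.generateFrom (pairCylinders X K) := by
  classical
  refine le_antisymm ?_ ?_
  · refine iSup_le fun k => ?_
    rintro _ ⟨U, hU, rfl⟩
    have : (fun z : ℕ → X × Fin K => z k) ⁻¹' U = ⋃ b : Fin (k + 1) → Fin K,
        {z : ℕ → X × Fin K | ∀ j < k + 1,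
          (z j).1 ∈ (if j = k then {x | (x, b (Fin.last k)) ∈ U} else Set.univ) ∧
          (z j).2 = b (Fin.ofNat (k + 1) j)} := by
      ext z
      simp only [Set.mem_preimage, Set.mem_iUnion, Set.mem_ofPred_eq]
      constructor
      · intro h
        refine ⟨fun j => (z j).2, fun j hj => ⟨?_, ?_⟩⟩
        · split_ifs with h'
          · subst h'; simpa using h
          · trivial
        · simp [Nat.mod_eq_of_lt hj]
      · rintro ⟨b, hb⟩
        have := hb k (Nat.lt_succ_self k)
        simp only [if_true] at this
        have e : (Fin.ofNat (k + 1) k) = Fin.last k := by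
          ext; simp
        rw [e] at this
        have h2 : z k = ((z k).1, b (Fin.last k)) := Prod.ext rfl this.2
        rw [h2]; exact this.1
    rw [this]
    refine MeasurableSet.iUnion fun b => MeasurableSpace.measurableSet_generateFrom
      ⟨k + 1, fun j => if j = k then {x | (x, b (Fin.last k)) ∈ U} else Set.univ,
        fun j => b (Fin.ofNat (k + 1) j), fun j => ?_, rfl⟩
    simp only
    split_ifs
    · exact measurable_prodMk_right hU
    · exact MeasurableSet.univ
  · refine MeasurableSpace.generateFrom_le ?_
    rintro _ ⟨n, B, b, hB, rfl⟩
    exact measurableSet_pairCylinder hB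

theorem lintegral_ofReal_policy {q : X → Fin K → ℝ} (hq : IsPolicy q) (s : Set X) (a : Fin K) :
    ∫⁻ x in s, ENNReal.ofReal (q x a) ∂D = ENNReal.ofReal (∫ x in s, q x a ∂D) := by
  refine (ofReal_integral_eq_lintegral_ofReal ?_ ?_).symm
  · refine Integrable.of_bound (hq.meas a).aestronglyMeasurable 1
      (Filter.Eventually.of_forall fun x => ?_)
    rw [Real.norm_eq_abs, abs_of_nonneg ((hq.mem x).1 a)]
    exact hq.le_one x a
  · exact Filter.Eventually.of_forall fun x => (hq.mem x).1 a

/-- The joint law of the information `Y` and a sequence of pairs that is conditionally i.i.d. -/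
theorem map_seq_eq_compProd (hm : m ≤ mΩ) {Y : Ω → Ω'}
    (hY : Measurable[m] Y) {Xs : ℕ → Ω → X} {As : ℕ → Ω → Fin K} (hXs : ∀ k, Measurable (Xs k))
    (hAs : ∀ k, Measurable (As k)) (hp : ∀ y, IsPolicy (p y))
    (hpm : ∀ a, Measurable fun q : Ω' × X => p q.1 q.2 a)
    (hlaw : ∀ (n : ℕ) (B : ℕ → Set X) (b : ℕ → Fin K), (∀ k, MeasurableSet (B k)) →
      μ[Set.indicator {ω | ∀ k < n, Xs k ω ∈ B k ∧ As k ω = b k} (fun _ => (1 : ℝ)) | m]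
        =ᵐ[μ] fun ω => ∏ k ∈ Finset.range n, ∫ x in B k, p (Y ω) x (b k) ∂D) :
    μ.map (fun ω => (Y ω, fun k => (Xs k ω, As k ω))) = (μ.map Y) ⊗ₘ seqKernel D hp hpm := by
  have hZ : Measurable fun ω => fun k => (Xs k ω, As k ω) :=
    measurable_pi_iff.2 fun k => (hXs k).prodMk (hAs k)
  refine map_prodMk_eq_compProd (hY.mono hm le_rfl) hZ _ _
    generateFrom_pairCylinders isPiSystem_pairCylinders ?_
  rintro A hA _ ⟨n, B, b, hB, rfl⟩
  set E : Set Ω := {ω | ∀ k < n, Xs k ω ∈ B k ∧ As k ω = b k} with hE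
  have hEm : MeasurableSet E := hZ (measurableSet_pairCylinder (n := n) (b := b) hB)
  have e1 : (fun ω => fun k => (Xs k ω, As k ω)) ⁻¹'
      {z : ℕ → X × Fin K | ∀ k < n, (z k).1 ∈ B k ∧ (z k).2 = b k} = E := rfl
  rw [e1]
  have hκ : ∀ y, seqKernel D hp hpm y {z | ∀ k < n, (z k).1 ∈ B k ∧ (z k).2 = b k}
      = ENNReal.ofReal (∏ k ∈ Finset.range n, ∫ x in B k, p y x (b k) ∂D) := by
    intro y
    have := isProbabilityMeasure_pairLaw D (hp y)
    have e2 : {z : ℕ → X × Fin K | ∀ k < n, (z k).1 ∈ B k ∧ (z k).2 = b k}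
        = ((Finset.range n : Finset ℕ) : Set ℕ).pi fun k => B k ×ˢ {b k} := by
      ext z; simp [Set.mem_pi]
    rw [e2]
    change (Measure.infinitePi fun _ : ℕ => pairLaw D (p y)) _ = _
    rw [Measure.infinitePi_pi _ fun k _ => (hB k).prod (measurableSet_singleton _),
      ENNReal.ofReal_prod_of_nonneg fun k _ => integral_nonneg fun x => ((hp y).mem x).1 _]
    refine Finset.prod_congr rfl fun k _ => ?_
    rw [pairLaw_prod_singleton D (p y) (hB k), lintegral_ofReal_policy (hp y)]
  simp_rw [hκ]
  have hYA : MeasurableSet[m] (Y ⁻¹' A) := hY hA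
  have hint : Integrable (E.indicator fun _ => (1 : ℝ)) μ :=
    (integrable_const (1 : ℝ)).indicator hEm
  have h1 := setIntegral_condExp hm hint hYA
  rw [setIntegral_congr_ae (hm _ hYA) ((hlaw n B b hB).mono fun ω h _ => h),
    integral_indicator_const _ hEm] at h1
  rw [← ofReal_integral_eq_lintegral_ofReal, h1]
  · simp [Measure.real, Measure.restrict_apply hEm, Set.inter_comm]
  · exact ((integrable_condExp (m := m)).congr (hlaw n B b hB)).integrableOn
  · exact Filter.Eventually.of_forall fun ω => Finset.prod_nonneg fun k _ =>
      integral_nonneg fun x => ((hp _).mem x).1 _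

/-- The joint law of past information `Y`, the context, and an arm drawn from the policy. -/
theorem map_pair_eq_compProd (hm : m ≤ mΩ) {Y : Ω → Ω'}
    (hY : Measurable[m] Y) {ξ : Ω → X} {α : Ω → Fin K} (hξ : Measurable ξ) (hα : Measurable α)
    (hlaw : μ.map ξ = D) (hind : Indep (MeasurableSpace.comap ξ inferInstance) m μ)
    (hp : ∀ y, IsPolicy (p y)) (hpm : ∀ a, Measurable fun q : Ω' × X => p q.1 q.2 a)
    (harm : ∀ a, μ[Set.indicator {ω | α ω = a} (fun _ => (1 : ℝ)) |
        m ⊔ MeasurableSpace.comap ξ inferInstance] =ᵐ[μ] fun ω => p (Y ω) (ξ ω) a) :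
    μ.map (fun ω => (Y ω, (ξ ω, α ω))) = (μ.map Y) ⊗ₘ pairKernel D hp hpm := by
  have hY' := hY.mono hm le_rfl
  have hm' : m ⊔ MeasurableSpace.comap ξ inferInstance ≤ mΩ := sup_le hm hξ.comap_le
  refine map_prodMk_eq_compProd hY' (hξ.prodMk hα) _
    {c | ∃ (B : Set X) (b : Fin K), MeasurableSet B ∧ c = B ×ˢ {b}} ?_ ?_ ?_
  · refine le_antisymm ?_ ?_
    · intro U hU
      have : U = ⋃ b : Fin K, {x | (x, b) ∈ U} ×ˢ {b} := by
        ext ⟨x, a⟩; simp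
      rw [this]
      exact MeasurableSet.iUnion fun b => MeasurableSpace.measurableSet_generateFrom
        ⟨_, b, measurable_prodMk_right hU, rfl⟩
    · refine MeasurableSpace.generateFrom_le ?_
      rintro _ ⟨B, b, hB, rfl⟩
      exact hB.prod (measurableSet_singleton b)
  · rintro _ ⟨B, b, hB, rfl⟩ _ ⟨B', b', hB', rfl⟩ ⟨z, hz1, hz2⟩
    refine ⟨B ∩ B', b, hB.inter hB', ?_⟩
    have : b' = b := by rw [← show z.2 = b' from hz2.2, ← show z.2 = b from hz1.2]
    rw [this, Set.prod_inter_prod, Set.inter_self]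
  · rintro A hA _ ⟨B, b, hB, rfl⟩
    have hE : MeasurableSet {ω | α ω = b} := hα (measurableSet_singleton b)
    have hs : MeasurableSet[m ⊔ MeasurableSpace.comap ξ inferInstance] (Y ⁻¹' A ∩ ξ ⁻¹' B) := by
      refine MeasurableSet.inter ?_ ?_
      · exact (le_sup_left : m ≤ _) _ (hY hA)
      · exact (le_sup_right : MeasurableSpace.comap ξ inferInstance ≤ _) _ ⟨B, hB, rfl⟩
    have hint : Integrable ({ω | α ω = b}.indicator fun _ => (1 : ℝ)) μ :=
      (integrable_const (1 : ℝ)).indicator hE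
    have h1 := setIntegral_condExp hm' hint hs
    rw [setIntegral_congr_ae (hm' _ hs) ((harm b).mono fun ω h _ => h),
      integral_indicator_const _ hE] at h1
    have hκ : ∀ y, pairKernel D hp hpm y (B ×ˢ {b})
        = ∫⁻ x in B, ENNReal.ofReal (p y x b) ∂D := fun y => pairLaw_prod_singleton D (p y) hB b
    simp_rw [hκ]
    have hf : Measurable fun q : Ω' × X => ENNReal.ofReal (p q.1 q.2 b) := (hpm b).ennreal_ofReal
    have h2 : ∫⁻ ω in Y ⁻¹' A, ∫⁻ x in B, ENNReal.ofReal (p (Y ω) x b) ∂D ∂μ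
        = ∫⁻ ω in Y ⁻¹' A ∩ ξ ⁻¹' B, ENNReal.ofReal (p (Y ω) (ξ ω) b) ∂μ := by
      have h3 : ∫⁻ ω in Y ⁻¹' A ∩ ξ ⁻¹' B, ENNReal.ofReal (p (Y ω) (ξ ω) b) ∂μ
          = ∫⁻ q in A ×ˢ B, ENNReal.ofReal (p q.1 q.2 b) ∂(μ.map fun ω => (Y ω, ξ ω)) :=
        (setLIntegral_map (hA.prod hB) hf (hY'.prodMk hξ)).symm
      have h4 : ∫⁻ ω in Y ⁻¹' A, ∫⁻ x in B, ENNReal.ofReal (p (Y ω) x b) ∂D ∂μ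
          = ∫⁻ y in A, ∫⁻ x in B, ENNReal.ofReal (p y x b) ∂D ∂(μ.map Y) :=
        (setLIntegral_map hA hf.lintegral_prod_right' hY').symm
      have : IsProbabilityMeasure (μ.map Y) := Measure.isProbabilityMeasure_map hY'.aemeasurable
      rw [h3, h4, map_ctx_eq_prod hm hY hξ hlaw hind, ← Measure.prod_restrict,
        lintegral_prod _ hf.aemeasurable]
    rw [h2, ← ofReal_integral_eq_lintegral_ofReal, h1]
    · simp only [Measure.real, Measure.restrict_apply hE, smul_eq_mul, mul_one]
      rw [ENNReal.ofReal_toReal (measure_ne_top _ _)]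
      congr 1
      ext ω; simp; tauto
    · exact ((integrable_condExp (m := m ⊔ MeasurableSpace.comap ξ inferInstance)).congr
        (harm b)).integrableOn
    · exact Filter.Eventually.of_forall fun ω => ((hp _).mem _).1 _

end Laws

/-! ### Matrix geometric resampling under a fixed policy -/

section Resampling

variable {K d : ℕ}

theorem inner_eq_dotProduct (x y : Ctx d) : inner ℝ x y = x.ofLp ⬝ᵥ y.ofLp := by
  rw [EuclideanSpace.inner_eq_star_dotProduct, star_trivial, dotProduct_comm]

theorem dotProduct_self_eq (x : Ctx d) : x.ofLp ⬝ᵥ x.ofLp = ‖x‖ ^ 2 := by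
  rw [← inner_eq_dotProduct, real_inner_self_eq_norm_sq]

theorem posSemidef_vecMulVec_self {n : Type*} [Fintype n] (x : n → ℝ) :
    (Matrix.vecMulVec x x).PosSemidef := by
  simpa using Matrix.posSemidef_vecMulVec_self_star x

theorem dotProduct_vecMulVec_mulVec {n : Type*} [Fintype n] (x u v : n → ℝ) :
    u ⬝ᵥ (Matrix.vecMulVec x x).mulVec v = (u ⬝ᵥ x) * (x ⬝ᵥ v) := by
  rw [Matrix.vecMulVec_mulVec]
  simp [dotProduct_smul, mul_comm]

theorem posSemidef_mgrW (a : Fin K) (x : Ctx d) (v : Fin K) : (mgrW a x v).PosSemidef := by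
  unfold mgrW
  split_ifs
  · exact posSemidef_vecMulVec_self _
  · exact Matrix.PosSemidef.zero

theorem posSemidef_one_sub_mgrW {δ : ℝ} (hδ : 0 ≤ δ) (a : Fin K) {x : Ctx d} (v : Fin K)
    (hx : δ * ‖x‖ ^ 2 ≤ 1) :
    ((1 : Matrix (Fin d) (Fin d) ℝ) - δ • mgrW a x v).PosSemidef := by
  refine Matrix.PosSemidef.of_dotProduct_mulVec_nonneg ?_ fun u => ?_
  · exact Matrix.isHermitian_one.sub ((posSemidef_mgrW a x v).smul hδ).isHermitian
  · rw [Matrix.sub_mulVec, Matrix.one_mulVec, dotProduct_sub, Matrix.smul_mulVec, dotProduct_smul,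
      star_trivial, smul_eq_mul]
    have h1 : u ⬝ᵥ u = ‖WithLp.toLp 2 u‖ ^ 2 := dotProduct_self_eq (WithLp.toLp 2 u)
    have h2 : u ⬝ᵥ (mgrW a x v).mulVec u ≤ ‖x‖ ^ 2 * ‖WithLp.toLp 2 u‖ ^ 2 := by
      unfold mgrW
      split_ifs
      · rw [dotProduct_vecMulVec_mulVec, dotProduct_comm u, ← sq, ← mul_pow]
        have := abs_real_inner_le_norm x (WithLp.toLp 2 u)
        rw [inner_eq_dotProduct] at this
        exact sq_le_sq' (by linarith [neg_le_of_abs_le this]) (le_of_abs_le this)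
      · simp only [Matrix.zero_mulVec, dotProduct_zero]; positivity
    rw [h1]
    have h3 := mul_le_mul_of_nonneg_left h2 hδ
    have h4 := mul_le_mul_of_nonneg_right hx (sq_nonneg ‖WithLp.toLp 2 u‖)
    nlinarith

theorem stronglyMeasurable_mgrW (a : Fin K) :
    StronglyMeasurable fun w : Ctx d × Fin K => mgrW a w.1 w.2 := by
  refine StronglyMeasurable.ite (measurable_snd (measurableSet_singleton a)) ?_
    stronglyMeasurable_const
  have hc : Continuous fun w : Ctx d × Fin K => Matrix.vecMulVec w.1.ofLp w.1.ofLp := by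
    refine Continuous.matrix_vecMulVec ?_ ?_ <;>
      exact (PiLp.continuous_ofLp 2 _).comp continuous_fst
  exact hc.stronglyMeasurable

/-- The factor `1 - δ W` of matrix geometric resampling. -/
noncomputable def shrink (δ : ℝ) (a : Fin K) (w : Ctx d × Fin K) : Matrix (Fin d) (Fin d) ℝ :=
  1 - δ • mgrW a w.1 w.2

theorem stronglyMeasurable_shrink (δ : ℝ) (a : Fin K) :
    StronglyMeasurable (shrink δ a : Ctx d × Fin K → _) :=
  stronglyMeasurable_const.sub ((stronglyMeasurable_mgrW a).const_smul δ)

theorem mgr_eq_sum_seqProd (δ : ℝ) (M : ℕ) (a : Fin K) (z : ℕ → Ctx d × Fin K) :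
    mgr δ M a (fun k => (z k).1) (fun k => (z k).2)
      = δ • ∑ k ∈ Finset.range (M + 1), seqProd (shrink δ a) z k := by
  have h : ∀ k, mgrV δ a (fun k => (z k).1) (fun k => (z k).2) k = seqProd (shrink δ a) z k := by
    intro k
    induction k with
    | zero => rfl
    | succ k ih => rw [mgrV, seqProd, ih]; rfl
  unfold mgr
  simp_rw [h]
  rw [← smul_add, Finset.range_eq_Ico, Finset.sum_eq_sum_Ico_succ_bot (by omega)]
  rfl

theorem stronglyMeasurable_mgr (δ : ℝ) (M : ℕ) (a : Fin K) :
    StronglyMeasurable fun z : ℕ → Ctx d × Fin K =>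
      mgr δ M a (fun k => (z k).1) (fun k => (z k).2) := by
  simp_rw [mgr_eq_sum_seqProd]
  refine StronglyMeasurable.const_smul ?_ δ
  exact Finset.stronglyMeasurable_fun_sum _ fun k _ =>
    stronglyMeasurable_seqProd (stronglyMeasurable_shrink δ a) k

/-- The second moment `E[π(a ∣ X) X Xᵀ]` of the contexts on which arm `a` is played. -/
noncomputable def armMoment (D : Measure (Ctx d)) (p : Ctx d → Fin K → ℝ) (a : Fin K) :
    Matrix (Fin d) (Fin d) ℝ :=
  ∫ w, mgrW a w.1 w.2 ∂(pairLaw D p)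

variable {D : Measure (Ctx d)} {δ C : ℝ}

theorem norm_shrink_le (hδ : 0 ≤ δ) (a : Fin K) {w : Ctx d × Fin K} (hw : δ * ‖w.1‖ ^ 2 ≤ 1) :
    ‖shrink δ a w‖ ≤ 1 := by
  refine norm_le_of_posSemidef one_pos (posSemidef_one_sub_mgrW hδ a w.2 hw) ?_
  rw [one_smul, shrink, sub_sub_cancel]
  exact (posSemidef_mgrW a _ _).smul hδ

theorem norm_mgr_le (hδ : 0 ≤ δ) (M : ℕ) (a : Fin K) {z : ℕ → Ctx d × Fin K}
    (hz : ∀ k, δ * ‖(z k).1‖ ^ 2 ≤ 1) :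
    ‖mgr δ M a (fun k => (z k).1) (fun k => (z k).2)‖ ≤ δ * (M + 1) := by
  have h1 : ‖∑ k ∈ Finset.range (M + 1), seqProd (shrink δ a) z k‖ ≤ (M + 1 : ℝ) := by
    refine (norm_sum_le _ _).trans ?_
    refine (Finset.sum_le_sum fun k _ =>
      norm_seqProd_le (fun k => norm_shrink_le hδ a (hz k)) k).trans ?_
    simp
  rw [mgr_eq_sum_seqProd, norm_smul, Real.norm_eq_abs, abs_of_nonneg hδ]
  exact mul_le_mul_of_nonneg_left h1 hδ

theorem isContraction_shrink (hδ : 0 ≤ δ) (hbd : ∀ᵐ x ∂D, δ * ‖x‖ ^ 2 ≤ 1)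
    (p : Ctx d → Fin K → ℝ) (a : Fin K) :
    IsContraction (pairLaw D p) (shrink δ a : Ctx d × Fin K → _) where
  meas := stronglyMeasurable_shrink δ a
  psd := by
    filter_upwards [ae_pairLaw D (p := p) hbd] with w hw
    exact posSemidef_one_sub_mgrW hδ a w.2 hw
  le_one := by
    refine Filter.Eventually.of_forall fun w => ?_
    rw [shrink, sub_sub_cancel]
    exact (posSemidef_mgrW a _ _).smul hδ

theorem ae_delta_norm_sq_le (hbd : ∀ᵐ x ∂D, ‖x‖ ≤ C) (hδ : 0 < δ) (hδC : δ * C ^ 2 ≤ 1) :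
    ∀ᵐ x ∂D, δ * ‖x‖ ^ 2 ≤ 1 := by
  filter_upwards [hbd] with x hx
  refine le_trans ?_ hδC
  gcongr

theorem norm_mgrW_le (a : Fin K) {x : Ctx d} (v : Fin K) (hC : 0 < C) (hx : ‖x‖ ≤ C) :
    ‖mgrW a x v‖ ≤ C ^ 2 := by
  refine norm_le_of_posSemidef (by positivity) (posSemidef_mgrW a x v) ?_
  have h := posSemidef_one_sub_mgrW (δ := (C ^ 2)⁻¹) (by positivity) a (x := x) v (by
    rw [inv_mul_le_iff₀ (by positivity), mul_one]; gcongr)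
  have h2 := h.smul (sq_nonneg C)
  rwa [smul_sub, smul_smul, mul_inv_cancel₀ (by positivity), one_smul] at h2

variable [IsProbabilityMeasure D]

theorem integrable_mgrW (hC : 0 < C) (hbd : ∀ᵐ x ∂D, ‖x‖ ≤ C) {p : Ctx d → Fin K → ℝ}
    (hp : IsPolicy p) (a : Fin K) :
    Integrable (fun w : Ctx d × Fin K => mgrW a w.1 w.2) (pairLaw D p) := by
  have := isProbabilityMeasure_pairLaw D hp
  refine Integrable.of_bound (stronglyMeasurable_mgrW a).aestronglyMeasurable (C ^ 2) ?_
  filter_upwards [ae_pairLaw D (p := p) hbd] with w hw using norm_mgrW_le a w.2 hC hw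

theorem integral_shrink (hC : 0 < C) (hbd : ∀ᵐ x ∂D, ‖x‖ ≤ C) {p : Ctx d → Fin K → ℝ}
    (hp : IsPolicy p) (a : Fin K) (δ : ℝ) :
    ∫ w, shrink δ a w ∂(pairLaw D p) = 1 - δ • armMoment D p a := by
  have := isProbabilityMeasure_pairLaw D hp
  unfold shrink
  have h1 : Integrable (fun w : Ctx d × Fin K => δ • mgrW a w.1 w.2) (pairLaw D p) :=
    (integrable_mgrW hC hbd hp a).smul δ
  rw [integral_sub (integrable_const _) h1, integral_smul]
  simp [armMoment]

theorem dotProduct_armMoment (hC : 0 < C) (hbd : ∀ᵐ x ∂D, ‖x‖ ≤ C) {p : Ctx d → Fin K → ℝ}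
    (hp : IsPolicy p) (a : Fin K) (u v : Fin d → ℝ) :
    u ⬝ᵥ (armMoment D p a).mulVec v = ∫ x, p x a * ((u ⬝ᵥ x.ofLp) * (x.ofLp ⬝ᵥ v)) ∂D := by
  let L : Matrix (Fin d) (Fin d) ℝ →ₗ[ℝ] ℝ :=
    { toFun := fun V => u ⬝ᵥ V.mulVec v
      map_add' := fun V W => by simp [Matrix.add_mulVec, dotProduct_add]
      map_smul' := fun c V => by simp [Matrix.smul_mulVec, dotProduct_smul] }
  have h := IsContraction.integral_linear (integrable_mgrW hC hbd hp a) L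
  have hi := IsContraction.integrable_linear (integrable_mgrW hC hbd hp a) L
  have hm : StronglyMeasurable fun w : Ctx d × Fin K => L (mgrW a w.1 w.2) :=
    (LinearMap.toContinuousLinearMap L).continuous.comp_stronglyMeasurable
      (stronglyMeasurable_mgrW a)
  change L (∫ w, mgrW a w.1 w.2 ∂(pairLaw D p)) = _
  rw [← h, integral_pairLaw D hp hm hi, Finset.sum_eq_single a]
  · refine integral_congr_ae (Filter.Eventually.of_forall fun x => ?_)
    simp only [smul_eq_mul]
    congr 1
    change u ⬝ᵥ (mgrW a x a).mulVec v = _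
    rw [mgrW, if_pos rfl, dotProduct_vecMulVec_mulVec]
  · intro b _ hb
    have : ∀ x : Ctx d, L (mgrW a x b) = 0 := fun x => by
      rw [mgrW, if_neg hb, map_zero]
    simp [this]
  · simp

/-- Bounded weights keep the products of coordinates of a context integrable. -/
theorem integrable_mul_dotProduct_mul (hC : 0 < C) (hbd : ∀ᵐ x ∂D, ‖x‖ ≤ C) {f : Ctx d → ℝ}
    (hf : Measurable f) (hf1 : ∀ x, |f x| ≤ 1) (u v : Fin d → ℝ) :
    Integrable (fun x => f x * ((u ⬝ᵥ x.ofLp) * (x.ofLp ⬝ᵥ v))) D := by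
  have h1 : Continuous fun x : Ctx d => u ⬝ᵥ x.ofLp :=
    continuous_const.dotProduct (PiLp.continuous_ofLp 2 _)
  have h2 : Continuous fun x : Ctx d => x.ofLp ⬝ᵥ v :=
    (PiLp.continuous_ofLp 2 _).dotProduct continuous_const
  refine Integrable.of_bound (hf.mul (h1.mul h2).measurable).aestronglyMeasurable
    (1 * ((‖WithLp.toLp 2 u‖ * C) * (C * ‖WithLp.toLp 2 v‖))) ?_
  filter_upwards [hbd] with x hx
  have e1 := abs_real_inner_le_norm (WithLp.toLp 2 u) x
  have e2 := abs_real_inner_le_norm x (WithLp.toLp 2 v)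
  rw [inner_eq_dotProduct] at e1 e2
  rw [Real.norm_eq_abs, abs_mul, abs_mul]
  refine mul_le_mul (hf1 x) (mul_le_mul (e1.trans ?_) (e2.trans ?_) (abs_nonneg _) ?_) ?_ zero_le_one
  · gcongr
  · gcongr
  · positivity
  · positivity

theorem dotProduct_secondMoment (hC : 0 < C) (hbd : ∀ᵐ x ∂D, ‖x‖ ≤ C) (u v : Fin d → ℝ) :
    u ⬝ᵥ (secondMoment D).mulVec v = ∫ x, (u ⬝ᵥ x.ofLp) * (x.ofLp ⬝ᵥ v) ∂D := by
  have hij : ∀ i j : Fin d, Integrable (fun x : Ctx d => x i * x j) D := by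
    intro i j
    have := integrable_mul_dotProduct_mul hC hbd (f := fun _ => 1) measurable_const (by simp)
      (Pi.single i 1) (Pi.single j 1)
    simpa using this
  simp only [dotProduct, Matrix.mulVec, secondMoment, Matrix.of_apply, Finset.mul_sum,
    Finset.sum_mul]
  rw [integral_finsetSum]
  · rw [Finset.sum_comm]
    refine Finset.sum_congr rfl fun j _ => ?_
    rw [integral_finsetSum]
    · refine Finset.sum_congr rfl fun i _ => ?_
      rw [← integral_mul_const, ← integral_const_mul]
      refine integral_congr_ae (Filter.Eventually.of_forall fun x => ?_)
      simp only; ring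
    · intro i _
      have := ((hij i j).const_mul (u i)).mul_const (v j)
      refine this.congr (Filter.Eventually.of_forall fun x => ?_)
      simp only; ring
  · intro j _
    refine integrable_finsetSum _ fun i _ => ?_
    have := ((hij i j).const_mul (u i)).mul_const (v j)
    refine this.congr (Filter.Eventually.of_forall fun x => ?_)
    simp only; ring

/-- Uniform exploration bounds the moment of every arm from below. -/
theorem armMoment_lower (hC : 0 < C) (hbd : ∀ᵐ x ∂D, ‖x‖ ≤ C) {p : Ctx d → Fin K → ℝ}
    (hp : IsPolicy p) (a : Fin K) {m lam : ℝ} (hm0 : 0 ≤ m) (hm : ∀ x, m ≤ p x a)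
    (hlam : ∀ u : Fin d → ℝ, lam * (u ⬝ᵥ u) ≤ u ⬝ᵥ (secondMoment D).mulVec u)
    (u : Fin d → ℝ) : m * lam * (u ⬝ᵥ u) ≤ u ⬝ᵥ (armMoment D p a).mulVec u := by
  rw [dotProduct_armMoment hC hbd hp]
  have h1 := mul_le_mul_of_nonneg_left (hlam u) hm0
  rw [dotProduct_secondMoment hC hbd, ← integral_const_mul] at h1
  rw [mul_assoc]
  refine h1.trans (integral_mono_ae ?_ ?_ ?_)
  · have := (integrable_mul_dotProduct_mul hC hbd (f := fun _ => 1) measurable_const (by simp) u u)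
    simp only [one_mul] at this
    exact this.const_mul m
  · refine integrable_mul_dotProduct_mul hC hbd (hp.meas a) (fun x => ?_) u u
    rw [abs_of_nonneg ((hp.mem x).1 a)]; exact hp.le_one x a
  · refine Filter.Eventually.of_forall fun x => ?_
    simp only
    rw [dotProduct_comm x.ofLp u]
    exact mul_le_mul_of_nonneg_right (hm x) (mul_self_nonneg _)

theorem posSemidef_armMoment (hC : 0 < C) (hbd : ∀ᵐ x ∂D, ‖x‖ ≤ C) {p : Ctx d → Fin K → ℝ}
    (hp : IsPolicy p) (a : Fin K) : (armMoment D p a).PosSemidef :=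
  IsContraction.posSemidef_integral (integrable_mgrW hC hbd hp a)
    (Filter.Eventually.of_forall fun w => posSemidef_mgrW a w.1 w.2)

/-- On average, a resampling step contracts, at a rate given by the exploration of the arm. -/
theorem norm_one_sub_armMoment_le (hC : 0 < C) (hbd : ∀ᵐ x ∂D, ‖x‖ ≤ C)
    (hδ : 0 ≤ δ) (hδC : δ * C ^ 2 ≤ 1) {p : Ctx d → Fin K → ℝ}
    (hp : IsPolicy p) (a : Fin K) {m lam : ℝ} (hm0 : 0 ≤ m) (hm : ∀ x, m ≤ p x a)
    (hlam : ∀ u : Fin d → ℝ, lam * (u ⬝ᵥ u) ≤ u ⬝ᵥ (secondMoment D).mulVec u)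
    (hpos : δ * (m * lam) < 1) :
    ‖1 - δ • armMoment D p a‖ ≤ 1 - δ * (m * lam) := by
  have := isProbabilityMeasure_pairLaw D hp
  have hbd' : ∀ᵐ x ∂D, δ * ‖x‖ ^ 2 ≤ 1 := by
    filter_upwards [hbd] with x hx
    refine le_trans ?_ hδC
    gcongr
  have hcon := isContraction_shrink hδ hbd' p a
  refine norm_le_of_posSemidef (by linarith) ?_ ?_
  · rw [← integral_shrink hC hbd hp]; exact hcon.psd_mean
  · have hA := posSemidef_armMoment hC hbd hp a
    refine Matrix.PosSemidef.of_dotProduct_mulVec_nonneg ?_ fun u => ?_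
    · exact ((Matrix.isHermitian_one.smul (IsSelfAdjoint.all _))).sub
        (Matrix.isHermitian_one.sub (hA.smul hδ).isHermitian)
    · have h1 := armMoment_lower hC hbd hp a hm0 hm hlam u
      have h2 := mul_le_mul_of_nonneg_left h1 hδ
      simp only [star_trivial, Matrix.sub_mulVec, Matrix.smul_mulVec, Matrix.one_mulVec,
        dotProduct_sub, dotProduct_smul, smul_eq_mul]
      nlinarith

/-- The mean of the resampling estimator is a truncated Neumann series of `Σ_a⁻¹`, and misses the
inverse by the remainder `(1 - δ Σ_a)^{M+1}`. -/
theorem integral_mgr_mul_armMoment (hC : 0 < C) (hbd : ∀ᵐ x ∂D, ‖x‖ ≤ C) (hδ : 0 < δ)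
    (hδC : δ * C ^ 2 ≤ 1) {p : Ctx d → Fin K → ℝ} (hp : IsPolicy p) (M : ℕ) (a : Fin K) :
    (∫ z, mgr δ M a (fun k => (z k).1) (fun k => (z k).2)
        ∂(Measure.infinitePi fun _ : ℕ => pairLaw D p)) * armMoment D p a
      = 1 - (1 - δ • armMoment D p a) ^ (M + 1) := by
  have := isProbabilityMeasure_pairLaw D hp
  have hcon := isContraction_shrink hδ.le (ae_delta_norm_sq_le hbd hδ hδC) p a
  simp_rw [mgr_eq_sum_seqProd]
  rw [integral_smul, integral_finsetSum _ fun k _ => hcon.integrable_seqProd k]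
  simp_rw [hcon.integral_seqProd, integral_shrink hC hbd hp]
  rw [Matrix.smul_mul, ← Matrix.mul_smul]
  have h := geom_sum_mul_neg (1 - δ • armMoment D p a) (M + 1)
  rwa [sub_sub_cancel] at h

/-- The second moment `E[tr (Σ_a Σ̂† Σ_a Σ̂†ᵀ)]` is at most `2 d`, whatever the number of resampling
steps and the smallest eigenvalue of `Σ_a` are. -/
theorem integral_trace_mgr_le (hC : 0 < C) (hbd : ∀ᵐ x ∂D, ‖x‖ ≤ C) (hδ : 0 < δ)
    (hδC : δ * C ^ 2 ≤ 1) {p : Ctx d → Fin K → ℝ} (hp : IsPolicy p) (M : ℕ) (a : Fin K) :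
    ∫ z, (armMoment D p a * mgr δ M a (fun k => (z k).1) (fun k => (z k).2) * armMoment D p a
        * (mgr δ M a (fun k => (z k).1) (fun k => (z k).2)).transpose).trace
        ∂(Measure.infinitePi fun _ : ℕ => pairLaw D p) ≤ 2 * d := by
  have := isProbabilityMeasure_pairLaw D hp
  have hcon := isContraction_shrink hδ.le (ae_delta_norm_sq_le hbd hδ hδC) p a
  have h := hcon.trace_second_moment_le (M + 1)
  rw [integral_shrink hC hbd hp, sub_sub_cancel] at h
  simp_rw [mgr_eq_sum_seqProd]
  simp only [Matrix.smul_mul, Matrix.mul_smul, Matrix.transpose_smul, Fintype.card_fin] at h ⊢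
  exact h

end Resampling

/-! ### Consequences of the choice of parameters -/

/-- The standing assumptions on the context distribution and the parameters. -/
structure Setting {K d : ℕ} (D : Measure (Ctx d)) (P : Params) (CX Cl : ℝ) : Prop where
  two_le_K : 2 ≤ K
  one_le_d : 1 ≤ d
  two_le_T : 2 ≤ P.T
  CX_pos : 0 < CX
  CX_le : CX ≤ 2 * Cl
  bdd : ∀ᵐ x ∂D, ‖x‖ ≤ CX
  posDef : (secondMoment D).PosDef
  delta_eq : P.delta = 1 / (2 * Cl * CX)
  lam_eq : P.lam = lambdaMin D
  beta1_pos : 0 < P.beta1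
  gamma_le : gammaOf K P P.beta1 ≤ 1

namespace Setting

variable {K d : ℕ} {D : Measure (Ctx d)} {P : Params} {CX Cl : ℝ}

theorem Cl_pos (S : Setting (K := K) D P CX Cl) : 0 < Cl := by
  have := S.CX_pos; have := S.CX_le; linarith

theorem delta_pos (S : Setting (K := K) D P CX Cl) : 0 < P.delta := by
  have h1 := S.CX_pos; have h2 := S.Cl_pos
  rw [S.delta_eq]; positivity

theorem delta_mul (S : Setting (K := K) D P CX Cl) : P.delta * (Cl * CX) = 1 / 2 := by
  have h1 := S.CX_pos; have h2 := S.Cl_pos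
  rw [S.delta_eq]; field_simp

theorem delta_mul_sq_le (S : Setting (K := K) D P CX Cl) : P.delta * CX ^ 2 ≤ 1 := by
  have h1 := S.CX_pos; have h2 := S.Cl_pos; have h3 := S.CX_le
  rw [S.delta_eq, div_mul_eq_mul_div, div_le_one (by positivity)]
  nlinarith

theorem quadratic_lower (S : Setting (K := K) D P CX Cl) (u : Fin d → ℝ) :
    P.lam * (u ⬝ᵥ u) ≤ u ⬝ᵥ (secondMoment D).mulVec u := by
  have hH := S.posDef.isHermitian
  have h1 : ∀ i, P.lam ≤ hH.eigenvalues i := by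
    intro i
    rw [S.lam_eq, lambdaMin, hH.spectrum_real_eq_range_eigenvalues]
    exact csInf_le (Set.finite_range _).bddBelow ⟨i, rfl⟩
  have h2 : (secondMoment D - P.lam • (1 : Matrix (Fin d) (Fin d) ℝ)).PosSemidef := by
    have hH2 : (secondMoment D - P.lam • (1 : Matrix (Fin d) (Fin d) ℝ)).IsHermitian :=
      hH.sub (Matrix.isHermitian_one.smul (IsSelfAdjoint.all _))
    open scoped MatrixOrder in
    rw [Matrix.posSemidef_iff_isHermitian_and_spectrum_nonneg]
    refine ⟨hH2, fun r hr => ?_⟩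
    have h3 : r + P.lam ∈ spectrum ℝ (secondMoment D) := by
      have e : secondMoment D - P.lam • (1 : Matrix (Fin d) (Fin d) ℝ)
          = secondMoment D - algebraMap ℝ _ P.lam := by rw [Algebra.algebraMap_eq_smul_one]
      rw [e] at hr
      have := spectrum.add_mem_add_iff (r := r) (a := secondMoment D - algebraMap ℝ _ P.lam)
        (s := P.lam)
      rw [add_sub_cancel] at this
      exact this.2 hr
    rw [hH.spectrum_real_eq_range_eigenvalues] at h3
    obtain ⟨i, hi⟩ := h3
    have := h1 i
    simp only [Set.mem_ofPred_eq]
    linarith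
  have h3 := h2.dotProduct_mulVec_nonneg u
  simp only [star_trivial, Matrix.sub_mulVec, Matrix.smul_mulVec, Matrix.one_mulVec,
    dotProduct_sub, dotProduct_smul, smul_eq_mul] at h3
  linarith

theorem lam_pos (S : Setting (K := K) D P CX Cl) : 0 < P.lam := by
  have hH := S.posDef.isHermitian
  have : Nonempty (Fin d) := ⟨⟨0, S.one_le_d⟩⟩
  obtain ⟨i, hi⟩ := (Set.range_nonempty hH.eigenvalues).csInf_mem (Set.finite_range _)
  rw [S.lam_eq, lambdaMin, hH.spectrum_real_eq_range_eigenvalues, ← hi]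
  exact S.posDef.eigenvalues_pos i

theorem log_T_pos (S : Setting (K := K) D P CX Cl) : Real.log 2 ≤ Real.log P.T :=
  Real.log_le_log (by norm_num) (by exact_mod_cast S.two_le_T)

theorem log_T_pos' (S : Setting (K := K) D P CX Cl) : 0 < Real.log P.T :=
  (Real.log_pos (by norm_num)).trans_le S.log_T_pos

theorem K_pos (S : Setting (K := K) D P CX Cl) : (2 : ℝ) ≤ K := by exact_mod_cast S.two_le_K

/-- The condition `γ₁ ≤ 1` as a lower bound on the initial learning rate. -/
theorem le_beta1 (S : Setting (K := K) D P CX Cl) :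
    K * Real.log P.T ≤ 2 * P.delta * P.lam * P.beta1 := by
  have h := S.gamma_le
  have h1 := S.delta_pos; have h2 := S.lam_pos; have h3 := S.beta1_pos
  rwa [gammaOf, div_le_one (by positivity)] at h

variable [IsProbabilityMeasure D]

/-- `d λ_min ≤ tr Σ ≤ C_X²`. -/
theorem delta_lam_d_le (S : Setting (K := K) D P CX Cl) : P.delta * P.lam * d ≤ 1 := by
  have h1 : P.lam * d ≤ (secondMoment D).trace := by
    have : ∀ i : Fin d, P.lam ≤ secondMoment D i i := by
      intro i
      have := S.quadratic_lower (Pi.single i 1)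
      simpa using this
    calc P.lam * d = ∑ _i : Fin d, P.lam := by simp [mul_comm]
      _ ≤ _ := Finset.sum_le_sum fun i _ => this i
  have h2 : (secondMoment D).trace ≤ CX ^ 2 := by
    have hi : ∀ i : Fin d, Integrable (fun x : Ctx d => x i * x i) D := by
      intro i
      have := integrable_mul_dotProduct_mul S.CX_pos S.bdd (f := fun _ => 1) measurable_const (by simp)
        (Pi.single i 1) (Pi.single i 1)
      simpa using this
    have e : (secondMoment D).trace = ∫ x, ∑ i, x i * x i ∂D := by
      rw [integral_finsetSum _ fun i _ => hi i]; rfl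
    rw [e]
    calc ∫ x, ∑ i, x i * x i ∂D ≤ ∫ _x, CX ^ 2 ∂D := by
          refine integral_mono_ae (integrable_finsetSum _ fun i _ => hi i) (integrable_const _) ?_
          filter_upwards [S.bdd] with x hx
          have : ∑ i, x i * x i = ‖x‖ ^ 2 := dotProduct_self_eq x
          simp only [this]
          gcongr
      _ = CX ^ 2 := by simp
  have h3 := mul_le_mul_of_nonneg_left (h1.trans h2) S.delta_pos.le
  have := S.delta_mul_sq_le
  linarith

theorem delta_lam_le (S : Setting (K := K) D P CX Cl) : P.delta * P.lam ≤ 1 := by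
  have h1 := S.delta_lam_d_le
  have h2 : (1 : ℝ) ≤ d := by exact_mod_cast S.one_le_d
  have h3 := mul_pos S.delta_pos S.lam_pos
  nlinarith

/-- Together with the bound on `δ λ_min d`, the condition `γ₁ ≤ 1` bounds `K d log T` by `β₁`. -/
theorem K_d_log_le (S : Setting (K := K) D P CX Cl) : K * d * Real.log P.T ≤ 2 * P.beta1 := by
  have h1 := mul_le_mul_of_nonneg_right S.le_beta1 (Nat.cast_nonneg' d : (0 : ℝ) ≤ d)
  have h2 := mul_le_mul_of_nonneg_right S.delta_lam_d_le S.beta1_pos.le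
  nlinarith

theorem log_T_le (S : Setting (K := K) D P CX Cl) : Real.log P.T ≤ P.beta1 := by
  have h1 := S.K_d_log_le
  have h2 : (1 : ℝ) ≤ d := by exact_mod_cast S.one_le_d
  have h3 := S.K_pos
  have h4 := S.log_T_pos'
  have : (2 : ℝ) ≤ K * d := by nlinarith
  nlinarith

theorem half_le_beta1 (S : Setting (K := K) D P CX Cl) : 1 / 2 ≤ P.beta1 := by
  have h1 := S.log_T_le
  have h2 := S.log_T_pos
  have h3 := Real.log_two_gt_d9
  linarith

end Setting

theorem le_stepsOf (β : ℝ) : 2 * β ≤ stepsOf β + 1 := by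
  have := Nat.le_ceil (2 * β - 1)
  unfold stepsOf; linarith

theorem stepsOf_add_one_le {β : ℝ} (hβ : 1 / 2 ≤ β) : (stepsOf β : ℝ) + 1 ≤ 4 * β := by
  have := Nat.ceil_lt_add_one (show (0 : ℝ) ≤ 2 * β - 1 by linarith)
  unfold stepsOf; linarith

/-! ### The policy as a function of a finite-dimensional history -/

/-- The relevant part of the history before a round: the sums of the parameter estimates, the
learning rate, and the parameters chosen by the environment. -/
abbrev Hist (K d : ℕ) : Type := (Fin K → Ctx d) × ℝ × (Fin K → Ctx d)

section HistPolicy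

variable {K d : ℕ}

/-- The learning rate, cut off from below at `β₁`; it never is below `β₁` in a trial, and the
cut-off makes `histPi` a policy for every value of the history. -/
noncomputable def histRate (P : Params) (y : Hist K d) : ℝ := max y.2.1 P.beta1

/-- The distribution `q(· ∣ x)`. -/
noncomputable def histQ (P : Params) (y : Hist K d) (x : Ctx d) : Fin K → ℝ :=
  softmax (histRate P y) fun a => inner ℝ x (y.1 a)

/-- The exploration rate. -/
noncomputable def histGamma (P : Params) (y : Hist K d) : ℝ := gammaOf K P (histRate P y)

/-- The policy `π(· ∣ x)`. -/
noncomputable def histPi (P : Params) (y : Hist K d) (x : Ctx d) (a : Fin K) : ℝ :=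
  (1 - histGamma P y) * histQ P y x a + histGamma P y / K

theorem measurable_histRate (P : Params) : Measurable (histRate P : Hist K d → ℝ) := by
  unfold histRate; fun_prop

theorem measurable_histQ (P : Params) (a : Fin K) :
    Measurable fun q : Hist K d × Ctx d => histQ P q.1 q.2 a := by
  unfold histQ softmax partition
  have h := (measurable_histRate (K := K) (d := d) P)
  have h1 : ∀ a, Measurable fun q : Hist K d × Ctx d => (inner ℝ q.2 (q.1.1 a) : ℝ) := by
    intro a; fun_prop
  have h2 : Measurable fun q : Hist K d × Ctx d => histRate P q.1 := h.comp measurable_fst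
  have h3 : ∀ a, Measurable fun q : Hist K d × Ctx d =>
      Real.exp (-(inner ℝ q.2 (q.1.1 a) : ℝ) / histRate P q.1) := fun a =>
    Real.measurable_exp.comp ((h1 a).neg.div h2)
  exact (h3 a).div (Finset.measurable_sum _ fun b _ => h3 b)

theorem measurable_histGamma (P : Params) : Measurable (histGamma P : Hist K d → ℝ) := by
  unfold histGamma gammaOf
  exact measurable_const.div (measurable_const.mul (measurable_histRate P))

theorem measurable_histPi (P : Params) (a : Fin K) :
    Measurable fun q : Hist K d × Ctx d => histPi P q.1 q.2 a := by
  unfold histPi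
  have h1 := (measurable_histGamma (K := K) (d := d) P).comp
    (measurable_fst : Measurable (Prod.fst : Hist K d × Ctx d → Hist K d))
  exact ((measurable_const.sub h1).mul (measurable_histQ P a)).add (h1.div_const _)

variable {D : Measure (Ctx d)} {P : Params} {CX Cl : ℝ}

theorem Setting.neZero (S : Setting (K := K) D P CX Cl) : NeZero K :=
  ⟨by have := S.two_le_K; omega⟩

theorem beta1_le_histRate (P : Params) (y : Hist K d) : P.beta1 ≤ histRate P y := le_max_right _ _

theorem Setting.histRate_pos (S : Setting (K := K) D P CX Cl) (y : Hist K d) : 0 < histRate P y :=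
  S.beta1_pos.trans_le (beta1_le_histRate P y)

theorem histQ_mem (S : Setting (K := K) D P CX Cl) (y : Hist K d) (x : Ctx d) :
    histQ P y x ∈ stdSimplex ℝ (Fin K) := by
  have := S.neZero
  exact softmax_mem_stdSimplex _ _

theorem histQ_le_one (S : Setting (K := K) D P CX Cl) (y : Hist K d) (x : Ctx d) (a : Fin K) :
    histQ P y x a ≤ 1 := by
  have := S.neZero
  exact softmax_le_one _ _ a

theorem histGamma_pos (S : Setting (K := K) D P CX Cl) (y : Hist K d) : 0 < histGamma P y := by
  have h1 := S.delta_pos; have h2 := S.lam_pos; have h3 := S.histRate_pos y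
  have h4 := S.log_T_pos'; have h5 := S.K_pos
  unfold histGamma gammaOf
  positivity

theorem histGamma_le (S : Setting (K := K) D P CX Cl) (y : Hist K d) :
    histGamma P y ≤ P.beta1 * (1 / histRate P y) := by
  have h1 := S.delta_pos; have h2 := S.lam_pos; have h3 := S.histRate_pos y
  have h4 := S.le_beta1
  unfold histGamma gammaOf
  rw [div_le_iff₀ (by positivity)]
  have e : P.beta1 * (1 / histRate P y) * (2 * P.delta * P.lam * histRate P y)
      = 2 * P.delta * P.lam * P.beta1 := by field_simp
  rw [e]; exact h4

theorem histGamma_le_one (S : Setting (K := K) D P CX Cl) (y : Hist K d) : histGamma P y ≤ 1 := by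
  refine (histGamma_le S y).trans ?_
  have h3 := S.histRate_pos y
  rw [mul_one_div, div_le_one h3]
  exact beta1_le_histRate P y

theorem histGamma_div_nonneg (S : Setting (K := K) D P CX Cl) (y : Hist K d) :
    0 ≤ histGamma P y / K := div_nonneg (histGamma_pos S y).le (by linarith [S.K_pos])

theorem sum_histPi (S : Setting (K := K) D P CX Cl) (y : Hist K d) (x : Ctx d) :
    ∑ a, histPi P y x a = 1 := by
  have hK : (K : ℝ) ≠ 0 := by linarith [S.K_pos]
  unfold histPi
  rw [Finset.sum_add_distrib, ← Finset.mul_sum, (histQ_mem S y x).2, Finset.sum_const,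
    Finset.card_univ, Fintype.card_fin, nsmul_eq_mul, mul_div_cancel₀ _ hK]
  ring

theorem histGamma_div_le_histPi (S : Setting (K := K) D P CX Cl) (y : Hist K d) (x : Ctx d)
    (a : Fin K) : histGamma P y / K ≤ histPi P y x a := by
  have := mul_nonneg (sub_nonneg.2 (histGamma_le_one S y)) ((histQ_mem S y x).1 a)
  unfold histPi; linarith

theorem measurable_histPi_right (P : Params) (y : Hist K d) (a : Fin K) :
    Measurable fun x => histPi P y x a := by
  have h : Measurable fun x : Ctx d => (y, x) := measurable_prodMk_left
  have h' : Measurable ((fun q : Hist K d × Ctx d => histPi P q.1 q.2 a) ∘ fun x : Ctx d => (y, x)) :=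
    (measurable_histPi P a).comp h
  simp only [Function.comp_def] at h'
  exact h'

theorem histPi_mem (S : Setting (K := K) D P CX Cl) (y : Hist K d) (x : Ctx d) :
    histPi P y x ∈ stdSimplex ℝ (Fin K) :=
  ⟨fun a => (histGamma_div_nonneg S y).trans (histGamma_div_le_histPi S y x a), sum_histPi S y x⟩

theorem isPolicy_histPi (S : Setting (K := K) D P CX Cl) (y : Hist K d) :
    IsPolicy (histPi P y) :=
  ⟨measurable_histPi_right P y, histPi_mem S y⟩

/-- The policy dominates `q` up to a factor `2K`, whatever the exploration rate is. -/
theorem histQ_le_histPi (S : Setting (K := K) D P CX Cl) (y : Hist K d) (x : Ctx d)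
    (a : Fin K) : histQ P y x a ≤ 2 * K * histPi P y x a := by
  have h1 := (histQ_mem S y x).1 a
  have h2 := histQ_le_one S y x a
  have h3 := histGamma_pos S y
  have h4 := S.K_pos
  have e : 2 * (K : ℝ) * histPi P y x a
      = 2 * K * ((1 - histGamma P y) * histQ P y x a) + 2 * histGamma P y := by
    unfold histPi; field_simp
  rw [e]
  rcases le_total (histGamma P y) (1 / 2) with h | h
  · have h5 : (1 / 2 : ℝ) * histQ P y x a ≤ (1 - histGamma P y) * histQ P y x a := by
      gcongr; linarith
    have h6 : 0 ≤ (1 - histGamma P y) * histQ P y x a := by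
      have := mul_nonneg (by norm_num : (0 : ℝ) ≤ 1 / 2) h1; linarith
    have h7 : 2 * ((1 - histGamma P y) * histQ P y x a)
        ≤ K * ((1 - histGamma P y) * histQ P y x a) := by gcongr
    linarith
  · have h6 : 0 ≤ 2 * K * ((1 - histGamma P y) * histQ P y x a) :=
      mul_nonneg (by positivity) (mul_nonneg (sub_nonneg.2 (histGamma_le_one S y)) h1)
    linarith

/-- The policy puts at least half as much mass off any arm as `q` does. -/
theorem one_sub_histQ_le (S : Setting (K := K) D P CX Cl) (y : Hist K d) (x : Ctx d)
    (a : Fin K) : 1 - histQ P y x a ≤ 2 * (1 - histPi P y x a) := by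
  have h1 := (histQ_mem S y x).1 a
  have h2 := histQ_le_one S y x a
  have h3 := histGamma_pos S y
  have h3' := histGamma_le_one S y
  have h4 := S.K_pos
  have h5 : histGamma P y / K ≤ histGamma P y / 2 := by gcongr
  unfold histPi
  nlinarith [mul_nonneg (sub_nonneg.2 h3') (sub_nonneg.2 h2), mul_nonneg h3.le h1]

variable [IsProbabilityMeasure D]

/-- The truncation bias `‖(1 - δ Σ_a)^{M+1}‖` is at most `1 / T`: exploration gives
`Σ_a ≥ (γ / K) λ_min`, and `γ` and `M` are chosen such that `δ (γ / K) λ_min (M + 1) ≥ log T`. -/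
theorem norm_bias_le (S : Setting (K := K) D P CX Cl) (y : Hist K d) (a : Fin K) :
    ‖(1 - P.delta • armMoment D (histPi P y) a) ^ (stepsOf (histRate P y) + 1)‖ ≤ 1 / P.T := by
  have h1 := S.delta_pos; have h2 := S.lam_pos; have h3 := S.histRate_pos y
  have h4 := S.K_pos
  have hg := histGamma_pos S y
  set m := histGamma P y / K with hm
  have hm0 : 0 ≤ m := by positivity
  have hm1 : m ≤ 1 / 2 := by
    rw [hm, div_le_iff₀ (by linarith)]
    have := histGamma_le_one S y
    linarith
  have hpos : P.delta * (m * P.lam) < 1 := by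
    have := S.delta_lam_le
    have h5 : P.delta * (m * P.lam) = (P.delta * P.lam) * m := by ring
    have h6 := mul_pos h1 h2
    rw [h5]; nlinarith
  have hnorm := norm_one_sub_armMoment_le S.CX_pos S.bdd h1.le S.delta_mul_sq_le
    (isPolicy_histPi S y) a hm0 (fun x => histGamma_div_le_histPi S y x a) S.quadratic_lower hpos
  have hT : (0 : ℝ) < P.T := by have := S.two_le_T; positivity
  have hM := le_stepsOf (histRate P y)
  set M := stepsOf (histRate P y)
  have key : P.delta * (m * P.lam) * (2 * histRate P y) = Real.log P.T := by
    rw [hm, histGamma, gammaOf]; field_simp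
  calc ‖(1 - P.delta • armMoment D (histPi P y) a) ^ (M + 1)‖
      ≤ ‖1 - P.delta • armMoment D (histPi P y) a‖ ^ (M + 1) := norm_pow_le' _ (Nat.succ_pos M)
    _ ≤ (1 - P.delta * (m * P.lam)) ^ (M + 1) := by gcongr
    _ ≤ (Real.exp (-(P.delta * (m * P.lam)))) ^ (M + 1) := by
        refine pow_le_pow_left₀ (by linarith) ?_ _
        have := Real.add_one_le_exp (-(P.delta * (m * P.lam)))
        linarith
    _ = Real.exp (-(P.delta * (m * P.lam) * (M + 1))) := by
        rw [← Real.exp_nat_mul]; push_cast; congr 1; ring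
    _ ≤ Real.exp (-Real.log P.T) := by
        rw [Real.exp_le_exp, neg_le_neg_iff, ← key]
        exact mul_le_mul_of_nonneg_left hM (by positivity)
    _ = 1 / P.T := by rw [Real.exp_neg, Real.exp_log hT, one_div]

end HistPolicy

/-! ### Measurability of the algorithm -/

section Algorithm

variable {K d : ℕ}

theorem beta1_div_nonneg {P : Params} (hP : 0 < P.beta1) (r : ℝ) :
    0 ≤ P.beta1 / Real.sqrt r := div_nonneg hP.le (Real.sqrt_nonneg _)

theorem beta1_le_betaAt {P : Params} (hP : 0 < P.beta1) (h : ℕ → RoundData K d) (t : ℕ) :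
    P.beta1 ≤ betaAt P h t := by
  induction t with
  | zero => exact le_rfl
  | succ t ih =>
    rw [betaAt_succ]
    have := beta1_div_nonneg hP (1 + (Real.log K)⁻¹ *
      ∑ s ∈ Finset.range (t + 1), entropy (qAt P h s (h s).ctx))
    linarith

theorem betaAt_pos {P : Params} (hP : 0 < P.beta1) (h : ℕ → RoundData K d) (t : ℕ) :
    0 < betaAt P h t := hP.trans_le (beta1_le_betaAt hP h t)

/-- In every round, `q_t` is given by exponential weights. -/
theorem qOf_eq_softmax [NeZero K] {P : Params} (hP : 0 < P.beta1) (h : ℕ → RoundData K d) (t : ℕ)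
    (x : Ctx d) : qOf t (stateAt P h t) x
      = softmax (betaAt P h t) fun a => inner ℝ x ((stateAt P h t).thetaSum a) := by
  unfold qOf
  split_ifs with ht
  · subst ht
    funext a
    have : (fun a : Fin K => (inner ℝ x ((stateAt P h 0).thetaSum a) : ℝ)) = 0 := by
      funext a; simp [stateAt]
    rw [this, softmax_zero]
  · exact ftrl_eq_softmax (betaAt_pos hP h t) _

theorem stronglyMeasurable_mgr_stepsOf (δ : ℝ) (a : Fin K) :
    StronglyMeasurable fun q : ℝ × (ℕ → Ctx d × Fin K) =>
      mgr δ (stepsOf q.1) a (fun k => (q.2 k).1) (fun k => (q.2 k).2) := by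
  borelize (Matrix (Fin d) (Fin d) ℝ)
  have h1 : Measurable fun q : ℕ × (ℕ → Ctx d × Fin K) =>
      mgr δ q.1 a (fun k => (q.2 k).1) (fun k => (q.2 k).2) :=
    measurable_from_prod_countable_right fun M => (stronglyMeasurable_mgr δ M a).measurable
  have h2 : Measurable (stepsOf : ℝ → ℕ) := by
    unfold stepsOf
    exact Nat.measurable_ceil.comp (by fun_prop)
  have h3 : Measurable fun q : ℝ × (ℕ → Ctx d × Fin K) => (stepsOf q.1, q.2) :=
    (h2.comp measurable_fst).prodMk measurable_snd
  exact (h1.comp h3).stronglyMeasurable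

/-- `θ̂(a)` as a function of the learning rate, the simulated pairs, the context, the arm and the
loss of arm `a`. -/
noncomputable def thetaFun (P : Params) (a : Fin K)
    (q : ℝ × (ℕ → Ctx d × Fin K) × Ctx d × Fin K × ℝ) : Ctx d :=
  if q.2.2.2.1 = a then
    q.2.2.2.2 • Matrix.toEuclideanCLM (𝕜 := ℝ)
      (mgr P.delta (stepsOf q.1) a (fun k => (q.2.1 k).1) (fun k => (q.2.1 k).2)) q.2.2.1
  else 0

theorem continuous_toEuclideanCLM_apply :
    Continuous fun r : Matrix (Fin d) (Fin d) ℝ × Ctx d =>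
      Matrix.toEuclideanCLM (𝕜 := ℝ) r.1 r.2 := by
  have e : Continuous fun N : Matrix (Fin d) (Fin d) ℝ => Matrix.toEuclideanCLM (𝕜 := ℝ) N :=
    LinearMap.continuous_of_finiteDimensional
      (Matrix.toEuclideanCLM (n := Fin d) (𝕜 := ℝ)).toAlgEquiv.toLinearMap
  exact (e.comp continuous_fst).clm_apply continuous_snd

theorem measurable_mgr_apply {S : Type*} [MeasurableSpace S] (δ : ℝ) (a : Fin K) {b : S → ℝ}
    {z : S → ℕ → Ctx d × Fin K} {x : S → Ctx d} (hb : Measurable b) (hz : Measurable z)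
    (hx : Measurable x) :
    Measurable fun s => Matrix.toEuclideanCLM (𝕜 := ℝ)
      (mgr δ (stepsOf (b s)) a (fun k => (z s k).1) (fun k => (z s k).2)) (x s) := by
  have h1 := (stronglyMeasurable_mgr_stepsOf (d := d) δ a).comp_measurable (hb.prodMk hz)
  have h2 := continuous_toEuclideanCLM_apply.comp_stronglyMeasurable
    (h1.prodMk hx.stronglyMeasurable)
  exact h2.measurable

theorem measurable_thetaFun (P : Params) (a : Fin K) :
    Measurable (thetaFun P a : _ → Ctx d) := by
  unfold thetaFun
  refine Measurable.ite ?_ ?_ measurable_const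
  · have : Measurable fun q : ℝ × (ℕ → Ctx d × Fin K) × Ctx d × Fin K × ℝ => q.2.2.2.1 := by fun_prop
    exact this (measurableSet_singleton a)
  · have h1 : Measurable fun q : ℝ × (ℕ → Ctx d × Fin K) × Ctx d × Fin K × ℝ => q.2.2.2.2 := by
      fun_prop
    have h2 : Measurable fun q : ℝ × (ℕ → Ctx d × Fin K) × Ctx d × Fin K × ℝ => q.2.2.1 := by
      fun_prop
    have h3 : Measurable fun q : ℝ × (ℕ → Ctx d × Fin K) × Ctx d × Fin K × ℝ => q.2.1 := by
      fun_prop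
    exact h1.smul (measurable_mgr_apply P.delta a measurable_fst h3 h2)

variable {Ω : Type*}

/-- The simulated pairs of one round and arm. -/
def Trial.sims (R : Trial Ω K d) (t : ℕ) (a : Fin K) (ω : Ω) : ℕ → Ctx d × Fin K :=
  fun k => (R.simX t a k ω, R.simA t a k ω)

/-- The estimate `θ̂_t(a)`. -/
noncomputable def Trial.estimate (R : Trial Ω K d) (P : Params) (t : ℕ) (a : Fin K) (ω : Ω) :
    Ctx d := thetaHat P (betaAt P (R.data ω) t) (R.data ω t) a

theorem Trial.estimate_eq (R : Trial Ω K d) (P : Params) (t : ℕ) (a : Fin K) (ω : Ω) :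
    R.estimate P t a ω = thetaFun P a
      (betaAt P (R.data ω) t, R.sims t a ω, R.X t ω, R.A t ω, R.loss t a ω) := by
  unfold Trial.estimate thetaHat thetaFun
  by_cases h : R.A t ω = a
  · have h' : (R.data ω t).arm = a := h
    rw [if_pos h', if_pos h]
    have e : (R.data ω t).loss = R.loss t a ω := by
      change R.loss t (R.A t ω) ω = _; rw [h]
    rw [e]
    rfl
  · have h' : ¬ (R.data ω t).arm = a := h
    rw [if_neg h', if_neg h]

/-- The history before round `t`. -/
noncomputable def Trial.hist (R : Trial Ω K d) (P : Params) (t : ℕ) (ω : Ω) : Hist K d :=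
  ((stateAt P (R.data ω) t).thetaSum, betaAt P (R.data ω) t, fun a => R.θ t a ω)

theorem Trial.histRate_hist (R : Trial Ω K d) {P : Params} (hP : 0 < P.beta1) (t : ℕ) (ω : Ω) :
    histRate P (R.hist P t ω) = betaAt P (R.data ω) t :=
  max_eq_left (beta1_le_betaAt hP _ t)

theorem Trial.histQ_hist [NeZero K] (R : Trial Ω K d) {P : Params} (hP : 0 < P.beta1) (t : ℕ)
    (ω : Ω) (x : Ctx d) : histQ P (R.hist P t ω) x = qAt P (R.data ω) t x := by
  rw [qAt, qOf_eq_softmax hP, histQ, R.histRate_hist hP]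
  rfl

theorem Trial.policy_eq [NeZero K] (R : Trial Ω K d) {P : Params} (hP : 0 < P.beta1) (t : ℕ)
    (ω : Ω) (x : Ctx d) (a : Fin K) : R.policy P t ω x a = histPi P (R.hist P t ω) x a := by
  unfold Trial.policy policyAt histPi
  rw [R.histQ_hist hP, histGamma, R.histRate_hist hP]

theorem measurable_entropy : Measurable (entropy : (Fin K → ℝ) → ℝ) := by
  unfold entropy
  fun_prop

theorem measurable_softmax_inner {m : MeasurableSpace Ω} {b : Ω → ℝ} {x : Ω → Ctx d}
    {L : Ω → Fin K → Ctx d} (hb : Measurable b) (hx : Measurable x) (hL : ∀ a, Measurable fun ω => L ω a) :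
    Measurable fun ω => softmax (b ω) fun a => inner ℝ (x ω) (L ω a) := by
  have h1 : ∀ a, Measurable fun ω => Real.exp (-(inner ℝ (x ω) (L ω a) : ℝ) / b ω) := fun a =>
    Real.measurable_exp.comp (((hx.inner (hL a)).neg).div hb)
  refine measurable_pi_iff.2 fun a => ?_
  exact (h1 a).div (Finset.measurable_sum _ fun b _ => h1 b)

/-- The random variables of the first `n` rounds are measurable. -/
structure Trial.MeasurableUpTo (R : Trial Ω K d) (m : MeasurableSpace Ω) (n : ℕ) : Prop where
  X : ∀ s < n, Measurable (R.X s)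
  A : ∀ s < n, Measurable (R.A s)
  θ : ∀ s < n, ∀ a, Measurable (R.θ s a)
  ε : ∀ s < n, ∀ a, Measurable (R.ε s a)
  simX : ∀ s < n, ∀ a k, Measurable (R.simX s a k)
  simA : ∀ s < n, ∀ a k, Measurable (R.simA s a k)

theorem Trial.MeasurableUpTo.estimate {R : Trial Ω K d} {m : MeasurableSpace Ω} {n : ℕ}
    (h : R.MeasurableUpTo m n) {P : Params} {s : ℕ} (hs : s < n)
    (hb : Measurable fun ω => betaAt P (R.data ω) s) (a : Fin K) :
    Measurable (R.estimate P s a) := by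
  have h1 : Measurable (R.sims s a) :=
    measurable_pi_iff.2 fun k => (h.simX s hs a k).prodMk (h.simA s hs a k)
  have h2 : Measurable (R.loss s a) := ((h.X s hs).inner (h.θ s hs a)).add (h.ε s hs a)
  have h3 : R.estimate P s a = fun ω => thetaFun P a
      (betaAt P (R.data ω) s, R.sims s a ω, R.X s ω, R.A s ω, R.loss s a ω) :=
    funext (R.estimate_eq P s a)
  rw [h3]
  exact (measurable_thetaFun P a).comp
    (hb.prodMk (h1.prodMk ((h.X s hs).prodMk ((h.A s hs).prodMk h2))))

theorem Trial.MeasurableUpTo.state [NeZero K] {R : Trial Ω K d} {m : MeasurableSpace Ω} {n : ℕ}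
    (h : R.MeasurableUpTo m n) {P : Params} (hP : 0 < P.beta1) :
    ∀ s ≤ n, (∀ a, Measurable fun ω => (stateAt P (R.data ω) s).thetaSum a)
      ∧ Measurable (fun ω => betaAt P (R.data ω) s)
      ∧ Measurable fun ω => (stateAt P (R.data ω) s).entSum := by
  intro s
  induction s with
  | zero =>
    intro _
    exact ⟨fun a => measurable_const, measurable_const, measurable_const⟩
  | succ s ih =>
    intro hs
    obtain ⟨h1, h2, h3⟩ := ih (by omega)
    have h4 : Measurable fun ω => entropy (qOf s (stateAt P (R.data ω) s) (R.data ω s).ctx) := by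
      simp_rw [fun ω => qOf_eq_softmax hP (R.data ω) s (R.data ω s).ctx]
      exact measurable_entropy.comp (measurable_softmax_inner h2 (h.X s hs) h1)
    have h5 := h3.add h4
    refine ⟨fun a => (h1 a).add (h.estimate hs h2 a), ?_, h5⟩
    exact h2.add (measurable_const.div ((measurable_const.add (measurable_const.mul h5)).sqrt))

theorem Trial.MeasurableUpTo.hist [NeZero K] {R : Trial Ω K d} {m : MeasurableSpace Ω} {n : ℕ}
    (h : R.MeasurableUpTo m n) {P : Params} (hP : 0 < P.beta1) {s : ℕ} (hs : s ≤ n)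
    (hθ : ∀ a, Measurable (R.θ s a)) : Measurable (R.hist P s) := by
  obtain ⟨h1, h2, _⟩ := h.state hP s hs
  exact (measurable_pi_iff.2 h1).prodMk (h2.prodMk (measurable_pi_iff.2 hθ))

end Algorithm

section TrialLaws

variable {K d : ℕ} {Ω : Type*} {mΩ : MeasurableSpace Ω} {μ : Measure Ω}
  {R : Trial Ω K d} {P : Params} {D : Measure (Ctx d)} {G : Filtration ℕ mΩ} {CX Cl : ℝ}

namespace Trial.IsBoBWRealFTRL

theorem measurableUpTo (h : R.IsBoBWRealFTRL P D G μ) {n : ℕ} (hn : n ≤ P.T) :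
    R.MeasurableUpTo (G n) n where
  X s hs := (h.past_X s (hs.trans_le hn)).mono (G.mono hs) le_rfl
  A s hs := (h.past_A s (hs.trans_le hn)).mono (G.mono hs) le_rfl
  θ s hs a := (h.choice_θ s (hs.trans_le hn) a).mono (G.mono hs.le) le_rfl
  ε s hs a := (h.past_ε s (hs.trans_le hn) a).mono (G.mono hs) le_rfl
  simX s hs a k := (h.past_simX s (hs.trans_le hn) a k).mono (G.mono hs) le_rfl
  simA s hs a k := (h.past_simA s (hs.trans_le hn) a k).mono (G.mono hs) le_rfl

theorem measurableUpTo_top (h : R.IsBoBWRealFTRL P D G μ) : R.MeasurableUpTo mΩ P.T where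
  X s hs := (h.past_X s hs).mono (G.le _) le_rfl
  A s hs := (h.past_A s hs).mono (G.le _) le_rfl
  θ s hs a := (h.choice_θ s hs a).mono (G.le _) le_rfl
  ε s hs a := (h.past_ε s hs a).mono (G.le _) le_rfl
  simX s hs a k := (h.past_simX s hs a k).mono (G.le _) le_rfl
  simA s hs a k := (h.past_simA s hs a k).mono (G.le _) le_rfl

end Trial.IsBoBWRealFTRL

end TrialLaws

/-! ### The resampling estimator given the history -/

section Round

variable {K d : ℕ}

theorem toEuclideanCLM_mul_mgrW (N : Matrix (Fin d) (Fin d) ℝ) (a : Fin K) (x : Ctx d)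
    (v : Fin K) (u θ : Ctx d) :
    inner ℝ u (Matrix.toEuclideanCLM (𝕜 := ℝ) (N * mgrW a x v) θ)
      = if v = a then inner ℝ x θ * inner ℝ u (Matrix.toEuclideanCLM (𝕜 := ℝ) N x) else 0 := by
  unfold mgrW
  split_ifs with h
  · rw [map_mul, mul_apply_eq_comp]
    have : Matrix.toEuclideanCLM (𝕜 := ℝ) (Matrix.vecMulVec x.ofLp x.ofLp) θ
        = (inner ℝ x θ : ℝ) • x := by
      ext i
      rw [Matrix.ofLp_toEuclideanCLM, Matrix.vecMulVec_mulVec, inner_eq_dotProduct]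
      simp [mul_comm]
    rw [this, map_smul, inner_smul_right]
  · simp

theorem trace_mgrW_mul (a : Fin K) (x : Ctx d) (v : Fin K) (N A : Matrix (Fin d) (Fin d) ℝ) :
    (mgrW a x v * (N.transpose * A * N)).trace
      = if v = a then (N.mulVec x.ofLp) ⬝ᵥ A.mulVec (N.mulVec x.ofLp) else 0 := by
  unfold mgrW
  split_ifs
  · rw [Matrix.vecMulVec_mul, Matrix.trace_vecMulVec, ← Matrix.vecMul_vecMul,
      ← Matrix.vecMul_vecMul, Matrix.vecMul_transpose, dotProduct_comm, ← Matrix.dotProduct_mulVec,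
      ← Matrix.dotProduct_mulVec]
  · simp

theorem norm_toEuclideanCLM_apply_le (N : Matrix (Fin d) (Fin d) ℝ) (x : Ctx d) :
    ‖Matrix.toEuclideanCLM (𝕜 := ℝ) N x‖ ≤ ‖N‖ * ‖x‖ := by
  rw [Matrix.cstar_norm_def]; exact ContinuousLinearMap.le_opNorm _ _

variable {D : Measure (Ctx d)} [IsProbabilityMeasure D] {P : Params} {CX Cl : ℝ}

/-- The law of the context-arm pair of a round, given the history. -/
noncomputable def Setting.pairK (S : Setting (K := K) D P CX Cl) : Kernel (Hist K d) (Ctx d × Fin K) :=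
  pairKernel D (isPolicy_histPi S) (measurable_histPi P)

instance (S : Setting (K := K) D P CX Cl) : IsMarkovKernel S.pairK := by
  unfold Setting.pairK; infer_instance

/-- The law of the simulated pairs of a round, given the history. -/
noncomputable def Setting.seqK (S : Setting (K := K) D P CX Cl) :
    Kernel (Hist K d) (ℕ → Ctx d × Fin K) :=
  seqKernel D (isPolicy_histPi S) (measurable_histPi P)

instance (S : Setting (K := K) D P CX Cl) : IsMarkovKernel S.seqK := by
  unfold Setting.seqK; infer_instance

/-- The resampling estimator for a given history and given simulated pairs. -/
noncomputable def histMgr (P : Params) (a : Fin K) (y : Hist K d) (z : ℕ → Ctx d × Fin K) :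
    Matrix (Fin d) (Fin d) ℝ :=
  mgr P.delta (stepsOf (histRate P y)) a (fun k => (z k).1) (fun k => (z k).2)

theorem stronglyMeasurable_histMgr (P : Params) (a : Fin K) :
    StronglyMeasurable fun q : Hist K d × (ℕ → Ctx d × Fin K) => histMgr P a q.1 q.2 := by
  have h1 : Measurable fun q : Hist K d × (ℕ → Ctx d × Fin K) => (histRate P q.1, q.2) :=
    ((measurable_histRate P).comp measurable_fst).prodMk measurable_snd
  have h2 := (stronglyMeasurable_mgr_stepsOf (d := d) P.delta a).comp_measurable h1
  exact h2

theorem stronglyMeasurable_histMgr_right (P : Params) (a : Fin K) (y : Hist K d) :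
    StronglyMeasurable fun z : ℕ → Ctx d × Fin K => histMgr P a y z :=
  stronglyMeasurable_mgr _ _ _

namespace Setting

/-- Simulated contexts obey the almost sure bound on contexts. -/
theorem ae_seqK (S : Setting (K := K) D P CX Cl) (y : Hist K d) :
    ∀ᵐ z ∂(S.seqK y), ∀ k, ‖(z k).1‖ ≤ CX := by
  have := isProbabilityMeasure_pairLaw D (isPolicy_histPi S y)
  exact ae_infinitePi_forall (pairLaw D (histPi P y)) (ae_pairLaw D S.bdd)

theorem norm_histMgr_le (S : Setting (K := K) D P CX Cl) (a : Fin K) (y : Hist K d)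
    {z : ℕ → Ctx d × Fin K} (hz : ∀ k, ‖(z k).1‖ ≤ CX) :
    ‖histMgr P a y z‖ ≤ P.delta * (4 * histRate P y) := by
  have hδ := S.delta_pos
  refine (norm_mgr_le hδ.le _ a fun k => ?_).trans ?_
  · refine le_trans ?_ S.delta_mul_sq_le
    have := hz k
    gcongr
  · refine mul_le_mul_of_nonneg_left (stepsOf_add_one_le ?_) hδ.le
    exact S.half_le_beta1.trans (beta1_le_histRate P y)

theorem integrable_histMgr (S : Setting (K := K) D P CX Cl) (a : Fin K) (y : Hist K d) :
    Integrable (histMgr P a y) (S.seqK y) := by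
  refine Integrable.of_bound (stronglyMeasurable_histMgr_right P a y).aestronglyMeasurable
    (P.delta * (4 * histRate P y)) ?_
  filter_upwards [S.ae_seqK y] with z hz using S.norm_histMgr_le a y hz

/-- The conditional mean of the resampling estimator. -/
noncomputable def meanMgr (S : Setting (K := K) D P CX Cl) (a : Fin K) (y : Hist K d) :
    Matrix (Fin d) (Fin d) ℝ := ∫ z, histMgr P a y z ∂(S.seqK y)

theorem stronglyMeasurable_meanMgr (S : Setting (K := K) D P CX Cl) (a : Fin K) :
    StronglyMeasurable (S.meanMgr a) :=
  StronglyMeasurable.integral_kernel_prod_right' (κ := S.seqK) (stronglyMeasurable_histMgr P a)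

theorem norm_meanMgr_le (S : Setting (K := K) D P CX Cl) (a : Fin K) (y : Hist K d) :
    ‖S.meanMgr a y‖ ≤ P.delta * (4 * histRate P y) := by
  have h : ∀ᵐ z ∂(S.seqK y), ‖histMgr P a y z‖ ≤ P.delta * (4 * histRate P y) := by
    filter_upwards [S.ae_seqK y] with z hz using S.norm_histMgr_le a y hz
  have h' := norm_integral_le_of_norm_le_const h
  rw [probReal_univ, mul_one] at h'
  exact h'

theorem stronglyMeasurable_armMoment (S : Setting (K := K) D P CX Cl) (a : Fin K) :
    StronglyMeasurable fun y : Hist K d => armMoment D (histPi P y) a := by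
  have h1 : StronglyMeasurable fun q : Hist K d × (Ctx d × Fin K) => mgrW a q.2.1 q.2.2 :=
    (stronglyMeasurable_mgrW a).comp_measurable measurable_snd
  have h2 := StronglyMeasurable.integral_kernel_prod_right' (κ := S.pairK) h1
  exact h2

theorem norm_armMoment_le (S : Setting (K := K) D P CX Cl) (a : Fin K) (y : Hist K d) :
    ‖armMoment D (histPi P y) a‖ ≤ CX ^ 2 := by
  have := isProbabilityMeasure_pairLaw D (isPolicy_histPi S y)
  have h : ∀ᵐ w ∂(pairLaw D (histPi P y)), ‖mgrW a w.1 w.2‖ ≤ CX ^ 2 := by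
    filter_upwards [ae_pairLaw D (p := histPi P y) S.bdd] with w hw using
      norm_mgrW_le a w.2 S.CX_pos hw
  have h' := norm_integral_le_of_norm_le_const h
  rw [probReal_univ, mul_one] at h'
  exact h'

theorem meanMgr_mul_armMoment (S : Setting (K := K) D P CX Cl) (a : Fin K) (y : Hist K d) :
    S.meanMgr a y * armMoment D (histPi P y) a
      = 1 - (1 - P.delta • armMoment D (histPi P y) a) ^ (stepsOf (histRate P y) + 1) :=
  integral_mgr_mul_armMoment S.CX_pos S.bdd S.delta_pos S.delta_mul_sq_le (isPolicy_histPi S y) _ a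

/-- The conditional mean of `Σ̂†ᵀ Σ_a Σ̂†`. -/
noncomputable def meanSq (S : Setting (K := K) D P CX Cl) (a : Fin K) (y : Hist K d) :
    Matrix (Fin d) (Fin d) ℝ :=
  ∫ z, (histMgr P a y z).transpose * armMoment D (histPi P y) a * histMgr P a y z ∂(S.seqK y)

theorem stronglyMeasurable_sq (S : Setting (K := K) D P CX Cl) (a : Fin K) :
    StronglyMeasurable fun q : Hist K d × (ℕ → Ctx d × Fin K) =>
      (histMgr P a q.1 q.2).transpose * armMoment D (histPi P q.1) a * histMgr P a q.1 q.2 := by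
  have h1 := stronglyMeasurable_histMgr (K := K) (d := d) P a
  have h2 : StronglyMeasurable fun q : Hist K d × (ℕ → Ctx d × Fin K) =>
      armMoment D (histPi P q.1) a := by
    have := (S.stronglyMeasurable_armMoment a).comp_measurable
      (measurable_fst : Measurable (Prod.fst : Hist K d × (ℕ → Ctx d × Fin K) → Hist K d))
    exact this
  have h3 : StronglyMeasurable fun q : Hist K d × (ℕ → Ctx d × Fin K) =>
      (histMgr P a q.1 q.2).transpose := by
    have := (continuous_id.matrix_transpose).comp_stronglyMeasurable h1
    exact this
  exact (h3.mul h2).mul h1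

theorem stronglyMeasurable_meanSq (S : Setting (K := K) D P CX Cl) (a : Fin K) :
    StronglyMeasurable (S.meanSq a) :=
  StronglyMeasurable.integral_kernel_prod_right' (κ := S.seqK) (S.stronglyMeasurable_sq a)

theorem norm_sq_le (S : Setting (K := K) D P CX Cl) (a : Fin K) (y : Hist K d)
    {z : ℕ → Ctx d × Fin K} (hz : ∀ k, ‖(z k).1‖ ≤ CX) :
    ‖(histMgr P a y z).transpose * armMoment D (histPi P y) a * histMgr P a y z‖
      ≤ P.delta * (4 * histRate P y) * CX ^ 2 * (P.delta * (4 * histRate P y)) := by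
  have h1 := S.norm_histMgr_le a y hz
  have h2 := S.norm_armMoment_le a y
  have h3 : ‖(histMgr P a y z).transpose‖ ≤ P.delta * (4 * histRate P y) := by
    have := Matrix.l2_opNorm_conjTranspose (histMgr P a y z)
    rw [Matrix.conjTranspose_eq_transpose_of_trivial] at this
    exact this.trans_le h1
  have h0 : 0 ≤ P.delta * (4 * histRate P y) := (norm_nonneg _).trans h1
  refine (norm_mul_le _ _).trans (mul_le_mul ((norm_mul_le _ _).trans ?_) h1 (norm_nonneg _) ?_)
  · exact mul_le_mul h3 h2 (norm_nonneg _) h0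
  · exact mul_nonneg h0 (sq_nonneg _)

theorem integrable_sq (S : Setting (K := K) D P CX Cl) (a : Fin K) (y : Hist K d) :
    Integrable (fun z => (histMgr P a y z).transpose * armMoment D (histPi P y) a
      * histMgr P a y z) (S.seqK y) := by
  have h : StronglyMeasurable fun z => (histMgr P a y z).transpose * armMoment D (histPi P y) a
      * histMgr P a y z := by
    have := (S.stronglyMeasurable_sq a).comp_measurable (measurable_prodMk_left (x := y))
    exact this
  refine Integrable.of_bound h.aestronglyMeasurable
    (P.delta * (4 * histRate P y) * CX ^ 2 * (P.delta * (4 * histRate P y))) ?_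
  filter_upwards [S.ae_seqK y] with z hz using S.norm_sq_le a y hz

theorem norm_meanSq_le (S : Setting (K := K) D P CX Cl) (a : Fin K) (y : Hist K d) :
    ‖S.meanSq a y‖ ≤ P.delta * (4 * histRate P y) * CX ^ 2 * (P.delta * (4 * histRate P y)) := by
  have h : ∀ᵐ z ∂(S.seqK y), ‖(histMgr P a y z).transpose * armMoment D (histPi P y) a
      * histMgr P a y z‖
      ≤ P.delta * (4 * histRate P y) * CX ^ 2 * (P.delta * (4 * histRate P y)) := by
    filter_upwards [S.ae_seqK y] with z hz using S.norm_sq_le a y hz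
  have h' := norm_integral_le_of_norm_le_const h
  rw [probReal_univ, mul_one] at h'
  exact h'

theorem trace_armMoment_mul_meanSq_le (S : Setting (K := K) D P CX Cl) (a : Fin K)
    (y : Hist K d) : (armMoment D (histPi P y) a * S.meanSq a y).trace ≤ 2 * d := by
  have h := IsContraction.integral_linear (S.integrable_sq a y)
    (IsContraction.traceLin (armMoment D (histPi P y) a) 1 1)
  simp only [IsContraction.traceLin, LinearMap.coe_mk, AddHom.coe_mk, mul_one] at h
  unfold meanSq
  rw [← h]
  refine le_trans (le_of_eq (integral_congr_ae (Filter.Eventually.of_forall fun z => ?_)))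
    (integral_trace_mgr_le S.CX_pos S.bdd S.delta_pos S.delta_mul_sq_le (isPolicy_histPi S y)
      (stepsOf (histRate P y)) a)
  simp only
  change _ = (armMoment D (histPi P y) a * histMgr P a y z * armMoment D (histPi P y) a
    * (histMgr P a y z).transpose).trace
  rw [Matrix.trace_mul_comm, Matrix.trace_mul_comm _ (histMgr P a y z).transpose]
  simp only [mul_assoc]

end Setting

end Round

/-! ### Laws of the random variables of a trial -/

/-- A trial of the algorithm with bounded parameters, errors and losses. -/
structure Trial.IsAdmissible {Ω : Type*} {K d : ℕ} {mΩ : MeasurableSpace Ω} (R : Trial Ω K d)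
    (P : Params) (D : Measure (Ctx d)) (G : Filtration ℕ mΩ) (μ : Measure Ω)
    (CX CΘ CE Cl : ℝ) : Prop where
  setting : Setting (K := K) D P CX Cl
  play : R.IsBoBWRealFTRL P D G μ
  CΘ_pos : 0 < CΘ
  norm_θ : ∀ t < P.T, ∀ a, ∀ᵐ ω ∂μ, ‖R.θ t a ω‖ ≤ CΘ
  abs_ε : ∀ t < P.T, ∀ a, ∀ᵐ ω ∂μ, |R.ε t a ω| ≤ CE
  abs_loss : ∀ t < P.T, ∀ a, ∀ᵐ ω ∂μ, |R.loss t a ω| ≤ Cl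

section Info

variable {Ω : Type*} {K d : ℕ}

/-- All that is known in a round before the resampling for arm `a`. -/
noncomputable def Trial.info (R : Trial Ω K d) (P : Params) (t : ℕ) (a : Fin K)
    (ω : Ω) : Hist K d × (Ctx d × Fin K) × ℝ :=
  (R.hist P t ω, (R.X t ω, R.A t ω), R.ε t a ω)

theorem measurable_histPi_info (P : Params) (b : Fin K) :
    Measurable fun q : (Hist K d × (Ctx d × Fin K) × ℝ) × Ctx d => histPi P q.1.1 q.2 b := by
  have e : Measurable fun q : (Hist K d × (Ctx d × Fin K) × ℝ) × Ctx d => (q.1.1, q.2) :=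
    (measurable_fst.comp measurable_fst).prodMk measurable_snd
  have := (measurable_histPi P b).comp e
  simp only [Function.comp_def] at this
  exact this

variable {P : Params} {D : Measure (Ctx d)} {CX Cl : ℝ} [IsProbabilityMeasure D]

/-- The law of the simulated pairs given the information before the resampling. -/
noncomputable def Setting.infoK (S : Setting (K := K) D P CX Cl) :
    Kernel (Hist K d × (Ctx d × Fin K) × ℝ) (ℕ → Ctx d × Fin K) :=
  seqKernel D (p := fun y => histPi P y.1) (fun y => isPolicy_histPi S y.1)
    (measurable_histPi_info P)

instance (S : Setting (K := K) D P CX Cl) : IsMarkovKernel S.infoK := by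
  unfold Setting.infoK; infer_instance

theorem Setting.infoK_apply (S : Setting (K := K) D P CX Cl)
    (y : Hist K d × (Ctx d × Fin K) × ℝ) : S.infoK y = S.seqK y.1 := rfl

end Info

namespace Trial.IsAdmissible

variable {Ω : Type*} {K d : ℕ} {mΩ : MeasurableSpace Ω} {R : Trial Ω K d}
  {P : Params} {D : Measure (Ctx d)} {G : Filtration ℕ mΩ} {μ : Measure Ω} {CX CΘ CE Cl : ℝ}

theorem measurable_hist_G (h : R.IsAdmissible P D G μ CX CΘ CE Cl) {t : ℕ} (ht : t < P.T) :
    Measurable[G t] (R.hist P t) := by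
  have := h.setting.neZero
  exact (h.play.measurableUpTo ht.le).hist h.setting.beta1_pos le_rfl (h.play.choice_θ t ht)

theorem measurable_hist (h : R.IsAdmissible P D G μ CX CΘ CE Cl) {t : ℕ} (ht : t < P.T) :
    Measurable (R.hist P t) := (h.measurable_hist_G ht).mono (G.le t) le_rfl

theorem measurable_X (h : R.IsAdmissible P D G μ CX CΘ CE Cl) {t : ℕ} (ht : t < P.T) :
    Measurable (R.X t) := h.play.measurableUpTo_top.X t ht

theorem measurable_A (h : R.IsAdmissible P D G μ CX CΘ CE Cl) {t : ℕ} (ht : t < P.T) :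
    Measurable (R.A t) := h.play.measurableUpTo_top.A t ht

theorem measurable_θ (h : R.IsAdmissible P D G μ CX CΘ CE Cl) {t : ℕ} (ht : t < P.T) (a : Fin K) :
    Measurable (R.θ t a) := h.play.measurableUpTo_top.θ t ht a

theorem measurable_ε (h : R.IsAdmissible P D G μ CX CΘ CE Cl) {t : ℕ} (ht : t < P.T) (a : Fin K) :
    Measurable (R.ε t a) := h.play.measurableUpTo_top.ε t ht a

theorem measurable_beta (h : R.IsAdmissible P D G μ CX CΘ CE Cl) {t : ℕ} (ht : t ≤ P.T) :
    Measurable fun ω => betaAt P (R.data ω) t := by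
  have := h.setting.neZero
  exact (h.play.measurableUpTo_top.state h.setting.beta1_pos t ht).2.1

theorem measurable_beta_G (h : R.IsAdmissible P D G μ CX CΘ CE Cl) {t : ℕ} (ht : t ≤ P.T) :
    Measurable[G t] fun ω => betaAt P (R.data ω) t := by
  have := h.setting.neZero
  exact ((h.play.measurableUpTo ht).state h.setting.beta1_pos t le_rfl).2.1

theorem measurable_estimate (h : R.IsAdmissible P D G μ CX CΘ CE Cl) {t : ℕ} (ht : t < P.T)
    (a : Fin K) : Measurable (R.estimate P t a) :=
  h.play.measurableUpTo_top.estimate ht (h.measurable_beta ht.le) a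

theorem histRate_hist (h : R.IsAdmissible P D G μ CX CΘ CE Cl) (t : ℕ) (ω : Ω) :
    histRate P (R.hist P t ω) = betaAt P (R.data ω) t :=
  R.histRate_hist h.setting.beta1_pos t ω

theorem beta_pos (h : R.IsAdmissible P D G μ CX CΘ CE Cl) (t : ℕ) (ω : Ω) :
    0 < betaAt P (R.data ω) t := betaAt_pos h.setting.beta1_pos _ t

/-- The learning rate is bounded, uniformly over all outcomes. -/
theorem beta_le (h : R.IsAdmissible P D G μ CX CΘ CE Cl) (t : ℕ) (ω : Ω) :
    betaAt P (R.data ω) t ≤ (t + 1) * P.beta1 := by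
  have := h.setting.neZero
  have hB := h.setting.beta1_pos
  induction t with
  | zero => simp [betaAt, stateAt]
  | succ t ih =>
    rw [betaAt_succ]
    have h1 : 0 ≤ ∑ s ∈ Finset.range (t + 1), entropy (qAt P (R.data ω) s (R.data ω s).ctx) := by
      refine Finset.sum_nonneg fun s _ => entropy_nonneg ?_
      rw [qAt, qOf_eq_softmax hB]
      exact softmax_mem_stdSimplex _ _
    have h2 : 0 ≤ Real.log K := Real.log_natCast_nonneg K
    have h3 : 1 ≤ Real.sqrt (1 + (Real.log K)⁻¹ *
        ∑ s ∈ Finset.range (t + 1), entropy (qAt P (R.data ω) s (R.data ω s).ctx)) := by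
      rw [Real.one_le_sqrt]
      have := mul_nonneg (inv_nonneg.2 h2) h1
      linarith
    have h4 := div_le_self hB.le h3
    push_cast
    linarith

theorem ae_X (h : R.IsAdmissible P D G μ CX CΘ CE Cl) {t : ℕ} (ht : t < P.T) :
    ∀ᵐ ω ∂μ, ‖R.X t ω‖ ≤ CX := by
  have h1 := h.setting.bdd
  rw [← h.play.law_X t ht] at h1
  exact ae_of_ae_map (h.measurable_X ht).aemeasurable h1

theorem measurable_info (h : R.IsAdmissible P D G μ CX CΘ CE Cl) {t : ℕ} (ht : t < P.T)
    (a : Fin K) : Measurable (R.info P t a) :=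
  (h.measurable_hist ht).prodMk (((h.measurable_X ht).prodMk (h.measurable_A ht)).prodMk
    (h.measurable_ε ht a))

theorem measurable_sims (h : R.IsAdmissible P D G μ CX CΘ CE Cl) {t : ℕ} (ht : t < P.T)
    (a : Fin K) : Measurable (R.sims t a) :=
  measurable_pi_iff.2 fun k => (h.play.measurableUpTo_top.simX t ht a k).prodMk
    (h.play.measurableUpTo_top.simA t ht a k)

theorem estimate_eq' (h : R.IsAdmissible P D G μ CX CΘ CE Cl) (t : ℕ) (a : Fin K) (ω : Ω) :
    R.estimate P t a ω = if R.A t ω = a then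
      R.loss t a ω • Matrix.toEuclideanCLM (𝕜 := ℝ)
        (histMgr P a (R.hist P t ω) (R.sims t a ω)) (R.X t ω) else 0 := by
  rw [R.estimate_eq, thetaFun, histMgr, h.histRate_hist]

variable [IsProbabilityMeasure μ]

theorem map_ctx (h : R.IsAdmissible P D G μ CX CΘ CE Cl) {t : ℕ} (ht : t < P.T) {S : Type*}
    [MeasurableSpace S] {Y : Ω → S} (hY : Measurable[G t] Y) :
    μ.map (fun ω => (Y ω, R.X t ω)) = (μ.map Y).prod D :=
  map_ctx_eq_prod (G.le t) hY (h.measurable_X ht) (h.play.law_X t ht) (h.play.indep_X t ht)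

variable [IsProbabilityMeasure D]

/-- The context and the arm of a round, given the history. -/
theorem map_pair (h : R.IsAdmissible P D G μ CX CΘ CE Cl) {t : ℕ} (ht : t < P.T) :
    μ.map (fun ω => (R.hist P t ω, (R.X t ω, R.A t ω)))
      = (μ.map (R.hist P t)) ⊗ₘ h.setting.pairK := by
  have := h.setting.neZero
  refine map_pair_eq_compProd (G.le t) (h.measurable_hist_G ht) (h.measurable_X ht)
    (h.measurable_A ht) (h.play.law_X t ht) (h.play.indep_X t ht) (isPolicy_histPi h.setting)
    (measurable_histPi P) fun a => ?_
  refine (h.play.law_A t ht a).trans (Filter.Eventually.of_forall fun ω => ?_)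
  exact R.policy_eq h.setting.beta1_pos t ω _ a

/-- The simulated pairs for arm `a` are conditionally i.i.d. given all that is known before. -/
theorem map_info (h : R.IsAdmissible P D G μ CX CΘ CE Cl) {t : ℕ} (ht : t < P.T) (a : Fin K) :
    μ.map (fun ω => (R.info P t a ω, R.sims t a ω))
      = (μ.map (R.info P t a)) ⊗ₘ h.setting.infoK := by
  have := h.setting.neZero
  have hX : MeasurableSpace.comap (R.X t) inferInstance ≤ mΩ := (h.measurable_X ht).comap_le
  have hA : MeasurableSpace.comap (R.A t) inferInstance ≤ mΩ := (h.measurable_A ht).comap_le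
  have hE : (⨆ a', MeasurableSpace.comap (R.ε t a') inferInstance) ≤ mΩ :=
    iSup_le fun a' => (h.measurable_ε ht a').comap_le
  set ℋ := G t ⊔ MeasurableSpace.comap (R.X t) inferInstance
    ⊔ MeasurableSpace.comap (R.A t) inferInstance
    ⊔ ⨆ a', MeasurableSpace.comap (R.ε t a') inferInstance with hℋ
  have hm : ℋ ≤ mΩ := sup_le (sup_le (sup_le (G.le t) hX) hA) hE
  have m1 : Measurable[ℋ] (R.hist P t) :=
    (h.measurable_hist_G ht).mono (le_sup_left.trans (le_sup_left.trans le_sup_left)) le_rfl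
  have m2 : Measurable[ℋ] (R.X t) :=
    (comap_measurable (R.X t)).mono (le_sup_right.trans (le_sup_left.trans le_sup_left)) le_rfl
  have m3 : Measurable[ℋ] (R.A t) :=
    (comap_measurable (R.A t)).mono (le_sup_right.trans le_sup_left) le_rfl
  have m4 : Measurable[ℋ] (R.ε t a) :=
    (comap_measurable (R.ε t a)).mono
      ((le_iSup (fun a' => MeasurableSpace.comap (R.ε t a') inferInstance) a).trans le_sup_right)
      le_rfl
  have hY : Measurable[ℋ] (R.info P t a) := m1.prodMk ((m2.prodMk m3).prodMk m4)
  have hlaw : ∀ (n : ℕ) (B : ℕ → Set (Ctx d)) (b : ℕ → Fin K), (∀ k, MeasurableSet (B k)) →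
      μ[Set.indicator {ω | ∀ k < n, R.simX t a k ω ∈ B k ∧ R.simA t a k ω = b k}
        (fun _ => (1 : ℝ)) | ℋ]
        =ᵐ[μ] fun ω => ∏ k ∈ Finset.range n,
          ∫ x in B k, histPi P (R.info P t a ω).1 x (b k) ∂D := by
    intro n B b hB
    refine (h.play.law_sim t ht a n B b hB).trans (Filter.Eventually.of_forall fun ω => ?_)
    refine Finset.prod_congr rfl fun k _ => ?_
    refine integral_congr_ae (Filter.Eventually.of_forall fun x => ?_)
    exact R.policy_eq h.setting.beta1_pos t ω x (b k)
  have hsX : ∀ k, Measurable[mΩ] (R.simX t a k) := fun k => h.play.measurableUpTo_top.simX t ht a k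
  have hsA : ∀ k, Measurable[mΩ] (R.simA t a k) := fun k => h.play.measurableUpTo_top.simA t ht a k
  have key := map_seq_eq_compProd (p := fun y : Hist K d × (Ctx d × Fin K) × ℝ => histPi P y.1) hm hY hsX hsA
    (fun y => isPolicy_histPi h.setting y.1) (measurable_histPi_info P) hlaw
  exact key

theorem ae_sims (h : R.IsAdmissible P D G μ CX CΘ CE Cl) {t : ℕ} (ht : t < P.T) (a : Fin K) :
    ∀ᵐ ω ∂μ, ∀ k, ‖(R.sims t a ω k).1‖ ≤ CX := by
  have hs : MeasurableSet {z : ℕ → Ctx d × Fin K | ∀ k, ‖(z k).1‖ ≤ CX} := by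
    have : {z : ℕ → Ctx d × Fin K | ∀ k, ‖(z k).1‖ ≤ CX} = ⋂ k, {z | ‖(z k).1‖ ≤ CX} := by
      ext z; simp
    rw [this]
    refine MeasurableSet.iInter fun k => measurableSet_le ?_ measurable_const
    fun_prop
  have := ae_freeze (h.measurable_info ht a) (h.measurable_sims ht a) (h.map_info ht a) hs
    fun y => h.setting.ae_seqK y.1
  filter_upwards [this] with ω hω using hω

/-- The estimates are at most of the order of the learning rate, so that the estimated losses, divided
by the learning rate, stay bounded. -/
theorem ae_norm_estimate (h : R.IsAdmissible P D G μ CX CΘ CE Cl) {t : ℕ} (ht : t < P.T)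
    (a : Fin K) : ∀ᵐ ω ∂μ, ‖R.estimate P t a ω‖ ≤ 2 * betaAt P (R.data ω) t := by
  filter_upwards [h.ae_X ht, h.ae_sims ht a, h.abs_loss t ht a] with ω h1 h2 h3
  have hb := h.beta_pos t ω
  rw [h.estimate_eq']
  split_ifs
  · rw [norm_smul, Real.norm_eq_abs]
    have h4 := h.setting.norm_histMgr_le a (R.hist P t ω) h2
    rw [h.histRate_hist] at h4
    have h5 := norm_toEuclideanCLM_apply_le (histMgr P a (R.hist P t ω) (R.sims t a ω)) (R.X t ω)
    have hδ := h.setting.delta_pos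
    have hCl := h.setting.Cl_pos
    calc |R.loss t a ω| * ‖Matrix.toEuclideanCLM (𝕜 := ℝ)
          (histMgr P a (R.hist P t ω) (R.sims t a ω)) (R.X t ω)‖
        ≤ Cl * (P.delta * (4 * betaAt P (R.data ω) t) * CX) := by
          refine mul_le_mul h3 (h5.trans ?_) (norm_nonneg _) hCl.le
          exact mul_le_mul h4 h1 (norm_nonneg _) (by positivity)
      _ = (P.delta * (Cl * CX)) * (4 * betaAt P (R.data ω) t) := by ring
      _ = 2 * betaAt P (R.data ω) t := by rw [h.setting.delta_mul]; ring
  · simp; exact hb.le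

end Trial.IsAdmissible

/-! ### Bias and variance of the estimates -/

section Linear

variable {d : ℕ}

theorem measurable_toEuclideanCLM_apply {S : Type*} {mS : MeasurableSpace S}
    {N : S → Matrix (Fin d) (Fin d) ℝ} {x : S → Ctx d} (hN : StronglyMeasurable N)
    (hx : Measurable x) : Measurable fun s => Matrix.toEuclideanCLM (𝕜 := ℝ) (N s) (x s) := by
  have h2 := continuous_toEuclideanCLM_apply.comp_stronglyMeasurable
    (hN.prodMk hx.stronglyMeasurable)
  exact h2.measurable

/-- `V ↦ ⟨u, V x⟩` as a linear functional. -/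
noncomputable def pairing (u x : Ctx d) : Matrix (Fin d) (Fin d) ℝ →ₗ[ℝ] ℝ where
  toFun V := inner ℝ u (Matrix.toEuclideanCLM (𝕜 := ℝ) V x)
  map_add' V W := by simp [inner_add_right]
  map_smul' c V := by simp [inner_smul_right]

end Linear

namespace Trial.IsAdmissible

variable {Ω : Type*} {K d : ℕ} {mΩ : MeasurableSpace Ω} {R : Trial Ω K d}
  {P : Params} {D : Measure (Ctx d)} {G : Filtration ℕ mΩ} {μ : Measure Ω} {CX CΘ CE Cl : ℝ}

variable [IsProbabilityMeasure μ]

/-- The error terms average out against bounded functions of the past, the context and the arm. -/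
theorem integral_mul_ε (h : R.IsAdmissible P D G μ CX CΘ CE Cl) {t : ℕ} (ht : t < P.T)
    (a : Fin K) {g : Ω → ℝ} {C : ℝ}
    (hg : Measurable[G t ⊔ MeasurableSpace.comap (R.X t) inferInstance
        ⊔ MeasurableSpace.comap (R.A t) inferInstance] g) (hgC : ∀ᵐ ω ∂μ, |g ω| ≤ C) :
    ∫ ω, g ω * R.ε t a ω ∂μ = 0 := by
  have hX : MeasurableSpace.comap (R.X t) inferInstance ≤ mΩ := (h.measurable_X ht).comap_le
  have hA : MeasurableSpace.comap (R.A t) inferInstance ≤ mΩ := (h.measurable_A ht).comap_le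
  have hm : G t ⊔ MeasurableSpace.comap (R.X t) inferInstance
    ⊔ MeasurableSpace.comap (R.A t) inferInstance ≤ mΩ := sup_le (sup_le (G.le t) hX) hA
  have hε : Integrable (R.ε t a) μ :=
    Integrable.of_bound (h.measurable_ε ht a).aestronglyMeasurable CE (h.abs_ε t ht a)
  have hgε : Integrable (g * R.ε t a) μ :=
    hε.bdd_mul (hg.mono hm le_rfl).aestronglyMeasurable hgC
  have h1 := condExp_mul_of_stronglyMeasurable_left hg.stronglyMeasurable hgε hε
  have h2 : ∫ ω, (g * R.ε t a) ω ∂μ = 0 := by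
    rw [← integral_condExp hm]
    refine integral_eq_zero_of_ae ?_
    filter_upwards [h1, h.play.mean_ε t ht a] with ω h3 h4
    rw [h3, Pi.mul_apply, h4]; simp
  exact h2

variable [IsProbabilityMeasure D]

/-- The mean of the estimate, tested against a bounded function of the history. The simulated pairs
are integrated out first; given the history, they are independent of the context, the arm and the
error. -/
theorem integral_inner_estimate (h : R.IsAdmissible P D G μ CX CΘ CE Cl) {t : ℕ} (ht : t < P.T)
    (a : Fin K) {u : Hist K d → Ctx d} (hu : Measurable u) {Cu : ℝ} (huC : ∀ y, ‖u y‖ ≤ Cu) :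
    ∫ ω, inner ℝ (u (R.hist P t ω)) (R.estimate P t a ω) ∂μ
      = ∫ ω, inner ℝ (u (R.hist P t ω)) (Matrix.toEuclideanCLM (𝕜 := ℝ)
          (h.setting.meanMgr a (R.hist P t ω) * armMoment D (histPi P (R.hist P t ω)) a)
          (R.θ t a ω)) ∂μ := by
  have S := h.setting
  have hβmax : ∀ ω, betaAt P (R.data ω) t ≤ (t + 1) * P.beta1 := h.beta_le t
  have hCu : 0 ≤ Cu := (norm_nonneg _).trans (huC (0, 0, 0))
  have hδ := S.delta_pos
  have hCX := S.CX_pos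
  have hB := S.beta1_pos
  -- integrate out the simulated pairs
  let F : Hist K d × (Ctx d × Fin K) × ℝ → (ℕ → Ctx d × Fin K) → ℝ := fun i z =>
    if i.2.1.2 = a then
      (inner ℝ i.2.1.1 (i.1.2.2 a) + i.2.2) * inner ℝ (u i.1)
        (Matrix.toEuclideanCLM (𝕜 := ℝ) (histMgr P a i.1 z) i.2.1.1)
    else 0
  have hFm : StronglyMeasurable (Function.uncurry F) := by
    have e1 : Measurable fun q : (Hist K d × (Ctx d × Fin K) × ℝ) × (ℕ → Ctx d × Fin K) =>
      q.1.2.1.2 := by fun_prop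
    have e2 : Measurable fun q : (Hist K d × (Ctx d × Fin K) × ℝ) × (ℕ → Ctx d × Fin K) =>
      q.1.2.1.1 := by fun_prop
    have e3 : Measurable fun q : (Hist K d × (Ctx d × Fin K) × ℝ) × (ℕ → Ctx d × Fin K) =>
      (inner ℝ q.1.2.1.1 (q.1.1.2.2 a) + q.1.2.2 : ℝ) := by fun_prop
    have e4 : Measurable fun q : (Hist K d × (Ctx d × Fin K) × ℝ) × (ℕ → Ctx d × Fin K) =>
      (q.1.1, q.2) := by fun_prop
    have e5 := (stronglyMeasurable_histMgr (K := K) (d := d) P a).comp_measurable e4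
    have e6 := measurable_toEuclideanCLM_apply e5 e2
    have e7 : Measurable fun q : (Hist K d × (Ctx d × Fin K) × ℝ) × (ℕ → Ctx d × Fin K) =>
      u q.1.1 := hu.comp (by fun_prop)
    exact (Measurable.ite (e1 (measurableSet_singleton a)) (e3.mul (e7.inner e6))
      measurable_const).stronglyMeasurable
  have hF : ∀ ω, inner ℝ (u (R.hist P t ω)) (R.estimate P t a ω)
      = F (R.info P t a ω) (R.sims t a ω) := by
    intro ω
    rw [h.estimate_eq']
    simp only [F, Trial.info]
    split_ifs with hA
    · rw [inner_smul_right]; rfl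
    · simp
  have hFi : Integrable (fun ω => F (R.info P t a ω) (R.sims t a ω)) μ := by
    simp_rw [← hF]
    have hm : Measurable fun ω => (inner ℝ (u (R.hist P t ω)) (R.estimate P t a ω) : ℝ) :=
      (hu.comp (h.measurable_hist ht)).inner (h.measurable_estimate ht a)
    refine Integrable.of_bound hm.aestronglyMeasurable (Cu * (2 * ((t + 1) * P.beta1))) ?_
    filter_upwards [h.ae_norm_estimate ht a] with ω hω
    refine (norm_inner_le_norm _ _).trans (mul_le_mul (huC _) (hω.trans ?_) (norm_nonneg _) hCu)
    have := hβmax ω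
    linarith
  have hmean : ∀ i, ∫ z, F i z ∂(S.infoK i) = if i.2.1.2 = a then
      (inner ℝ i.2.1.1 (i.1.2.2 a) + i.2.2) * inner ℝ (u i.1)
        (Matrix.toEuclideanCLM (𝕜 := ℝ) (S.meanMgr a i.1) i.2.1.1) else 0 := by
    intro i
    rw [S.infoK_apply]
    simp only [F]
    split_ifs
    · rw [integral_const_mul]
      congr 1
      exact IsContraction.integral_linear (S.integrable_histMgr a i.1) (pairing (u i.1) i.2.1.1)
    · simp
  have step1 : ∫ ω, inner ℝ (u (R.hist P t ω)) (R.estimate P t a ω) ∂μ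
      = ∫ ω, (if R.A t ω = a then (inner ℝ (R.X t ω) (R.θ t a ω) + R.ε t a ω)
          * inner ℝ (u (R.hist P t ω)) (Matrix.toEuclideanCLM (𝕜 := ℝ)
            (S.meanMgr a (R.hist P t ω)) (R.X t ω)) else 0) ∂μ := by
    simp_rw [hF]
    rw [integral_freeze (h.measurable_info ht a) (h.measurable_sims ht a) (h.map_info ht a) hFm hFi]
    refine integral_congr_ae (Filter.Eventually.of_forall fun ω => ?_)
    exact hmean (R.info P t a ω)
  -- the error term vanishes
  let g : Ω → ℝ := fun ω => if R.A t ω = a then inner ℝ (u (R.hist P t ω))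
    (Matrix.toEuclideanCLM (𝕜 := ℝ) (S.meanMgr a (R.hist P t ω)) (R.X t ω)) else 0
  have hgm : Measurable[G t ⊔ MeasurableSpace.comap (R.X t) inferInstance
        ⊔ MeasurableSpace.comap (R.A t) inferInstance] g := by
    have m1 : Measurable[G t ⊔ MeasurableSpace.comap (R.X t) inferInstance
        ⊔ MeasurableSpace.comap (R.A t) inferInstance] (R.hist P t) :=
      (h.measurable_hist_G ht).mono (le_sup_left.trans le_sup_left) le_rfl
    have m2 : Measurable[G t ⊔ MeasurableSpace.comap (R.X t) inferInstance
        ⊔ MeasurableSpace.comap (R.A t) inferInstance] (R.X t) :=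
      (comap_measurable (R.X t)).mono (le_sup_right.trans le_sup_left) le_rfl
    have m3 : Measurable[G t ⊔ MeasurableSpace.comap (R.X t) inferInstance
        ⊔ MeasurableSpace.comap (R.A t) inferInstance] (R.A t) :=
      (comap_measurable (R.A t)).mono le_sup_right le_rfl
    have e5 := (S.stronglyMeasurable_meanMgr a).comp_measurable m1
    have e6 := measurable_toEuclideanCLM_apply e5 m2
    exact Measurable.ite (m3 (measurableSet_singleton a)) ((hu.comp m1).inner e6) measurable_const
  have hgC : ∀ᵐ ω ∂μ, |g ω| ≤ Cu * (P.delta * (4 * ((t + 1) * P.beta1)) * CX) := by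
    filter_upwards [h.ae_X ht] with ω hω
    have hpos : 0 ≤ Cu * (P.delta * (4 * ((t + 1) * P.beta1)) * CX) := by positivity
    simp only [g]
    split_ifs
    · refine (abs_real_inner_le_norm _ _).trans (mul_le_mul (huC _) ?_ (norm_nonneg _) hCu)
      refine (norm_toEuclideanCLM_apply_le _ _).trans ?_
      have h1 := S.norm_meanMgr_le a (R.hist P t ω)
      rw [h.histRate_hist] at h1
      refine mul_le_mul (h1.trans ?_) hω (norm_nonneg _) (by positivity)
      have := hβmax ω
      gcongr
    · simpa using hpos
  have hgm' : Measurable g := by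
    have hX : MeasurableSpace.comap (R.X t) inferInstance ≤ mΩ := (h.measurable_X ht).comap_le
    have hA : MeasurableSpace.comap (R.A t) inferInstance ≤ mΩ := (h.measurable_A ht).comap_le
    exact hgm.mono (sup_le (sup_le (G.le t) hX) hA) le_rfl
  have hε0 := h.integral_mul_ε ht a hgm hgC
  have hε : Integrable (R.ε t a) μ :=
    Integrable.of_bound (h.measurable_ε ht a).aestronglyMeasurable CE (h.abs_ε t ht a)
  have hgε : Integrable (fun ω => g ω * R.ε t a ω) μ :=
    hε.bdd_mul hgm'.aestronglyMeasurable hgC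
  have hθX : Integrable (fun ω => (inner ℝ (R.X t ω) (R.θ t a ω) : ℝ)) μ := by
    refine Integrable.of_bound
      ((h.measurable_X ht).inner (h.measurable_θ ht a)).aestronglyMeasurable (CX * CΘ) ?_
    filter_upwards [h.ae_X ht, h.norm_θ t ht a] with ω h1 h2
    exact (norm_inner_le_norm _ _).trans (mul_le_mul h1 h2 (norm_nonneg _) hCX.le)
  have hgθ : Integrable (fun ω => g ω * inner ℝ (R.X t ω) (R.θ t a ω)) μ :=
    hθX.bdd_mul hgm'.aestronglyMeasurable hgC
  have step2 : ∫ ω, inner ℝ (u (R.hist P t ω)) (R.estimate P t a ω) ∂μ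
      = ∫ ω, g ω * inner ℝ (R.X t ω) (R.θ t a ω) ∂μ := by
    rw [step1]
    have : ∀ ω, (if R.A t ω = a then (inner ℝ (R.X t ω) (R.θ t a ω) + R.ε t a ω)
          * inner ℝ (u (R.hist P t ω)) (Matrix.toEuclideanCLM (𝕜 := ℝ)
            (S.meanMgr a (R.hist P t ω)) (R.X t ω)) else 0)
        = g ω * inner ℝ (R.X t ω) (R.θ t a ω) + g ω * R.ε t a ω := by
      intro ω
      simp only [g]
      split_ifs <;> ring
    simp_rw [this]
    rw [integral_add hgθ hgε, hε0, add_zero]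
  -- integrate out the context and the arm
  let F2 : Hist K d → Ctx d × Fin K → ℝ := fun y w =>
    inner ℝ (u y) (Matrix.toEuclideanCLM (𝕜 := ℝ) (S.meanMgr a y * mgrW a w.1 w.2) (y.2.2 a))
  have hF2 : ∀ ω, g ω * inner ℝ (R.X t ω) (R.θ t a ω) = F2 (R.hist P t ω) (R.X t ω, R.A t ω) := by
    intro ω
    simp only [F2, g]
    rw [toEuclideanCLM_mul_mgrW]
    split_ifs
    · rw [mul_comm]; rfl
    · simp
  have hF2m : StronglyMeasurable (Function.uncurry F2) := by
    have e1 := (S.stronglyMeasurable_meanMgr a).comp_measurable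
      (measurable_fst : Measurable (Prod.fst : Hist K d × (Ctx d × Fin K) → Hist K d))
    have e2 := (stronglyMeasurable_mgrW (d := d) a).comp_measurable
      (measurable_snd : Measurable (Prod.snd : Hist K d × (Ctx d × Fin K) → _))
    have e3 : Measurable fun q : Hist K d × (Ctx d × Fin K) => q.1.2.2 a := by fun_prop
    have e4 := measurable_toEuclideanCLM_apply (e1.mul e2) e3
    have e5 : Measurable fun q : Hist K d × (Ctx d × Fin K) => u q.1 := hu.comp measurable_fst
    exact (e5.inner e4).stronglyMeasurable
  rw [step2]
  simp_rw [hF2]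
  rw [integral_freeze (h.measurable_hist ht) ((h.measurable_X ht).prodMk (h.measurable_A ht))
    (h.map_pair ht) hF2m (by simp_rw [← hF2]; exact hgθ)]
  refine integral_congr_ae (Filter.Eventually.of_forall fun ω => ?_)
  simp only [F2]
  exact IsContraction.integral_linear
    (integrable_mgrW S.CX_pos S.bdd (isPolicy_histPi S (R.hist P t ω)) a)
    ((pairing (u (R.hist P t ω)) ((R.hist P t ω).2.2 a)).comp
      (LinearMap.mulLeft ℝ (S.meanMgr a (R.hist P t ω))))

end Trial.IsAdmissible

section Trace

variable {d : ℕ}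

theorem integral_trace_mul_left {E : Type*} [MeasurableSpace E] {ρ : Measure E}
    {f : E → Matrix (Fin d) (Fin d) ℝ} (hf : Integrable f ρ) (A : Matrix (Fin d) (Fin d) ℝ) :
    ∫ w, (A * f w).trace ∂ρ = (A * ∫ w, f w ∂ρ).trace := by
  have key := IsContraction.integral_linear hf (IsContraction.traceLin A 1 1)
  simp only [IsContraction.traceLin, LinearMap.coe_mk, AddHom.coe_mk, mul_one] at key
  exact key

theorem integral_trace_mul_right {E : Type*} [MeasurableSpace E] {ρ : Measure E}
    {f : E → Matrix (Fin d) (Fin d) ℝ} (hf : Integrable f ρ) (A : Matrix (Fin d) (Fin d) ℝ) :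
    ∫ w, (f w * A).trace ∂ρ = ((∫ w, f w ∂ρ) * A).trace := by
  have key := integral_trace_mul_left hf A
  simp only [Matrix.trace_mul_comm A] at key
  exact key

/-- Some constant suffices here, since the bound only serves integrability. -/
theorem exists_abs_trace_le (d : ℕ) :
    ∃ c : ℝ, 0 ≤ c ∧ ∀ V : Matrix (Fin d) (Fin d) ℝ, |V.trace| ≤ c * ‖V‖ := by
  let L : Matrix (Fin d) (Fin d) ℝ →L[ℝ] ℝ :=
    LinearMap.toContinuousLinearMap (Matrix.traceLinearMap (Fin d) ℝ ℝ)
  exact ⟨‖L‖, L.opNorm_nonneg, fun V => L.le_opNorm V⟩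

end Trace

namespace Trial.IsAdmissible

variable {Ω : Type*} {K d : ℕ} {mΩ : MeasurableSpace Ω} {R : Trial Ω K d}
  {P : Params} {D : Measure (Ctx d)} {G : Filtration ℕ mΩ} {μ : Measure Ω} {CX CΘ CE Cl : ℝ}
  [IsProbabilityMeasure μ] [IsProbabilityMeasure D]

/-- The estimates are unbiased up to `C_Θ / T`, when tested against functions of the history. -/
theorem integral_inner_θ_le (h : R.IsAdmissible P D G μ CX CΘ CE Cl) {t : ℕ} (ht : t < P.T)
    (a : Fin K) {u : Hist K d → Ctx d} (hu : Measurable u) {Cu : ℝ} (huC : ∀ y, ‖u y‖ ≤ Cu) :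
    ∫ ω, inner ℝ (u (R.hist P t ω)) (R.θ t a ω) ∂μ
      ≤ ∫ ω, inner ℝ (u (R.hist P t ω)) (R.estimate P t a ω) ∂μ + Cu * CΘ / P.T := by
  have S := h.setting
  rw [h.integral_inner_estimate ht a hu huC]
  have hCu : 0 ≤ Cu := (norm_nonneg _).trans (huC (0, 0, 0))
  have hT : (0 : ℝ) < P.T := by have := S.two_le_T; positivity
  have hCΘ := h.CΘ_pos
  have hum : Measurable fun ω => u (R.hist P t ω) := hu.comp (h.measurable_hist ht)
  have hi1 : Integrable (fun ω => (inner ℝ (u (R.hist P t ω)) (R.θ t a ω) : ℝ)) μ := by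
    refine Integrable.of_bound (hum.inner (h.measurable_θ ht a)).aestronglyMeasurable (Cu * CΘ) ?_
    filter_upwards [h.norm_θ t ht a] with ω hω
    exact (norm_inner_le_norm _ _).trans (mul_le_mul (huC _) hω (norm_nonneg _) hCu)
  -- the two integrands differ by the truncation bias of the resampling
  have hdiff : ∀ᵐ ω ∂μ, |inner ℝ (u (R.hist P t ω)) (R.θ t a ω)
      - inner ℝ (u (R.hist P t ω)) (Matrix.toEuclideanCLM (𝕜 := ℝ)
          (S.meanMgr a (R.hist P t ω) * armMoment D (histPi P (R.hist P t ω)) a)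
          (R.θ t a ω))| ≤ Cu * CΘ / P.T := by
    filter_upwards [h.norm_θ t ht a] with ω hω
    rw [S.meanMgr_mul_armMoment, map_sub, map_one, ← inner_sub_right,
      sub_apply, one_apply_eq_self, sub_sub_cancel]
    refine (abs_real_inner_le_norm _ _).trans ?_
    calc _ ≤ Cu * (1 / P.T * CΘ) := by
          refine mul_le_mul (huC _) ((norm_toEuclideanCLM_apply_le _ _).trans ?_) (norm_nonneg _) hCu
          exact mul_le_mul (norm_bias_le S _ a) hω (norm_nonneg _) (by positivity)
      _ = Cu * CΘ / P.T := by ring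
  have hm2 : Measurable fun ω => (inner ℝ (u (R.hist P t ω)) (Matrix.toEuclideanCLM (𝕜 := ℝ)
          (S.meanMgr a (R.hist P t ω) * armMoment D (histPi P (R.hist P t ω)) a)
          (R.θ t a ω)) : ℝ) := by
    have e1 := (S.stronglyMeasurable_meanMgr a).comp_measurable (h.measurable_hist ht)
    have e2 := (S.stronglyMeasurable_armMoment a).comp_measurable (h.measurable_hist ht)
    have e3 := measurable_toEuclideanCLM_apply (e1.mul e2) (h.measurable_θ ht a)
    exact hum.inner e3
  have hi2 : Integrable (fun ω => (inner ℝ (u (R.hist P t ω)) (Matrix.toEuclideanCLM (𝕜 := ℝ)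
          (S.meanMgr a (R.hist P t ω) * armMoment D (histPi P (R.hist P t ω)) a)
          (R.θ t a ω)) : ℝ)) μ := by
    refine Integrable.of_bound hm2.aestronglyMeasurable (Cu * CΘ + Cu * CΘ / P.T) ?_
    filter_upwards [h.norm_θ t ht a, hdiff] with ω h1 h2
    have h3 : |(inner ℝ (u (R.hist P t ω)) (R.θ t a ω) : ℝ)| ≤ Cu * CΘ :=
      (abs_real_inner_le_norm _ _).trans (mul_le_mul (huC _) h1 (norm_nonneg _) hCu)
    rw [Real.norm_eq_abs, abs_le]
    rw [abs_le] at h2 h3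
    constructor <;> linarith
  rw [← sub_le_iff_le_add', ← integral_sub hi1 hi2]
  calc _ ≤ ∫ _ω, Cu * CΘ / P.T ∂μ := by
        refine integral_mono_ae (hi1.sub hi2) (integrable_const _) ?_
        filter_upwards [hdiff] with ω hω using (le_abs_self _).trans hω
    _ = Cu * CΘ / P.T := by simp

/-- The second moment of the estimate, weighted by `1 / β_t`. Integrating out the simulated pairs and
then the context and the arm leaves `E[tr (Σ_a Σ̂† Σ_a Σ̂†ᵀ)]`. -/
theorem integral_trace_le (h : R.IsAdmissible P D G μ CX CΘ CE Cl) {t : ℕ} (ht : t < P.T)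
    (a : Fin K) :
    Integrable (fun ω => 1 / betaAt P (R.data ω) t * (mgrW a (R.X t ω) (R.A t ω) *
        ((histMgr P a (R.hist P t ω) (R.sims t a ω)).transpose
          * armMoment D (histPi P (R.hist P t ω)) a
          * histMgr P a (R.hist P t ω) (R.sims t a ω))).trace) μ ∧
    ∫ ω, 1 / betaAt P (R.data ω) t * (mgrW a (R.X t ω) (R.A t ω) *
        ((histMgr P a (R.hist P t ω) (R.sims t a ω)).transpose
          * armMoment D (histPi P (R.hist P t ω)) a
          * histMgr P a (R.hist P t ω) (R.sims t a ω))).trace ∂μ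
      ≤ 2 * d * ∫ ω, 1 / betaAt P (R.data ω) t ∂μ := by
  have S := h.setting
  have hδ := S.delta_pos
  have hB := S.beta1_pos
  have hβinv : Integrable (fun ω => 1 / betaAt P (R.data ω) t) μ := by
    refine Integrable.of_bound ((h.measurable_beta ht.le).const_div 1).aestronglyMeasurable
      (1 / P.beta1) (Filter.Eventually.of_forall fun ω => ?_)
    rw [Real.norm_of_nonneg (one_div_nonneg.2 (h.beta_pos t ω).le)]
    exact one_div_le_one_div_of_le hB (beta1_le_betaAt hB _ t)
  obtain ⟨c, hc, htr⟩ := exists_abs_trace_le d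
  let F : Hist K d × (Ctx d × Fin K) × ℝ → (ℕ → Ctx d × Fin K) → ℝ := fun i z =>
    1 / histRate P i.1 * (mgrW a i.2.1.1 i.2.1.2 *
        ((histMgr P a i.1 z).transpose * armMoment D (histPi P i.1) a * histMgr P a i.1 z)).trace
  have hFm : StronglyMeasurable (Function.uncurry F) := by
    have e4 : Measurable fun q : (Hist K d × (Ctx d × Fin K) × ℝ) × (ℕ → Ctx d × Fin K) =>
      (q.1.1, q.2) := by fun_prop
    have e5 := (S.stronglyMeasurable_sq a).comp_measurable e4
    have e6 : Measurable fun q : (Hist K d × (Ctx d × Fin K) × ℝ) × (ℕ → Ctx d × Fin K) =>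
      q.1.2.1 := by fun_prop
    have e7 := (stronglyMeasurable_mgrW (d := d) a).comp_measurable e6
    have e8 : Measurable fun q : (Hist K d × (Ctx d × Fin K) × ℝ) × (ℕ → Ctx d × Fin K) =>
      1 / histRate P q.1.1 :=
      ((measurable_histRate P).comp (measurable_fst.comp measurable_fst)).const_div 1
    have key := e8.stronglyMeasurable.mul (continuous_id.matrix_trace.comp_stronglyMeasurable (e7.mul e5))
    exact key
  have hF : ∀ ω, 1 / betaAt P (R.data ω) t * (mgrW a (R.X t ω) (R.A t ω) *
        ((histMgr P a (R.hist P t ω) (R.sims t a ω)).transpose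
          * armMoment D (histPi P (R.hist P t ω)) a
          * histMgr P a (R.hist P t ω) (R.sims t a ω))).trace
      = F (R.info P t a ω) (R.sims t a ω) := by
    intro ω
    simp only [F, Trial.info]
    rw [h.histRate_hist]
  let Cβ : ℝ := P.delta * (4 * ((t + 1) * P.beta1))
  have hCβ : 0 ≤ Cβ := by positivity
  have hrate : ∀ ω, P.delta * (4 * histRate P (R.hist P t ω)) ≤ Cβ := by
    intro ω
    rw [h.histRate_hist]
    have := h.beta_le t ω
    simp only [Cβ]; gcongr
  have hrate0 : ∀ ω, 0 ≤ P.delta * (4 * histRate P (R.hist P t ω)) := by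
    intro ω
    have := S.histRate_pos (R.hist P t ω)
    positivity
  have hbound : ∀ ω V, ‖R.X t ω‖ ≤ CX →
      ‖V‖ ≤ P.delta * (4 * histRate P (R.hist P t ω)) * CX ^ 2
        * (P.delta * (4 * histRate P (R.hist P t ω))) →
      ‖1 / histRate P (R.hist P t ω) * (mgrW a (R.X t ω) (R.A t ω) * V).trace‖
        ≤ 1 / P.beta1 * (c * (CX ^ 2 * (Cβ * CX ^ 2 * Cβ))) := by
    intro ω V hX hV
    have h1 : 1 / histRate P (R.hist P t ω) ≤ 1 / P.beta1 :=
      one_div_le_one_div_of_le hB (beta1_le_histRate P _)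
    have h0 : 0 ≤ 1 / histRate P (R.hist P t ω) := one_div_nonneg.2 (S.histRate_pos _).le
    rw [norm_mul, Real.norm_of_nonneg h0]
    refine mul_le_mul h1 ((htr _).trans ?_) (norm_nonneg _) (h0.trans h1)
    gcongr
    refine (norm_mul_le _ _).trans ?_
    have h2 := norm_mgrW_le a (R.A t ω) S.CX_pos hX
    have h3 : P.delta * (4 * histRate P (R.hist P t ω)) * CX ^ 2
        * (P.delta * (4 * histRate P (R.hist P t ω))) ≤ Cβ * CX ^ 2 * Cβ := by
      have := hrate ω
      have := hrate0 ω
      gcongr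
    exact mul_le_mul h2 (hV.trans h3) (norm_nonneg _) (sq_nonneg _)
  have hFi : Integrable (fun ω => F (R.info P t a ω) (R.sims t a ω)) μ := by
    have hm : StronglyMeasurable fun ω => F (R.info P t a ω) (R.sims t a ω) :=
      hFm.comp_measurable ((h.measurable_info ht a).prodMk (h.measurable_sims ht a))
    refine Integrable.of_bound hm.aestronglyMeasurable
      (1 / P.beta1 * (c * (CX ^ 2 * (Cβ * CX ^ 2 * Cβ)))) ?_
    filter_upwards [h.ae_X ht, h.ae_sims ht a] with ω hX hz
    exact hbound ω _ hX (S.norm_sq_le a (R.hist P t ω) hz)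
  simp_rw [hF]
  refine ⟨hFi, ?_⟩
  -- integrate out the simulated pairs
  rw [integral_freeze (h.measurable_info ht a) (h.measurable_sims ht a) (h.map_info ht a) hFm hFi]
  let F2 : Hist K d → Ctx d × Fin K → ℝ := fun y w =>
    1 / histRate P y * (mgrW a w.1 w.2 * S.meanSq a y).trace
  have hmean : ∀ ω, ∫ z, F (R.info P t a ω) z ∂(S.infoK (R.info P t a ω))
      = F2 (R.hist P t ω) (R.X t ω, R.A t ω) := by
    intro ω
    rw [S.infoK_apply]
    simp only [F, F2, Trial.info]
    rw [integral_const_mul]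
    congr 1
    exact integral_trace_mul_left (S.integrable_sq a (R.hist P t ω)) _
  have hF2m : StronglyMeasurable (Function.uncurry F2) := by
    have e1 := (S.stronglyMeasurable_meanSq a).comp_measurable
      (measurable_fst : Measurable (Prod.fst : Hist K d × (Ctx d × Fin K) → Hist K d))
    have e2 := (stronglyMeasurable_mgrW (d := d) a).comp_measurable
      (measurable_snd : Measurable (Prod.snd : Hist K d × (Ctx d × Fin K) → _))
    have e3 : Measurable fun q : Hist K d × (Ctx d × Fin K) => 1 / histRate P q.1 :=
      ((measurable_histRate P).comp measurable_fst).const_div 1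
    have key := e3.stronglyMeasurable.mul (continuous_id.matrix_trace.comp_stronglyMeasurable (e2.mul e1))
    exact key
  have hF2i : Integrable (fun ω => F2 (R.hist P t ω) (R.X t ω, R.A t ω)) μ := by
    have hm : StronglyMeasurable fun ω => F2 (R.hist P t ω) (R.X t ω, R.A t ω) :=
      hF2m.comp_measurable
        ((h.measurable_hist ht).prodMk ((h.measurable_X ht).prodMk (h.measurable_A ht)))
    refine Integrable.of_bound hm.aestronglyMeasurable
      (1 / P.beta1 * (c * (CX ^ 2 * (Cβ * CX ^ 2 * Cβ)))) ?_
    filter_upwards [h.ae_X ht] with ω hX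
    exact hbound ω _ hX (S.norm_meanSq_le a (R.hist P t ω))
  simp_rw [hmean]
  -- integrate out the context and the arm
  rw [integral_freeze (h.measurable_hist ht) ((h.measurable_X ht).prodMk (h.measurable_A ht))
    (h.map_pair ht) hF2m hF2i]
  have hmean2 : ∀ ω, ∫ w, F2 (R.hist P t ω) w ∂(S.pairK (R.hist P t ω))
      = 1 / betaAt P (R.data ω) t
        * (armMoment D (histPi P (R.hist P t ω)) a * S.meanSq a (R.hist P t ω)).trace := by
    intro ω
    simp only [F2]
    rw [integral_const_mul, h.histRate_hist]
    congr 1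
    exact integral_trace_mul_right
      (integrable_mgrW S.CX_pos S.bdd (isPolicy_histPi S (R.hist P t ω)) a) _
  simp_rw [hmean2]
  have hle : ∀ ω, 1 / betaAt P (R.data ω) t
        * (armMoment D (histPi P (R.hist P t ω)) a * S.meanSq a (R.hist P t ω)).trace
      ≤ 2 * d * (1 / betaAt P (R.data ω) t) := by
    intro ω
    rw [mul_comm (2 * (d : ℝ))]
    exact mul_le_mul_of_nonneg_left (S.trace_armMoment_mul_meanSq_le a _)
      (one_div_nonneg.2 (h.beta_pos t ω).le)
  rw [← integral_const_mul]
  refine integral_mono ?_ (hβinv.const_mul _) hle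
  have hm : StronglyMeasurable fun ω => 1 / betaAt P (R.data ω) t
        * (armMoment D (histPi P (R.hist P t ω)) a * S.meanSq a (R.hist P t ω)).trace := by
    have e1 := (S.stronglyMeasurable_armMoment a).comp_measurable (h.measurable_hist ht)
    have e2 := (S.stronglyMeasurable_meanSq a).comp_measurable (h.measurable_hist ht)
    have key := ((h.measurable_beta ht.le).const_div 1).stronglyMeasurable.mul
      (continuous_id.matrix_trace.comp_stronglyMeasurable (e1.mul e2))
    exact key
  refine Integrable.of_bound hm.aestronglyMeasurable
    (1 / P.beta1 * (c * (CX ^ 2 * (Cβ * CX ^ 2 * Cβ)))) (Filter.Eventually.of_forall fun ω => ?_)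
  have h0 : 0 ≤ 1 / betaAt P (R.data ω) t := one_div_nonneg.2 (h.beta_pos t ω).le
  have h1 : 1 / betaAt P (R.data ω) t ≤ 1 / P.beta1 :=
    one_div_le_one_div_of_le hB (beta1_le_betaAt hB _ t)
  rw [norm_mul, Real.norm_of_nonneg h0]
  refine mul_le_mul h1 ((htr _).trans ?_) (norm_nonneg _) (h0.trans h1)
  refine mul_le_mul_of_nonneg_left ((norm_mul_le _ _).trans ?_) hc
  refine mul_le_mul (S.norm_armMoment_le a _) ((S.norm_meanSq_le a _).trans ?_) (norm_nonneg _)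
    (sq_nonneg _)
  have := hrate ω
  have := hrate0 ω
  gcongr

end Trial.IsAdmissible

/-! ### Averages over a fresh context -/

section ContextMean

variable {d : ℕ} {D : Measure (Ctx d)} {CX c : ℝ}

/-- The mean `E[f(X) X]` of a context weighted by `f`. -/
noncomputable def contextMean (D : Measure (Ctx d)) (f : Ctx d → ℝ) : Ctx d := ∫ x, f x • x ∂D

theorem measurable_contextMean {S : Type*} [MeasurableSpace S] [SFinite D] {f : S → Ctx d → ℝ}
    (hf : Measurable (Function.uncurry f)) : Measurable fun s => contextMean D (f s) := by
  have h : StronglyMeasurable fun q : S × Ctx d => f q.1 q.2 • q.2 :=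
    (hf.smul measurable_snd).stronglyMeasurable
  have key := (h.integral_prod_right' (ν := D)).measurable
  exact key

variable [IsProbabilityMeasure D]

theorem integrable_smul_context (hbd : ∀ᵐ x ∂D, ‖x‖ ≤ CX) {f : Ctx d → ℝ} (hf : Measurable f)
    (hc : ∀ x, |f x| ≤ c) : Integrable (fun x => f x • x) D := by
  refine Integrable.of_bound (hf.smul measurable_id).aestronglyMeasurable (c * CX) ?_
  filter_upwards [hbd] with x hx
  rw [norm_smul]
  exact mul_le_mul (hc x) hx (norm_nonneg _) ((abs_nonneg _).trans (hc x))

theorem inner_contextMean (hbd : ∀ᵐ x ∂D, ‖x‖ ≤ CX) {f : Ctx d → ℝ} (hf : Measurable f)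
    (hc : ∀ x, |f x| ≤ c) (v : Ctx d) :
    inner ℝ (contextMean D f) v = ∫ x, f x * inner ℝ x v ∂D := by
  have h := integral_inner (𝕜 := ℝ) (integrable_smul_context hbd hf hc) v
  rw [real_inner_comm, contextMean, ← h]
  refine integral_congr_ae (Filter.Eventually.of_forall fun x => ?_)
  simp only [inner_smul_right]
  rw [real_inner_comm]

theorem integrable_mul_inner (hbd : ∀ᵐ x ∂D, ‖x‖ ≤ CX) {f : Ctx d → ℝ} (hf : Measurable f)
    (hc : ∀ x, |f x| ≤ c) (v : Ctx d) : Integrable (fun x => f x * inner ℝ x v) D := by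
  have h := (integrable_smul_context hbd hf hc).inner_const (𝕜 := ℝ) v
  simpa only [real_inner_smul_left] using h

theorem norm_contextMean_le (hbd : ∀ᵐ x ∂D, ‖x‖ ≤ CX) {f : Ctx d → ℝ} (hc : ∀ x, |f x| ≤ c) :
    ‖contextMean D f‖ ≤ c * CX := by
  have h : ∀ᵐ x ∂D, ‖f x • x‖ ≤ c * CX := by
    filter_upwards [hbd] with x hx
    rw [norm_smul]
    exact mul_le_mul (hc x) hx (norm_nonneg _) ((abs_nonneg _).trans (hc x))
  have h' := norm_integral_le_of_norm_le_const h
  rw [probReal_univ, mul_one] at h'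
  exact h'

end ContextMean

section Regret

variable {K d : ℕ}

/-- The indicator of the event that `ρ` picks the arm `a`. -/
noncomputable def picks (ρ : Ctx d → Fin K) (a : Fin K) (x : Ctx d) : ℝ := if ρ x = a then 1 else 0

theorem measurable_picks {ρ : Ctx d → Fin K} (hρ : Measurable ρ) (a : Fin K) :
    Measurable (picks ρ a) :=
  Measurable.ite (hρ (measurableSet_singleton a)) measurable_const measurable_const

theorem abs_picks_le (ρ : Ctx d → Fin K) (a : Fin K) (x : Ctx d) : |picks ρ a x| ≤ 1 := by
  unfold picks; split_ifs <;> simp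

theorem sum_picks_mul (ρ : Ctx d → Fin K) (x : Ctx d) (f : Fin K → ℝ) :
    ∑ a, picks ρ a x * f a = f (ρ x) := by
  simp [picks]

/-- `E[(q(a ∣ X) - 1[ρ(X) = a]) X]`: its inner product with a parameter of arm `a` is the part of
the regret of `q` against `ρ` that is due to this arm. -/
noncomputable def regretDir (D : Measure (Ctx d)) (P : Params) (ρ : Ctx d → Fin K) (a : Fin K)
    (y : Hist K d) : Ctx d := contextMean D fun x => histQ P y x a - picks ρ a x

variable {P : Params} {D : Measure (Ctx d)} {CX Cl : ℝ} {ρ : Ctx d → Fin K}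

theorem measurable_histQ_right (P : Params) (y : Hist K d) (a : Fin K) :
    Measurable fun x => histQ P y x a := by
  have h : Measurable fun x : Ctx d => (y, x) := measurable_prodMk_left
  have h' := (measurable_histQ P a).comp h
  simp only [Function.comp_def] at h'
  exact h'

theorem abs_histQ_sub_picks_le (S : Setting (K := K) D P CX Cl) (ρ : Ctx d → Fin K) (a : Fin K)
    (y : Hist K d) (x : Ctx d) : |histQ P y x a - picks ρ a x| ≤ 1 := by
  have h1 := (histQ_mem S y x).1 a
  have h2 := histQ_le_one S y x a
  rw [abs_le]
  unfold picks
  split_ifs <;> constructor <;> linarith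

/-- The mean entropy of `q(· ∣ X)` for a fresh context. -/
noncomputable def meanEntropy (D : Measure (Ctx d)) (P : Params) (y : Hist K d) : ℝ :=
  ∫ x, entropy (histQ P y x) ∂D

theorem meanEntropy_nonneg (S : Setting (K := K) D P CX Cl) (y : Hist K d) :
    0 ≤ meanEntropy D P y := integral_nonneg fun x => entropy_nonneg (histQ_mem S y x)

variable [IsProbabilityMeasure D]

theorem measurable_regretDir (hρ : Measurable ρ) (a : Fin K) :
    Measurable (regretDir D P ρ a) := by
  refine measurable_contextMean (f := fun y x => histQ P y x a - picks ρ a x) ?_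
  exact (measurable_histQ P a).sub ((measurable_picks hρ a).comp measurable_snd)

theorem norm_regretDir_le (S : Setting (K := K) D P CX Cl) (a : Fin K) (y : Hist K d) :
    ‖regretDir D P ρ a y‖ ≤ CX := by
  have := norm_contextMean_le S.bdd (abs_histQ_sub_picks_le S ρ a y)
  rwa [one_mul] at this

theorem measurable_entropy_histQ (P : Params) :
    Measurable fun q : Hist K d × Ctx d => entropy (histQ P q.1 q.2) :=
  measurable_entropy.comp (measurable_pi_iff.2 fun a => measurable_histQ P a)

theorem integrable_entropy_histQ (S : Setting (K := K) D P CX Cl) (y : Hist K d) :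
    Integrable (fun x => entropy (histQ P y x)) D := by
  have := S.neZero
  have hm : Measurable fun x => entropy (histQ P y x) :=
    measurable_entropy.comp (measurable_pi_iff.2 fun a => measurable_histQ_right P y a)
  refine Integrable.of_bound hm.aestronglyMeasurable (Real.log K)
    (Filter.Eventually.of_forall fun x => ?_)
  rw [Real.norm_of_nonneg (entropy_nonneg (histQ_mem S y x))]
  exact entropy_le_log (histQ_mem S y x)

theorem measurable_meanEntropy : Measurable (meanEntropy D P : Hist K d → ℝ) := by
  have key := ((measurable_entropy_histQ (K := K) (d := d) P).stronglyMeasurable.integral_prod_right'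
    (ν := D)).measurable
  exact key

theorem meanEntropy_le_log (S : Setting (K := K) D P CX Cl) (y : Hist K d) :
    meanEntropy D P y ≤ Real.log K := by
  have := S.neZero
  calc meanEntropy D P y ≤ ∫ _x, Real.log K ∂D :=
        integral_mono (integrable_entropy_histQ S y) (integrable_const _)
          fun x => entropy_le_log (histQ_mem S y x)
    _ = Real.log K := by simp

end Regret

namespace Trial.IsAdmissible

variable {Ω : Type*} {K d : ℕ} {mΩ : MeasurableSpace Ω} {R : Trial Ω K d}
  {P : Params} {D : Measure (Ctx d)} {G : Filtration ℕ mΩ} {μ : Measure Ω} {CX CΘ CE Cl : ℝ}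

/-- The unexplored policy consists of the exponential weights for the estimated losses. -/
theorem histQ_eq_softmax (h : R.IsAdmissible P D G μ CX CΘ CE Cl) (t : ℕ) (ω : Ω) (x : Ctx d) :
    histQ P (R.hist P t ω) x = softmax (betaAt P (R.data ω) t)
      (∑ s ∈ Finset.range t, fun a => inner ℝ x (R.estimate P s a ω)) := by
  rw [histQ, h.histRate_hist]
  congr 1
  ext a
  change inner ℝ x ((stateAt P (R.data ω) t).thetaSum a) = _
  rw [thetaSum_eq, inner_sum, Finset.sum_apply]
  rfl

variable [IsProbabilityMeasure D]

/-- The second-order term of the exponential weights, averaged over a fresh context, is controlled by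
a trace, since `q ≤ 2 K π`. -/
theorem integral_histQ_mul_sq_le (h : R.IsAdmissible P D G μ CX CΘ CE Cl) {t : ℕ} (ht : t < P.T)
    (a : Fin K) : ∀ᵐ ω ∂μ,
    ∫ x, histQ P (R.hist P t ω) x a * inner ℝ x (R.estimate P t a ω) ^ 2 ∂D
      ≤ 2 * K * Cl ^ 2 * (mgrW a (R.X t ω) (R.A t ω) *
        ((histMgr P a (R.hist P t ω) (R.sims t a ω)).transpose
          * armMoment D (histPi P (R.hist P t ω)) a
          * histMgr P a (R.hist P t ω) (R.sims t a ω))).trace := by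
  have S := h.setting
  filter_upwards [h.abs_loss t ht a] with ω hℓ
  set y := R.hist P t ω
  set v := R.estimate P t a ω with hv
  have hπ := isPolicy_histPi S y
  have e : ∀ x : Ctx d, ((v.ofLp ⬝ᵥ x.ofLp) * (x.ofLp ⬝ᵥ v.ofLp)) = inner ℝ x v ^ 2 := by
    intro x
    rw [inner_eq_dotProduct, dotProduct_comm v.ofLp x.ofLp]; ring
  have hi1 : Integrable (fun x => histQ P y x a * inner ℝ x v ^ 2) D := by
    have := integrable_mul_dotProduct_mul S.CX_pos S.bdd (measurable_histQ_right P y a)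
      (fun x => by rw [abs_of_nonneg ((histQ_mem S y x).1 a)]; exact histQ_le_one S y x a) v.ofLp v.ofLp
    simpa only [e] using this
  have hi2 : Integrable (fun x => histPi P y x a * inner ℝ x v ^ 2) D := by
    have := integrable_mul_dotProduct_mul S.CX_pos S.bdd (measurable_histPi_right P y a)
      (fun x => by rw [abs_of_nonneg ((hπ.mem x).1 a)]; exact hπ.le_one x a) v.ofLp v.ofLp
    simpa only [e] using this
  have h1 : ∫ x, histQ P y x a * inner ℝ x v ^ 2 ∂D
      ≤ 2 * K * (v.ofLp ⬝ᵥ (armMoment D (histPi P y) a).mulVec v.ofLp) := by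
    rw [dotProduct_armMoment S.CX_pos S.bdd hπ]
    simp only [e]
    rw [← integral_const_mul]
    refine integral_mono hi1 (hi2.const_mul _) fun x => ?_
    simp only
    rw [← mul_assoc]
    exact mul_le_mul_of_nonneg_right (histQ_le_histPi S y x a) (sq_nonneg _)
  refine h1.trans ?_
  rw [trace_mgrW_mul, hv, h.estimate_eq']
  have hK : (0 : ℝ) ≤ 2 * K := by linarith [S.K_pos]
  rw [mul_assoc (2 * (K : ℝ))]
  refine mul_le_mul_of_nonneg_left ?_ hK
  split_ifs
  · set w := (histMgr P a y (R.sims t a ω)).mulVec (R.X t ω).ofLp with hw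
    have hp := (posSemidef_armMoment S.CX_pos S.bdd hπ a).dotProduct_mulVec_nonneg w
    rw [star_trivial] at hp
    have e2 : (R.loss t a ω • Matrix.toEuclideanCLM (𝕜 := ℝ)
        (histMgr P a y (R.sims t a ω)) (R.X t ω)).ofLp = R.loss t a ω • w := by
      rw [WithLp.ofLp_smul, Matrix.ofLp_toEuclideanCLM]
    rw [e2, Matrix.mulVec_smul, smul_dotProduct, dotProduct_smul, smul_eq_mul, smul_eq_mul,
      ← mul_assoc, ← sq]
    refine mul_le_mul_of_nonneg_right ?_ hp
    rw [← sq_abs]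
    gcongr
  · simp

variable [IsProbabilityMeasure μ]

/-- The regret bound of follow-the-regularized-leader, averaged over a fresh context. -/
theorem sum_regretDir_le (h : R.IsAdmissible P D G μ CX CΘ CE Cl) {ρ : Ctx d → Fin K}
    (hρ : Measurable ρ) : ∀ᵐ ω ∂μ,
    ∑ t ∈ Finset.range P.T, ∑ a, inner ℝ (regretDir D P ρ a (R.hist P t ω)) (R.estimate P t a ω)
      ≤ P.beta1 * Real.log K
        + ∑ t ∈ Finset.range (P.T - 1), (betaAt P (R.data ω) (t + 1) - betaAt P (R.data ω) t)
            * meanEntropy D P (R.hist P (t + 1) ω)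
        + Real.exp (2 * CX) * (2 * K * Cl ^ 2) * ∑ t ∈ Finset.range P.T, ∑ a,
            1 / betaAt P (R.data ω) t * (mgrW a (R.X t ω) (R.A t ω) *
            ((histMgr P a (R.hist P t ω) (R.sims t a ω)).transpose
              * armMoment D (histPi P (R.hist P t ω)) a
              * histMgr P a (R.hist P t ω) (R.sims t a ω))).trace := by
  have S := h.setting
  have := S.neZero
  have hT := S.two_le_T
  have hest : ∀ᵐ ω ∂μ, ∀ t < P.T, ∀ a, ‖R.estimate P t a ω‖ ≤ 2 * betaAt P (R.data ω) t := by
    refine ae_all_iff.2 fun t => ?_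
    by_cases ht : t < P.T
    · filter_upwards [ae_all_iff.2 fun a => h.ae_norm_estimate ht a] with ω hω _ using hω
    · exact Filter.Eventually.of_forall fun ω h => absurd h ht
  have hvar : ∀ᵐ ω ∂μ, ∀ t < P.T, ∀ a,
      ∫ x, histQ P (R.hist P t ω) x a * inner ℝ x (R.estimate P t a ω) ^ 2 ∂D
      ≤ 2 * K * Cl ^ 2 * (mgrW a (R.X t ω) (R.A t ω) *
        ((histMgr P a (R.hist P t ω) (R.sims t a ω)).transpose
          * armMoment D (histPi P (R.hist P t ω)) a
          * histMgr P a (R.hist P t ω) (R.sims t a ω))).trace := by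
    refine ae_all_iff.2 fun t => ?_
    by_cases ht : t < P.T
    · filter_upwards [ae_all_iff.2 fun a => h.integral_histQ_mul_sq_le ht a] with ω hω _ using hω
    · exact Filter.Eventually.of_forall fun ω h => absurd h ht
  filter_upwards [hest, hvar] with ω hω hv
  have hβ := fun t => h.beta_pos t ω
  -- the bound for a fixed context
  have hx : ∀ᵐ x ∂D, ∑ t ∈ Finset.range P.T, ∑ a,
      (histQ P (R.hist P t ω) x a - picks ρ a x) * inner ℝ x (R.estimate P t a ω)
      ≤ P.beta1 * Real.log K
        + ∑ t ∈ Finset.range (P.T - 1), (betaAt P (R.data ω) (t + 1) - betaAt P (R.data ω) t)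
            * entropy (histQ P (R.hist P (t + 1) ω) x)
        + Real.exp (2 * CX) * ∑ t ∈ Finset.range P.T, 1 / betaAt P (R.data ω) t * ∑ a,
            histQ P (R.hist P t ω) x a * inner ℝ x (R.estimate P t a ω) ^ 2 := by
    filter_upwards [S.bdd] with x hx
    have key := ftrl_regret_le (b := 2 * CX) (betaAt P (R.data ω))
      (fun t a => inner ℝ x (R.estimate P t a ω)) hβ (P.T - 1) (fun t ht a => by
        refine (abs_real_inner_le_norm _ _).trans ?_
        calc ‖x‖ * ‖R.estimate P t a ω‖ ≤ CX * (2 * betaAt P (R.data ω) t) :=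
              mul_le_mul hx (hω t (by omega) a) (norm_nonneg _) S.CX_pos.le
          _ = _ := by ring) (ρ x)
    rw [Nat.sub_add_cancel (by omega)] at key
    simp only [← h.histQ_eq_softmax] at key
    have e : ∀ t, ∑ a, (histQ P (R.hist P t ω) x a - picks ρ a x) * inner ℝ x (R.estimate P t a ω)
        = ∑ a, histQ P (R.hist P t ω) x a * inner ℝ x (R.estimate P t a ω)
          - inner ℝ x (R.estimate P t (ρ x) ω) := by
      intro t
      simp only [sub_mul, Finset.sum_sub_distrib]
      rw [sum_picks_mul ρ x fun a => inner ℝ x (R.estimate P t a ω)]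
    simp only [e]
    exact key
  have hiL : ∀ t a, Integrable (fun x => (histQ P (R.hist P t ω) x a - picks ρ a x)
      * inner ℝ x (R.estimate P t a ω)) D := fun t a =>
    integrable_mul_inner S.bdd ((measurable_histQ_right P _ a).sub (measurable_picks hρ a))
      (abs_histQ_sub_picks_le S ρ a _) _
  have hiV : ∀ t a, Integrable (fun x => histQ P (R.hist P t ω) x a
      * inner ℝ x (R.estimate P t a ω) ^ 2) D := by
    intro t a
    have e : ∀ x : Ctx d, (((R.estimate P t a ω).ofLp ⬝ᵥ x.ofLp)
        * (x.ofLp ⬝ᵥ (R.estimate P t a ω).ofLp)) = inner ℝ x (R.estimate P t a ω) ^ 2 := by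
      intro x
      rw [inner_eq_dotProduct, dotProduct_comm (R.estimate P t a ω).ofLp x.ofLp]; ring
    have := integrable_mul_dotProduct_mul S.CX_pos S.bdd (measurable_histQ_right P (R.hist P t ω) a)
      (fun x => by rw [abs_of_nonneg ((histQ_mem S _ x).1 a)]; exact histQ_le_one S _ x a)
      (R.estimate P t a ω).ofLp (R.estimate P t a ω).ofLp
    simpa only [e] using this
  have hiE := fun t => integrable_entropy_histQ S (R.hist P t ω)
  have hR1 : Integrable (fun x => ∑ t ∈ Finset.range (P.T - 1),
      (betaAt P (R.data ω) (t + 1) - betaAt P (R.data ω) t)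
            * entropy (histQ P (R.hist P (t + 1) ω) x)) D :=
    integrable_finsetSum _ fun t _ => (hiE (t + 1)).const_mul _
  have hR2 : Integrable (fun x => ∑ t ∈ Finset.range P.T, 1 / betaAt P (R.data ω) t * ∑ a,
            histQ P (R.hist P t ω) x a * inner ℝ x (R.estimate P t a ω) ^ 2) D :=
    integrable_finsetSum _ fun t _ => (integrable_finsetSum _ fun a _ => hiV t a).const_mul _
  have hc : Integrable (fun _ : Ctx d => P.beta1 * Real.log K) D := integrable_const _
  have hcR : Integrable (fun x => P.beta1 * Real.log K + ∑ t ∈ Finset.range (P.T - 1),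
      (betaAt P (R.data ω) (t + 1) - betaAt P (R.data ω) t)
            * entropy (histQ P (R.hist P (t + 1) ω) x)) D := hc.add hR1
  have hint := integral_mono_ae (integrable_finsetSum _ fun t _ =>
    integrable_finsetSum _ fun a _ => hiL t a)
    (hcR.add (hR2.const_mul _)) hx
  simp only [Pi.add_apply] at hint
  rw [integral_add hcR (hR2.const_mul _), integral_add hc hR1,
    integral_finsetSum _ fun t _ => integrable_finsetSum _ fun a _ => hiL t a,
    integral_const_mul (Real.exp (2 * CX)), integral_finsetSum _ fun t _ => (hiE (t + 1)).const_mul _,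
    integral_finsetSum _ fun t _ => (integrable_finsetSum _ fun a _ => hiV t a).const_mul _] at hint
  simp only [integral_const_mul, integral_const, probReal_univ, one_smul] at hint
  have eL : ∀ t, ∑ a, inner ℝ (regretDir D P ρ a (R.hist P t ω)) (R.estimate P t a ω)
      = ∫ x, ∑ a, (histQ P (R.hist P t ω) x a - picks ρ a x)
          * inner ℝ x (R.estimate P t a ω) ∂D := by
    intro t
    rw [integral_finsetSum _ fun a _ => hiL t a]
    refine Finset.sum_congr rfl fun a _ => ?_
    exact inner_contextMean S.bdd ((measurable_histQ_right P _ a).sub (measurable_picks hρ a))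
      (abs_histQ_sub_picks_le S ρ a _) _
  simp only [eL]
  refine hint.trans ?_
  refine add_le_add le_rfl ?_
  rw [mul_assoc]
  refine mul_le_mul_of_nonneg_left ?_ (Real.exp_pos _).le
  rw [Finset.mul_sum]
  refine Finset.sum_le_sum fun t ht => ?_
  rw [integral_finsetSum _ fun a _ => hiV t a, Finset.mul_sum, Finset.mul_sum]
  refine Finset.sum_le_sum fun a _ => ?_
  have h1 := mul_le_mul_of_nonneg_left (hv t (Finset.mem_range.1 ht) a)
    (one_div_nonneg.2 (hβ t).le)
  linarith

end Trial.IsAdmissible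

/-! ### The expected regret of the unexplored policy -/

section OffMass

variable {K d : ℕ} {P : Params} {D : Measure (Ctx d)} {CX Cl : ℝ} {ρ : Ctx d → Fin K}

/-- The mean probability that the policy deviates from `ρ` on a fresh context. -/
noncomputable def offMass (D : Measure (Ctx d)) (P : Params) (ρ : Ctx d → Fin K) (y : Hist K d) :
    ℝ := ∫ x, (1 - histPi P y x (ρ x)) ∂D

theorem measurable_histPi_classifier (hρ : Measurable ρ) (P : Params) :
    Measurable fun q : Hist K d × Ctx d => 1 - histPi P q.1 q.2 (ρ q.2) := by
  have e : ∀ q : Hist K d × Ctx d, histPi P q.1 q.2 (ρ q.2)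
      = ∑ a, picks ρ a q.2 * histPi P q.1 q.2 a := fun q =>
    (sum_picks_mul ρ q.2 fun a => histPi P q.1 q.2 a).symm
  simp only [e]
  exact measurable_const.sub (Finset.measurable_sum _ fun a _ =>
    ((measurable_picks hρ a).comp measurable_snd).mul (measurable_histPi P a))

theorem measurable_offMass [SFinite D] (hρ : Measurable ρ) :
    Measurable (offMass D P ρ : Hist K d → ℝ) := by
  have key := ((measurable_histPi_classifier hρ P).stronglyMeasurable.integral_prod_right'
    (ν := D)).measurable
  exact key

variable [IsProbabilityMeasure D]

theorem integrable_one_sub_histPi (S : Setting (K := K) D P CX Cl) (hρ : Measurable ρ)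
    (y : Hist K d) : Integrable (fun x => 1 - histPi P y x (ρ x)) D := by
  have h : Measurable fun x : Ctx d => (y, x) := measurable_prodMk_left
  have h' := (measurable_histPi_classifier hρ P).comp h
  simp only [Function.comp_def] at h'
  refine Integrable.of_bound h'.aestronglyMeasurable 1 (Filter.Eventually.of_forall fun x => ?_)
  have h1 := (histPi_mem S y x).1 (ρ x)
  have h2 := (isPolicy_histPi S y).le_one x (ρ x)
  rw [Real.norm_eq_abs, abs_le]
  constructor <;> linarith

theorem offMass_mem (S : Setting (K := K) D P CX Cl) (hρ : Measurable ρ) (y : Hist K d) :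
    offMass D P ρ y ∈ Set.Icc (0 : ℝ) 1 := by
  have hle := fun x => (isPolicy_histPi S y).le_one x (ρ x)
  constructor
  · exact integral_nonneg fun x => sub_nonneg.2 (hle x)
  · calc offMass D P ρ y ≤ ∫ _x, (1 : ℝ) ∂D :=
          integral_mono (integrable_one_sub_histPi S hρ y) (integrable_const _) fun x => by
            have := (histPi_mem S y x).1 (ρ x)
            simp only
            linarith
      _ = 1 := by simp

/-- The mean entropy is small if the policy is close to some classifier. -/
theorem meanEntropy_le_offMass (S : Setting (K := K) D P CX Cl) (hρ : Measurable ρ)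
    (y : Hist K d) :
    meanEntropy D P y ≤ 2 * (Real.log (K * P.T) + 1) * offMass D P ρ y + 1 / P.T := by
  have hT := S.two_le_T
  have hK := S.two_le_K
  have := S.neZero
  have hL : 0 ≤ Real.log (K * P.T) + 1 := by
    have : 0 ≤ Real.log (K * P.T) := by
      have := Real.log_natCast_nonneg (K * P.T)
      rwa [Nat.cast_mul] at this
    linarith
  have hi := (integrable_one_sub_histPi S hρ y).const_mul (2 * (Real.log (K * P.T) + 1))
  calc meanEntropy D P y
      ≤ ∫ x, (2 * (Real.log (K * P.T) + 1) * (1 - histPi P y x (ρ x)) + 1 / P.T) ∂D := by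
        refine integral_mono (integrable_entropy_histQ S y) (hi.add (integrable_const _)) fun x => ?_
        have h1 := entropy_le_mass (T := P.T) (by omega) (by omega) (histQ_mem S y x) (ρ x)
        have h2 := mul_le_mul_of_nonneg_right (one_sub_histQ_le S y x (ρ x)) hL
        simp only
        linarith
    _ = _ := by
        rw [integral_add hi (integrable_const _), integral_const_mul]
        simp [offMass]

end OffMass

namespace Trial

variable {Ω : Type*} {K d : ℕ}

/-- The entropy of the unexplored policy of round `t` at the context of that round. -/
noncomputable def roundEntropy (R : Trial Ω K d) (P : Params) (t : ℕ) (ω : Ω) : ℝ :=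
  entropy (qAt P (R.data ω) t (R.X t ω))

/-- The sum of the entropies over all rounds. -/
noncomputable def totalEntropy (R : Trial Ω K d) (P : Params) (ω : Ω) : ℝ :=
  ∑ t ∈ Finset.range P.T, R.roundEntropy P t ω

theorem beta_succ_sub (R : Trial Ω K d) (P : Params) (t : ℕ) (ω : Ω) :
    betaAt P (R.data ω) (t + 1) - betaAt P (R.data ω) t
      = P.beta1 / Real.sqrt (1 + (Real.log K)⁻¹
          * ∑ s ∈ Finset.range (t + 1), R.roundEntropy P s ω) := by
  rw [betaAt_succ, add_sub_cancel_left]; rfl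

namespace IsAdmissible

variable {mΩ : MeasurableSpace Ω} {R : Trial Ω K d}
  {P : Params} {D : Measure (Ctx d)} {G : Filtration ℕ mΩ} {μ : Measure Ω} {CX CΘ CE Cl : ℝ}

theorem roundEntropy_eq (h : R.IsAdmissible P D G μ CX CΘ CE Cl) (t : ℕ) (ω : Ω) :
    R.roundEntropy P t ω = entropy (histQ P (R.hist P t ω) (R.X t ω)) := by
  have := h.setting.neZero
  rw [roundEntropy, R.histQ_hist h.setting.beta1_pos]

theorem roundEntropy_nonneg (h : R.IsAdmissible P D G μ CX CΘ CE Cl) (t : ℕ) (ω : Ω) :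
    0 ≤ R.roundEntropy P t ω := by
  rw [h.roundEntropy_eq]; exact entropy_nonneg (histQ_mem h.setting _ _)

theorem roundEntropy_le (h : R.IsAdmissible P D G μ CX CΘ CE Cl) (t : ℕ) (ω : Ω) :
    R.roundEntropy P t ω ≤ Real.log K := by
  have := h.setting.neZero
  rw [h.roundEntropy_eq]; exact entropy_le_log (histQ_mem h.setting _ _)

theorem measurable_roundEntropy (h : R.IsAdmissible P D G μ CX CΘ CE Cl) {t : ℕ} (ht : t < P.T) :
    Measurable (R.roundEntropy P t) := by
  have e : R.roundEntropy P t = fun ω => entropy (histQ P (R.hist P t ω) (R.X t ω)) :=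
    funext (h.roundEntropy_eq t)
  rw [e]
  have key := (measurable_entropy_histQ P).comp ((h.measurable_hist ht).prodMk (h.measurable_X ht))
  simp only [Function.comp_def] at key
  exact key

theorem totalEntropy_nonneg (h : R.IsAdmissible P D G μ CX CΘ CE Cl) (ω : Ω) :
    0 ≤ R.totalEntropy P ω := Finset.sum_nonneg fun t _ => h.roundEntropy_nonneg t ω

theorem measurable_totalEntropy (h : R.IsAdmissible P D G μ CX CΘ CE Cl) :
    Measurable (R.totalEntropy P) :=
  Finset.measurable_sum _ fun _ ht => h.measurable_roundEntropy (Finset.mem_range.1 ht)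

theorem log_K_pos (h : R.IsAdmissible P D G μ CX CΘ CE Cl) : 0 < Real.log K :=
  Real.log_pos (by linarith [h.setting.K_pos])

theorem beta_succ_sub_mem (h : R.IsAdmissible P D G μ CX CΘ CE Cl) (t : ℕ) (ω : Ω) :
    betaAt P (R.data ω) (t + 1) - betaAt P (R.data ω) t ∈ Set.Icc 0 P.beta1 := by
  rw [R.beta_succ_sub]
  have hB := h.setting.beta1_pos
  have h1 : 0 ≤ ∑ s ∈ Finset.range (t + 1), R.roundEntropy P s ω :=
    Finset.sum_nonneg fun s _ => h.roundEntropy_nonneg s ω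
  refine ⟨by positivity, div_le_self hB.le ?_⟩
  rw [Real.one_le_sqrt]
  have := mul_nonneg (inv_nonneg.2 h.log_K_pos.le) h1
  linarith

/-- The penalty of the changing learning rates, for a fixed outcome. -/
theorem sum_penalty_le (h : R.IsAdmissible P D G μ CX CΘ CE Cl) (ω : Ω) :
    ∑ t ∈ Finset.range (P.T - 1), (betaAt P (R.data ω) (t + 1) - betaAt P (R.data ω) t)
        * R.roundEntropy P (t + 1) ω
      ≤ 2 * P.beta1 * Real.sqrt (Real.log K) * Real.sqrt (R.totalEntropy P ω) := by
  have key := mul_le_mul_of_nonneg_left (sum_div_sqrt_le h.log_K_pos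
    (fun t => h.roundEntropy_nonneg t ω) (fun t => h.roundEntropy_le t ω) (P.T - 1))
    h.setting.beta1_pos.le
  have hT := h.setting.two_le_T
  rw [Nat.sub_add_cancel (by omega), Finset.mul_sum] at key
  refine le_trans (le_of_eq (Finset.sum_congr rfl fun t _ => ?_))
    (key.trans (le_of_eq (by rw [totalEntropy]; ring)))
  rw [R.beta_succ_sub]; ring

theorem sum_inv_beta_le (h : R.IsAdmissible P D G μ CX CΘ CE Cl) (ω : Ω) :
    ∑ t ∈ Finset.range P.T, 1 / betaAt P (R.data ω) t
      ≤ (1 + Real.log P.T) / P.beta1 * Real.sqrt (1 + (Real.log K)⁻¹ * R.totalEntropy P ω) := by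
  have hB := h.setting.beta1_pos
  have hℓ := inv_nonneg.2 h.log_K_pos.le
  have hS := mul_nonneg hℓ (h.totalEntropy_nonneg ω)
  refine (sum_inv_le (β := betaAt P (R.data ω)) hB
    (r := Real.sqrt (1 + (Real.log K)⁻¹ * R.totalEntropy P ω)) ?_ P.T rfl ?_).trans
    (le_of_eq (by ring))
  · rw [Real.one_le_sqrt]; linarith
  · intro t ht
    have h1 := R.beta_succ_sub P t ω
    have h2 : ∑ s ∈ Finset.range (t + 1), R.roundEntropy P s ω ≤ R.totalEntropy P ω :=
      Finset.sum_le_sum_of_subset_of_nonneg (Finset.range_subset_range.2 ht.le)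
        fun s _ _ => h.roundEntropy_nonneg s ω
    have h0 : 0 ≤ ∑ s ∈ Finset.range (t + 1), R.roundEntropy P s ω :=
      Finset.sum_nonneg fun s _ => h.roundEntropy_nonneg s ω
    have h3 : P.beta1 / Real.sqrt (1 + (Real.log K)⁻¹ * R.totalEntropy P ω)
        ≤ P.beta1 / Real.sqrt (1 + (Real.log K)⁻¹
          * ∑ s ∈ Finset.range (t + 1), R.roundEntropy P s ω) := by
      have := mul_nonneg hℓ h0
      gcongr
    linarith

variable [IsProbabilityMeasure μ]

theorem integrable_inv_beta (h : R.IsAdmissible P D G μ CX CΘ CE Cl) {t : ℕ} (ht : t < P.T) :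
    Integrable (fun ω => 1 / betaAt P (R.data ω) t) μ := by
  have hB := h.setting.beta1_pos
  refine Integrable.of_bound ((h.measurable_beta ht.le).const_div 1).aestronglyMeasurable
    (1 / P.beta1) (Filter.Eventually.of_forall fun ω => ?_)
  rw [Real.norm_of_nonneg (one_div_nonneg.2 (h.beta_pos t ω).le)]
  exact one_div_le_one_div_of_le hB (beta1_le_betaAt hB _ t)

theorem integrable_roundEntropy (h : R.IsAdmissible P D G μ CX CΘ CE Cl) {t : ℕ} (ht : t < P.T) :
    Integrable (R.roundEntropy P t) μ := by
  refine Integrable.of_bound (h.measurable_roundEntropy ht).aestronglyMeasurable (Real.log K)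
    (Filter.Eventually.of_forall fun ω => ?_)
  rw [Real.norm_of_nonneg (h.roundEntropy_nonneg t ω)]
  exact h.roundEntropy_le t ω

theorem integrable_totalEntropy (h : R.IsAdmissible P D G μ CX CΘ CE Cl) :
    Integrable (R.totalEntropy P) μ :=
  integrable_finsetSum _ fun _ ht => h.integrable_roundEntropy (Finset.mem_range.1 ht)

variable [IsProbabilityMeasure D]

/-- Averaging over the context of a round given the past. -/
theorem integral_ctx (h : R.IsAdmissible P D G μ CX CΘ CE Cl) {t : ℕ} (ht : t < P.T) {S : Type*}
    [MeasurableSpace S] {Y : Ω → S} (hY : Measurable[G t] Y) {F : S → Ctx d → ℝ}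
    (hF : Measurable (Function.uncurry F)) (hi : Integrable (fun ω => F (Y ω) (R.X t ω)) μ) :
    ∫ ω, F (Y ω) (R.X t ω) ∂μ = ∫ ω, ∫ x, F (Y ω) x ∂D ∂μ := by
  have hY' : Measurable[mΩ] Y := hY.mono (G.le t) le_rfl
  have hlaw : μ.map (fun ω => (Y ω, R.X t ω)) = (μ.map Y) ⊗ₘ (Kernel.const S D) := by
    have : IsProbabilityMeasure (μ.map Y) := Measure.isProbabilityMeasure_map hY'.aemeasurable
    rw [Measure.compProd_const]
    exact h.map_ctx ht hY
  have key := integral_freeze hY' (h.measurable_X ht) hlaw hF.stronglyMeasurable hi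
  simpa only [Kernel.const_apply] using key

/-- The mean entropy may be evaluated at the context of the round. -/
theorem integral_mul_meanEntropy (h : R.IsAdmissible P D G μ CX CΘ CE Cl) {t : ℕ} (ht : t < P.T)
    {W : Ω → ℝ} (hW : Measurable[G t] W) {c : ℝ} (hc : ∀ ω, |W ω| ≤ c) :
    ∫ ω, W ω * meanEntropy D P (R.hist P t ω) ∂μ = ∫ ω, W ω * R.roundEntropy P t ω ∂μ := by
  have hW' : Measurable[mΩ] W := hW.mono (G.le t) le_rfl
  have e : Measurable fun q : (ℝ × Hist K d) × Ctx d => (q.1.2, q.2) :=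
    (measurable_snd.comp measurable_fst).prodMk measurable_snd
  have h1 := (measurable_entropy_histQ P).comp e
  simp only [Function.comp_def] at h1
  have h2 : Measurable fun q : (ℝ × Hist K d) × Ctx d => q.1.1 :=
    measurable_fst.comp measurable_fst
  have hF : Measurable (Function.uncurry fun (y : ℝ × Hist K d) (x : Ctx d) =>
    y.1 * entropy (histQ P y.2 x)) := h2.mul h1
  have hi : Integrable (fun ω => W ω * R.roundEntropy P t ω) μ :=
    (h.integrable_roundEntropy ht).bdd_mul hW'.aestronglyMeasurable (Filter.Eventually.of_forall hc)
  simp only [h.roundEntropy_eq] at hi ⊢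
  have key := h.integral_ctx ht (hW.prodMk (h.measurable_hist_G ht)) hF hi
  simp only [integral_const_mul] at key
  exact key.symm

theorem integrable_offMass (h : R.IsAdmissible P D G μ CX CΘ CE Cl) {t : ℕ} (ht : t < P.T)
    {ρ : Ctx d → Fin K} (hρ : Measurable ρ) :
    Integrable (fun ω => offMass D P ρ (R.hist P t ω)) μ := by
  refine Integrable.of_bound
    ((measurable_offMass hρ).comp (h.measurable_hist ht)).aestronglyMeasurable 1
    (Filter.Eventually.of_forall fun ω => ?_)
  have := offMass_mem h.setting hρ (R.hist P t ω)
  rw [Real.norm_of_nonneg this.1]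
  exact this.2

theorem Qbar_eq (h : R.IsAdmissible P D G μ CX CΘ CE Cl) {ρ : Ctx d → Fin K} (hρ : Measurable ρ) :
    R.Qbar P D μ ρ = ∑ t ∈ Finset.range P.T, ∫ ω, offMass D P ρ (R.hist P t ω) ∂μ := by
  have := h.setting.neZero
  rw [Qbar, ← integral_finsetSum _ fun t ht => h.integrable_offMass (Finset.mem_range.1 ht) hρ]
  refine integral_congr_ae (Filter.Eventually.of_forall fun ω => ?_)
  simp only [R.policy_eq h.setting.beta1_pos]
  exact integral_finsetSum _ fun t _ => integrable_one_sub_histPi h.setting hρ (R.hist P t ω)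

theorem Qbar_nonneg (h : R.IsAdmissible P D G μ CX CΘ CE Cl) {ρ : Ctx d → Fin K}
    (hρ : Measurable ρ) : 0 ≤ R.Qbar P D μ ρ := by
  rw [h.Qbar_eq hρ]
  exact Finset.sum_nonneg fun t _ => integral_nonneg fun ω => (offMass_mem h.setting hρ _).1

/-- The expected total entropy is controlled by `Q̄`. -/
theorem integral_totalEntropy_le (h : R.IsAdmissible P D G μ CX CΘ CE Cl) {ρ : Ctx d → Fin K}
    (hρ : Measurable ρ) :
    ∫ ω, R.totalEntropy P ω ∂μ ≤ 2 * (Real.log (K * P.T) + 1) * R.Qbar P D μ ρ + 1 := by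
  have S := h.setting
  have hT : (0 : ℝ) < P.T := by have := S.two_le_T; positivity
  have h1 : ∀ t ∈ Finset.range P.T, ∫ ω, R.roundEntropy P t ω ∂μ
      ≤ 2 * (Real.log (K * P.T) + 1) * ∫ ω, offMass D P ρ (R.hist P t ω) ∂μ + 1 / P.T := by
    intro t ht
    have ht := Finset.mem_range.1 ht
    have e := h.integral_mul_meanEntropy ht (W := fun _ => 1) measurable_const (c := 1) (by simp)
    simp only [one_mul] at e
    rw [← e, ← integral_const_mul]
    have hi := (h.integrable_offMass ht hρ).const_mul (2 * (Real.log (K * P.T) + 1))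
    have e2 : ∫ ω, (2 * (Real.log (K * P.T) + 1) * offMass D P ρ (R.hist P t ω)
        + 1 / (P.T : ℝ)) ∂μ
        = ∫ ω, 2 * (Real.log (K * P.T) + 1) * offMass D P ρ (R.hist P t ω) ∂μ + 1 / P.T := by
      rw [integral_add hi (integrable_const _)]; simp
    rw [← e2]
    exact integral_mono_of_nonneg (Filter.Eventually.of_forall fun ω => meanEntropy_nonneg S _)
      (hi.add (integrable_const _)) (Filter.Eventually.of_forall fun ω =>
        meanEntropy_le_offMass S hρ _)
  have h2 : ∫ ω, R.totalEntropy P ω ∂μ = ∑ t ∈ Finset.range P.T, ∫ ω, R.roundEntropy P t ω ∂μ :=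
    integral_finsetSum _ fun t ht => h.integrable_roundEntropy (Finset.mem_range.1 ht)
  rw [h2]
  refine (Finset.sum_le_sum h1).trans (le_of_eq ?_)
  rw [Finset.sum_add_distrib, ← Finset.mul_sum, h.Qbar_eq hρ]
  congr 1
  rw [Finset.sum_const, Finset.card_range, nsmul_eq_mul]
  field_simp

/-- The expected regret of the unexplored policy, measured with the estimated losses. -/
theorem sum_integral_regretDir_le (h : R.IsAdmissible P D G μ CX CΘ CE Cl) {ρ : Ctx d → Fin K}
    (hρ : Measurable ρ) :
    ∑ t ∈ Finset.range P.T, ∑ a,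
        ∫ ω, inner ℝ (regretDir D P ρ a (R.hist P t ω)) (R.estimate P t a ω) ∂μ
      ≤ P.beta1 * Real.log K
        + 2 * P.beta1 * Real.sqrt (Real.log K) * ∫ ω, Real.sqrt (R.totalEntropy P ω) ∂μ
        + 4 * Real.exp (2 * CX) * Cl ^ 2 * (K ^ 2 * d)
          * ∫ ω, ∑ t ∈ Finset.range P.T, 1 / betaAt P (R.data ω) t ∂μ := by
  have S := h.setting
  have hsqrt : Integrable (fun ω => Real.sqrt (R.totalEntropy P ω)) μ := by
    refine (((integrable_const (1 : ℝ)).add h.integrable_totalEntropy)).mono'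
      h.measurable_totalEntropy.sqrt.aestronglyMeasurable (Filter.Eventually.of_forall fun ω => ?_)
    rw [Real.norm_of_nonneg (Real.sqrt_nonneg _)]
    have h1 := Real.sq_sqrt (h.totalEntropy_nonneg ω)
    simp only [Pi.add_apply]
    nlinarith [sq_nonneg (Real.sqrt (R.totalEntropy P ω) - 1), h.totalEntropy_nonneg ω]
  have hL : ∀ t < P.T, ∀ a, Integrable (fun ω =>
      (inner ℝ (regretDir D P ρ a (R.hist P t ω)) (R.estimate P t a ω) : ℝ)) μ := by
    intro t ht a
    have hm : Measurable fun ω =>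
        (inner ℝ (regretDir D P ρ a (R.hist P t ω)) (R.estimate P t a ω) : ℝ) :=
      ((measurable_regretDir hρ a).comp (h.measurable_hist ht)).inner (h.measurable_estimate ht a)
    refine Integrable.of_bound hm.aestronglyMeasurable (CX * (2 * ((t + 1) * P.beta1))) ?_
    filter_upwards [h.ae_norm_estimate ht a] with ω hω
    refine (norm_inner_le_norm _ _).trans
      (mul_le_mul (norm_regretDir_le S a _) (hω.trans ?_) (norm_nonneg _) S.CX_pos.le)
    have := h.beta_le t ω
    linarith
  have hWm : ∀ t < P.T - 1, Measurable[G (t + 1)] fun ω =>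
      betaAt P (R.data ω) (t + 1) - betaAt P (R.data ω) t := by
    intro t ht
    have h1 := h.measurable_beta_G (t := t + 1) (by omega)
    have h2 := (h.measurable_beta_G (t := t) (by omega)).mono (G.mono t.le_succ) le_rfl
    exact h1.sub h2
  have hWc : ∀ t ω, |betaAt P (R.data ω) (t + 1) - betaAt P (R.data ω) t| ≤ P.beta1 := by
    intro t ω
    have := h.beta_succ_sub_mem t ω
    rw [abs_of_nonneg this.1]; exact this.2
  have hP : ∀ t ∈ Finset.range (P.T - 1), Integrable (fun ω =>
      (betaAt P (R.data ω) (t + 1) - betaAt P (R.data ω) t)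
        * meanEntropy D P (R.hist P (t + 1) ω)) μ := by
    intro t ht
    have ht := Finset.mem_range.1 ht
    have hi : Integrable (fun ω => meanEntropy D P (R.hist P (t + 1) ω)) μ := by
      refine Integrable.of_bound (measurable_meanEntropy.comp
        (h.measurable_hist (t := t + 1) (by omega))).aestronglyMeasurable (Real.log K)
        (Filter.Eventually.of_forall fun ω => ?_)
      rw [Real.norm_of_nonneg (meanEntropy_nonneg S _)]
      exact meanEntropy_le_log S _
    exact hi.bdd_mul ((hWm t ht).mono (G.le _) le_rfl).aestronglyMeasurable
      (Filter.Eventually.of_forall (hWc t))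
  have hP' : ∀ t ∈ Finset.range (P.T - 1), Integrable (fun ω =>
      (betaAt P (R.data ω) (t + 1) - betaAt P (R.data ω) t) * R.roundEntropy P (t + 1) ω) μ := by
    intro t ht
    have ht := Finset.mem_range.1 ht
    exact (h.integrable_roundEntropy (t := t + 1) (by omega)).bdd_mul
      ((hWm t ht).mono (G.le _) le_rfl).aestronglyMeasurable (Filter.Eventually.of_forall (hWc t))
  have hV := fun t (ht : t < P.T) a => h.integral_trace_le ht a
  have hVi := integrable_finsetSum (Finset.range P.T) fun t ht =>
    integrable_finsetSum Finset.univ fun (a : Fin K) _ => (hV t (Finset.mem_range.1 ht) a).1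
  have hPi := integrable_finsetSum (Finset.range (P.T - 1)) hP
  have hc : Integrable (fun _ : Ω => P.beta1 * Real.log K) μ := integrable_const _
  have hint := integral_mono_ae (integrable_finsetSum (Finset.range P.T) fun t ht =>
    integrable_finsetSum Finset.univ fun (a : Fin K) _ => hL t (Finset.mem_range.1 ht) a)
    ((hc.add hPi).add (hVi.const_mul (Real.exp (2 * CX) * (2 * K * Cl ^ 2))))
    (h.sum_regretDir_le hρ)
  rw [integral_finsetSum _ fun t ht => integrable_finsetSum Finset.univ fun (a : Fin K) _ =>
    hL t (Finset.mem_range.1 ht) a, integral_add' (hc.add hPi) (hVi.const_mul _),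
    integral_add' hc hPi, integral_const_mul (Real.exp (2 * CX) * (2 * K * Cl ^ 2)),
    integral_finsetSum _ hP, integral_finsetSum _ fun t ht =>
    integrable_finsetSum Finset.univ fun (a : Fin K) _ => (hV t (Finset.mem_range.1 ht) a).1]
    at hint
  simp only [integral_const, probReal_univ, one_smul] at hint
  have e1 : ∀ t ∈ Finset.range P.T, ∫ ω, ∑ a,
        inner ℝ (regretDir D P ρ a (R.hist P t ω)) (R.estimate P t a ω) ∂μ
      = ∑ a, ∫ ω, inner ℝ (regretDir D P ρ a (R.hist P t ω)) (R.estimate P t a ω) ∂μ :=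
    fun t ht => integral_finsetSum _ fun a _ => hL t (Finset.mem_range.1 ht) a
  rw [Finset.sum_congr rfl e1] at hint
  refine hint.trans (add_le_add (add_le_add le_rfl ?_) ?_)
  · have e2 : ∀ t ∈ Finset.range (P.T - 1), ∫ ω,
          (betaAt P (R.data ω) (t + 1) - betaAt P (R.data ω) t)
            * meanEntropy D P (R.hist P (t + 1) ω) ∂μ
        = ∫ ω, (betaAt P (R.data ω) (t + 1) - betaAt P (R.data ω) t)
            * R.roundEntropy P (t + 1) ω ∂μ := fun t ht => by
      have ht := Finset.mem_range.1 ht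
      exact h.integral_mul_meanEntropy (by omega) (hWm t ht) (hWc t)
    rw [Finset.sum_congr rfl e2, ← integral_finsetSum _ hP', ← integral_const_mul]
    exact integral_mono (integrable_finsetSum _ hP') (hsqrt.const_mul _) h.sum_penalty_le
  · have e3 : ∀ t ∈ Finset.range P.T, ∫ ω, ∑ a, 1 / betaAt P (R.data ω) t *
          (mgrW a (R.X t ω) (R.A t ω) *
            ((histMgr P a (R.hist P t ω) (R.sims t a ω)).transpose
              * armMoment D (histPi P (R.hist P t ω)) a
              * histMgr P a (R.hist P t ω) (R.sims t a ω))).trace ∂μ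
        ≤ K * (2 * d * ∫ ω, 1 / betaAt P (R.data ω) t ∂μ) := by
      intro t ht
      rw [integral_finsetSum _ fun a _ => (hV t (Finset.mem_range.1 ht) a).1]
      refine (Finset.sum_le_sum fun a _ => (hV t (Finset.mem_range.1 ht) a).2).trans ?_
      simp
    rw [integral_finsetSum _ fun t ht => h.integrable_inv_beta (Finset.mem_range.1 ht)]
    have hpos : 0 ≤ Real.exp (2 * CX) * (2 * K * Cl ^ 2) := by positivity
    refine (mul_le_mul_of_nonneg_left (Finset.sum_le_sum e3) hpos).trans (le_of_eq ?_)
    rw [← Finset.mul_sum, ← Finset.mul_sum]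
    ring

end IsAdmissible

end Trial

/-! ### From the regret to the unexplored policy -/

/-- Exploration changes the probability of an arm by at most the exploration rate. -/
theorem abs_histPi_sub_histQ_le {K d : ℕ} {P : Params} {D : Measure (Ctx d)} {CX Cl : ℝ}
    (S : Setting (K := K) D P CX Cl) (a : Fin K) (y : Hist K d) (x : Ctx d) :
    |histPi P y x a - histQ P y x a| ≤ histGamma P y := by
  have h1 := (histQ_mem S y x).1 a
  have h2 := histQ_le_one S y x a
  have h3 := (histGamma_pos S y).le
  have h4 := S.K_pos
  have e : histPi P y x a - histQ P y x a = histGamma P y * (1 / K - histQ P y x a) := by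
    unfold histPi; ring
  have h5 : (0 : ℝ) ≤ 1 / K := by positivity
  have h6 : 1 / (K : ℝ) ≤ 1 := by rw [div_le_one (by linarith)]; linarith
  rw [e, abs_mul, abs_of_nonneg h3]
  refine mul_le_of_le_one_right h3 ?_
  rw [abs_le]
  constructor <;> linarith

/-- Exploration changes the mean context picked for an arm by at most `γ C_X`. -/
theorem norm_contextMean_sub_le {K d : ℕ} {P : Params} {D : Measure (Ctx d)}
    [IsProbabilityMeasure D] {CX Cl : ℝ} (S : Setting (K := K) D P CX Cl) {ρ : Ctx d → Fin K}
    (hρ : Measurable ρ) (a : Fin K) (y : Hist K d) :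
    ‖contextMean D (fun x => histPi P y x a) - contextMean D (picks ρ a) - regretDir D P ρ a y‖
      ≤ histGamma P y * CX := by
  have hπ := isPolicy_histPi S y
  have i1 := integrable_smul_context S.bdd (hπ.meas a) (c := 1) fun x => by
    rw [abs_of_nonneg ((hπ.mem x).1 a)]; exact hπ.le_one x a
  have i2 := integrable_smul_context S.bdd (measurable_picks hρ a) (abs_picks_le ρ a)
  have i3 : Integrable (fun x => (histQ P y x a - picks ρ a x) • x) D :=
    integrable_smul_context S.bdd
      ((measurable_histQ_right P y a).sub (measurable_picks hρ a)) (abs_histQ_sub_picks_le S ρ a y)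
  have i12 : Integrable (fun x => histPi P y x a • x - picks ρ a x • x) D := i1.sub i2
  have e : contextMean D (fun x => histPi P y x a) - contextMean D (picks ρ a)
      - regretDir D P ρ a y = contextMean D fun x => histPi P y x a - histQ P y x a := by
    unfold regretDir contextMean
    rw [← integral_sub i1 i2, ← integral_sub i12 i3]
    refine integral_congr_ae (Filter.Eventually.of_forall fun x => ?_)
    simp only
    module
  rw [e]
  exact norm_contextMean_le S.bdd (abs_histPi_sub_histQ_le S a y)

namespace Trial.IsAdmissible

variable {Ω : Type*} {K d : ℕ} {mΩ : MeasurableSpace Ω} {R : Trial Ω K d}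
  {P : Params} {D : Measure (Ctx d)} {G : Filtration ℕ mΩ} {μ : Measure Ω} {CX CΘ CE Cl : ℝ}
  [IsProbabilityMeasure μ]

theorem integrable_θ (h : R.IsAdmissible P D G μ CX CΘ CE Cl) {t : ℕ} (ht : t < P.T)
    (a : Fin K) : Integrable (R.θ t a) μ :=
  Integrable.of_bound (h.measurable_θ ht a).aestronglyMeasurable CΘ (h.norm_θ t ht a)

theorem integrable_ε (h : R.IsAdmissible P D G μ CX CΘ CE Cl) {t : ℕ} (ht : t < P.T)
    (a : Fin K) : Integrable (R.ε t a) μ :=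
  Integrable.of_bound (h.measurable_ε ht a).aestronglyMeasurable CE (h.abs_ε t ht a)

theorem integrable_inner_θ (h : R.IsAdmissible P D G μ CX CΘ CE Cl) {t : ℕ} (ht : t < P.T)
    (a : Fin K) : Integrable (fun ω => (inner ℝ (R.X t ω) (R.θ t a ω) : ℝ)) μ := by
  refine Integrable.of_bound
    ((h.measurable_X ht).inner (h.measurable_θ ht a)).aestronglyMeasurable (CX * CΘ) ?_
  filter_upwards [h.ae_X ht, h.norm_θ t ht a] with ω h1 h2
  exact (norm_inner_le_norm _ _).trans (mul_le_mul h1 h2 (norm_nonneg _) h.setting.CX_pos.le)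

theorem integrable_inner_hist (h : R.IsAdmissible P D G μ CX CΘ CE Cl) {t : ℕ} (ht : t < P.T)
    (a : Fin K) {u : Hist K d → Ctx d} (hu : Measurable u) {Cu : ℝ} (huC : ∀ y, ‖u y‖ ≤ Cu) :
    Integrable (fun ω => (inner ℝ (u (R.hist P t ω)) (R.θ t a ω) : ℝ)) μ := by
  have hCu : 0 ≤ Cu := (norm_nonneg _).trans (huC (0, 0, 0))
  refine Integrable.of_bound ((hu.comp (h.measurable_hist ht)).inner
    (h.measurable_θ ht a)).aestronglyMeasurable (Cu * CΘ) ?_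
  filter_upwards [h.norm_θ t ht a] with ω hω
  exact (norm_inner_le_norm _ _).trans (mul_le_mul (huC _) hω (norm_nonneg _) hCu)

/-- A loss selected by a function of the past, the context and the arm: errors average out. -/
theorem integral_select_loss (h : R.IsAdmissible P D G μ CX CΘ CE Cl) {t : ℕ} (ht : t < P.T)
    {s : Ω → Fin K} (hs : Measurable[G t ⊔ MeasurableSpace.comap (R.X t) inferInstance
        ⊔ MeasurableSpace.comap (R.A t) inferInstance] s) :
    Integrable (fun ω => R.loss t (s ω) ω) μ ∧
    ∫ ω, R.loss t (s ω) ω ∂μ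
      = ∑ a, ∫ ω, (if s ω = a then 1 else 0) * inner ℝ (R.X t ω) (R.θ t a ω) ∂μ := by
  have hX : MeasurableSpace.comap (R.X t) inferInstance ≤ mΩ := (h.measurable_X ht).comap_le
  have hA : MeasurableSpace.comap (R.A t) inferInstance ≤ mΩ := (h.measurable_A ht).comap_le
  have hg : ∀ a, Measurable[G t ⊔ MeasurableSpace.comap (R.X t) inferInstance
      ⊔ MeasurableSpace.comap (R.A t) inferInstance] fun ω => if s ω = a then (1 : ℝ) else 0 :=
    fun a => Measurable.ite (hs (measurableSet_singleton a)) measurable_const measurable_const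
  have hg' : ∀ a, Measurable[mΩ] fun ω => if s ω = a then (1 : ℝ) else 0 := fun a =>
    (hg a).mono (sup_le (sup_le (G.le t) hX) hA) le_rfl
  have hb : ∀ (a : Fin K) (ω : Ω), |if s ω = a then (1 : ℝ) else 0| ≤ 1 := by
    intro a ω; split_ifs <;> simp
  have e : ∀ ω, R.loss t (s ω) ω = ∑ a, ((if s ω = a then 1 else 0)
      * inner ℝ (R.X t ω) (R.θ t a ω) + (if s ω = a then 1 else 0) * R.ε t a ω) := by
    intro ω
    simp [Finset.sum_add_distrib, Trial.loss]
  have i1 : ∀ a, Integrable (fun ω => (if s ω = a then 1 else 0)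
      * inner ℝ (R.X t ω) (R.θ t a ω)) μ := fun a =>
    (h.integrable_inner_θ ht a).bdd_mul (hg' a).aestronglyMeasurable
      (Filter.Eventually.of_forall (hb a))
  have i2 : ∀ a, Integrable (fun ω => (if s ω = a then 1 else 0) * R.ε t a ω) μ := fun a =>
    (h.integrable_ε ht a).bdd_mul (hg' a).aestronglyMeasurable
      (Filter.Eventually.of_forall (hb a))
  simp_rw [e]
  have i3 : ∀ a, Integrable (fun ω => (if s ω = a then 1 else 0) * inner ℝ (R.X t ω) (R.θ t a ω)
      + (if s ω = a then 1 else 0) * R.ε t a ω) μ := fun a => (i1 a).add (i2 a)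
  refine ⟨integrable_finsetSum _ fun a _ => i3 a, ?_⟩
  rw [integral_finsetSum _ fun a _ => i3 a]
  refine Finset.sum_congr rfl fun a _ => ?_
  rw [integral_add (i1 a) (i2 a), h.integral_mul_ε ht a (hg a)
    (Filter.Eventually.of_forall (hb a)), add_zero]

variable [IsProbabilityMeasure D]

/-- The expected loss of the algorithm in one round. -/
theorem integral_loss_arm (h : R.IsAdmissible P D G μ CX CΘ CE Cl) {t : ℕ} (ht : t < P.T) :
    Integrable (fun ω => R.loss t (R.A t ω) ω) μ ∧
    ∫ ω, R.loss t (R.A t ω) ω ∂μ = ∑ a, ∫ ω,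
      inner ℝ (contextMean D fun x => histPi P (R.hist P t ω) x a) (R.θ t a ω) ∂μ := by
  have S := h.setting
  obtain ⟨hi, he⟩ := h.integral_select_loss ht (s := R.A t)
    ((comap_measurable (R.A t)).mono le_sup_right le_rfl)
  refine ⟨hi, he.trans (Finset.sum_congr rfl fun a _ => ?_)⟩
  let F : Hist K d → Ctx d × Fin K → ℝ := fun y w =>
    (if w.2 = a then 1 else 0) * inner ℝ w.1 (y.2.2 a)
  have hF : StronglyMeasurable (Function.uncurry F) := by
    have e1 : Measurable fun q : Hist K d × (Ctx d × Fin K) => q.2.2 := by fun_prop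
    have e2 : Measurable fun q : Hist K d × (Ctx d × Fin K) =>
      (inner ℝ q.2.1 (q.1.2.2 a) : ℝ) := by fun_prop
    exact ((Measurable.ite (e1 (measurableSet_singleton a)) measurable_const
      measurable_const).mul e2).stronglyMeasurable
  have hFb : ∀ y (w : Ctx d × Fin K), ‖w.1‖ ≤ CX → ‖F y w‖ ≤ CX * ‖y.2.2 a‖ := by
    intro y w hw
    have h1 : ‖(inner ℝ w.1 (y.2.2 a) : ℝ)‖ ≤ CX * ‖y.2.2 a‖ :=
      (norm_inner_le_norm _ _).trans (by gcongr)
    simp only [F]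
    split_ifs
    · rwa [one_mul]
    · rw [zero_mul, norm_zero]; exact (norm_nonneg _).trans h1
  have hFi : Integrable (fun ω => F (R.hist P t ω) (R.X t ω, R.A t ω)) μ := by
    have hm := hF.comp_measurable
      ((h.measurable_hist ht).prodMk ((h.measurable_X ht).prodMk (h.measurable_A ht)))
    refine Integrable.of_bound hm.aestronglyMeasurable (CX * CΘ) ?_
    filter_upwards [h.ae_X ht, h.norm_θ t ht a] with ω h1 h2
    exact (hFb (R.hist P t ω) (R.X t ω, R.A t ω) h1).trans
      (mul_le_mul_of_nonneg_left h2 S.CX_pos.le)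
  have key := integral_freeze (h.measurable_hist ht)
    ((h.measurable_X ht).prodMk (h.measurable_A ht)) (h.map_pair ht) hF hFi
  refine key.trans (integral_congr_ae (Filter.Eventually.of_forall fun ω => ?_))
  set y := R.hist P t ω with hy
  have hπ := isPolicy_histPi S y
  have := isProbabilityMeasure_pairLaw D hπ
  have hFm : StronglyMeasurable (F y) := hF.comp_measurable measurable_prodMk_left
  have hFy : Integrable (F y) (pairLaw D (histPi P y)) := by
    refine Integrable.of_bound hFm.aestronglyMeasurable (CX * ‖y.2.2 a‖) ?_
    filter_upwards [ae_pairLaw D (p := histPi P y) S.bdd] with w hw using hFb y w hw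
  change ∫ w, F y w ∂(pairLaw D (histPi P y)) = inner ℝ _ (y.2.2 a)
  rw [integral_pairLaw D hπ hFm hFy, Finset.sum_eq_single a,
    inner_contextMean S.bdd (hπ.meas a) (c := 1) fun x => by
      rw [abs_of_nonneg ((hπ.mem x).1 a)]; exact hπ.le_one x a]
  · simp [F]
  · intro b _ hb
    simp [F, hb]
  · simp

/-- The expected loss of a fixed classifier in one round. -/
theorem integral_loss_classifier (h : R.IsAdmissible P D G μ CX CΘ CE Cl) {t : ℕ} (ht : t < P.T)
    {ρ : Ctx d → Fin K} (hρ : Measurable ρ) :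
    Integrable (fun ω => R.loss t (ρ (R.X t ω)) ω) μ ∧
    ∫ ω, R.loss t (ρ (R.X t ω)) ω ∂μ = ∑ a, ∫ ω,
      inner ℝ (contextMean D (picks ρ a)) (R.θ t a ω) ∂μ := by
  have S := h.setting
  obtain ⟨hi, he⟩ := h.integral_select_loss ht (s := fun ω => ρ (R.X t ω))
    (hρ.comp ((comap_measurable (R.X t)).mono (le_sup_right.trans le_sup_left) le_rfl))
  refine ⟨hi, he.trans (Finset.sum_congr rfl fun a _ => ?_)⟩
  let F : Ctx d → Ctx d → ℝ := fun v x => picks ρ a x * inner ℝ x v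
  have hF : Measurable (Function.uncurry F) :=
    ((measurable_picks hρ a).comp measurable_snd).mul (measurable_snd.inner measurable_fst)
  have hFi : Integrable (fun ω => F (R.θ t a ω) (R.X t ω)) μ :=
    (h.integrable_inner_θ ht a).bdd_mul
      ((measurable_picks hρ a).comp (h.measurable_X ht)).aestronglyMeasurable
      (Filter.Eventually.of_forall fun ω => abs_picks_le ρ a _)
  have key := h.integral_ctx ht (h.play.choice_θ t ht a) hF hFi
  refine key.trans (integral_congr_ae (Filter.Eventually.of_forall fun ω => ?_))
  exact (inner_contextMean S.bdd (measurable_picks hρ a) (abs_picks_le ρ a) _).symm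

/-- Among all classifiers, an optimal one has the smallest expected cumulative loss. -/
theorem sum_loss_optimal_le (h : R.IsAdmissible P D G μ CX CΘ CE Cl) {astar ρ : Ctx d → Fin K}
    (hopt : R.IsOptimal P.T μ astar) (hρ : Measurable ρ) :
    ∑ t ∈ Finset.range P.T, ∑ a, ∫ ω, inner ℝ (contextMean D (picks astar a)) (R.θ t a ω) ∂μ
      ≤ ∑ t ∈ Finset.range P.T, ∑ a,
        ∫ ω, inner ℝ (contextMean D (picks ρ a)) (R.θ t a ω) ∂μ := by
  have S := h.setting
  have hi : ∀ {σ : Ctx d → Fin K}, Measurable σ → ∀ t a, Integrable (fun x =>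
      picks σ a x * inner ℝ x (∫ ω, R.θ t a ω ∂μ)) D := fun hσ t a =>
    integrable_mul_inner S.bdd (measurable_picks hσ a) (abs_picks_le _ a) _
  have e : ∀ {σ : Ctx d → Fin K}, Measurable σ →
      ∑ t ∈ Finset.range P.T, ∑ a, ∫ ω, inner ℝ (contextMean D (picks σ a)) (R.θ t a ω) ∂μ
      = ∫ x, ∑ t ∈ Finset.range P.T, inner ℝ x (∫ ω, R.θ t (σ x) ω ∂μ) ∂D := by
    intro σ hσ
    have e1 : ∀ x, ∑ t ∈ Finset.range P.T, inner ℝ x (∫ ω, R.θ t (σ x) ω ∂μ)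
        = ∑ t ∈ Finset.range P.T, ∑ a, picks σ a x * inner ℝ x (∫ ω, R.θ t a ω ∂μ) := fun x =>
      Finset.sum_congr rfl fun t _ =>
        (sum_picks_mul σ x fun a => inner ℝ x (∫ ω, R.θ t a ω ∂μ)).symm
    simp_rw [e1]
    rw [integral_finsetSum _ fun t _ => integrable_finsetSum _ fun a _ => hi hσ t a]
    refine Finset.sum_congr rfl fun t ht => ?_
    rw [integral_finsetSum _ fun a _ => hi hσ t a]
    refine Finset.sum_congr rfl fun a _ => ?_
    rw [integral_inner (h.integrable_θ (Finset.mem_range.1 ht) a),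
      inner_contextMean S.bdd (measurable_picks hσ a) (abs_picks_le _ a)]
  have hi' : ∀ {σ : Ctx d → Fin K}, Measurable σ → Integrable (fun x =>
      ∑ t ∈ Finset.range P.T, inner ℝ x (∫ ω, R.θ t (σ x) ω ∂μ)) D := by
    intro σ hσ
    have e1 : ∀ x, ∑ t ∈ Finset.range P.T, inner ℝ x (∫ ω, R.θ t (σ x) ω ∂μ)
        = ∑ t ∈ Finset.range P.T, ∑ a, picks σ a x * inner ℝ x (∫ ω, R.θ t a ω ∂μ) := fun x =>
      Finset.sum_congr rfl fun t _ =>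
        (sum_picks_mul σ x fun a => inner ℝ x (∫ ω, R.θ t a ω ∂μ)).symm
    simp_rw [e1]
    exact integrable_finsetSum _ fun t _ => integrable_finsetSum _ fun a _ => hi hσ t a
  rw [e hopt.1, e hρ]
  exact integral_mono (hi' hopt.1) (hi' hρ) fun x => hopt.2 x (ρ x)

/-- The regret is at most that of the unexplored policy against an optimal classifier, up to the
cost of exploration. -/
theorem regretAgainst_le (h : R.IsAdmissible P D G μ CX CΘ CE Cl) {astar ρ : Ctx d → Fin K}
    (hopt : R.IsOptimal P.T μ astar) (hρ : Measurable ρ) :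
    R.regretAgainst P.T μ ρ
      ≤ ∑ t ∈ Finset.range P.T, ∑ a,
          ∫ ω, inner ℝ (regretDir D P astar a (R.hist P t ω)) (R.θ t a ω) ∂μ
        + K * CX * CΘ * P.beta1 * ∫ ω, ∑ t ∈ Finset.range P.T, 1 / betaAt P (R.data ω) t ∂μ := by
  have S := h.setting
  have hCX := S.CX_pos
  have hCΘ := h.CΘ_pos
  have e : R.regretAgainst P.T μ ρ
      = ∑ t ∈ Finset.range P.T, ∑ a, ∫ ω,
          inner ℝ (contextMean D fun x => histPi P (R.hist P t ω) x a) (R.θ t a ω) ∂μ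
        - ∑ t ∈ Finset.range P.T, ∑ a,
          ∫ ω, inner ℝ (contextMean D (picks ρ a)) (R.θ t a ω) ∂μ := by
    have hi : ∀ t ∈ Finset.range P.T, Integrable (fun ω =>
        R.loss t (R.A t ω) ω - R.loss t (ρ (R.X t ω)) ω) μ := fun t ht =>
      (h.integral_loss_arm (Finset.mem_range.1 ht)).1.sub
        (h.integral_loss_classifier (Finset.mem_range.1 ht) hρ).1
    rw [regretAgainst, integral_finsetSum _ hi, ← Finset.sum_sub_distrib]
    refine Finset.sum_congr rfl fun t ht => ?_
    have ht := Finset.mem_range.1 ht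
    rw [integral_sub (h.integral_loss_arm ht).1 (h.integral_loss_classifier ht hρ).1,
      (h.integral_loss_arm ht).2, (h.integral_loss_classifier ht hρ).2]
  have hopt' := h.sum_loss_optimal_le hopt hρ
  have hround : ∀ t ∈ Finset.range P.T,
      ∑ a, ∫ ω, inner ℝ (contextMean D fun x => histPi P (R.hist P t ω) x a) (R.θ t a ω) ∂μ
        - ∑ a, ∫ ω, inner ℝ (contextMean D (picks astar a)) (R.θ t a ω) ∂μ
      ≤ ∑ a, ∫ ω, inner ℝ (regretDir D P astar a (R.hist P t ω)) (R.θ t a ω) ∂μ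
        + K * CX * CΘ * P.beta1 * ∫ ω, 1 / betaAt P (R.data ω) t ∂μ := by
    intro t ht
    have ht := Finset.mem_range.1 ht
    have ha : ∀ a, ∫ ω, inner ℝ (contextMean D fun x => histPi P (R.hist P t ω) x a)
          (R.θ t a ω) ∂μ
        - ∫ ω, inner ℝ (contextMean D (picks astar a)) (R.θ t a ω) ∂μ
        ≤ ∫ ω, inner ℝ (regretDir D P astar a (R.hist P t ω)) (R.θ t a ω) ∂μ
          + CX * CΘ * P.beta1 * ∫ ω, 1 / betaAt P (R.data ω) t ∂μ := by
      intro a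
      have i1 := h.integrable_inner_hist ht a
        (u := fun y => contextMean D fun x => histPi P y x a)
        (measurable_contextMean (f := fun y x => histPi P y x a) (measurable_histPi P a))
        (Cu := 1 * CX) fun y => norm_contextMean_le S.bdd fun x => by
          rw [abs_of_nonneg ((histPi_mem S y x).1 a)]; exact (isPolicy_histPi S y).le_one x a
      have i2 := h.integrable_inner_hist ht a
        (u := fun _ => contextMean D (picks astar a)) measurable_const
        (Cu := 1 * CX) fun y => norm_contextMean_le S.bdd (abs_picks_le astar a)
      have i3 := h.integrable_inner_hist ht a (measurable_regretDir (P := P) hopt.1 a)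
        (norm_regretDir_le S a)
      have i4 := (h.integrable_inv_beta ht).const_mul (CX * CΘ * P.beta1)
      rw [← integral_const_mul, ← integral_sub i1 i2, ← integral_add i3 i4]
      refine integral_mono_ae (i1.sub i2) (i3.add i4) ?_
      filter_upwards [h.norm_θ t ht a] with ω hω
      have h1 := norm_contextMean_sub_le S hopt.1 a (R.hist P t ω)
      have h2 := real_inner_le_norm (contextMean D (fun x => histPi P (R.hist P t ω) x a)
        - contextMean D (picks astar a) - regretDir D P astar a (R.hist P t ω)) (R.θ t a ω)
      have h3 := histGamma_le S (R.hist P t ω)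
      rw [h.histRate_hist] at h3
      have h4 : histGamma P (R.hist P t ω) * CX * CΘ
          ≤ CX * CΘ * P.beta1 * (1 / betaAt P (R.data ω) t) := by
        have := mul_le_mul_of_nonneg_right h3 (mul_pos hCX hCΘ).le
        linarith
      have h5 := mul_le_mul h1 hω (norm_nonneg _)
        (mul_nonneg (histGamma_pos S _).le hCX.le)
      rw [inner_sub_left, inner_sub_left] at h2
      linarith
    rw [← Finset.sum_sub_distrib]
    refine (Finset.sum_le_sum fun a _ => ha a).trans (le_of_eq ?_)
    rw [Finset.sum_add_distrib, Finset.sum_const, Finset.card_univ, Fintype.card_fin, nsmul_eq_mul]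
    ring
  have hsum := Finset.sum_le_sum hround
  rw [Finset.sum_sub_distrib, Finset.sum_add_distrib, ← Finset.mul_sum,
    ← integral_finsetSum _ fun t ht => h.integrable_inv_beta (Finset.mem_range.1 ht)] at hsum
  rw [e]
  linarith

end Trial.IsAdmissible

/-! ### The regret bound -/

/-- Jensen's inequality for the square root, from the tangent at `m`. -/
theorem integral_sqrt_le {Ω : Type*} {mΩ : MeasurableSpace Ω} {μ : Measure Ω}
    [IsProbabilityMeasure μ] {f : Ω → ℝ} (hf : Integrable f μ) (hf0 : ∀ ω, 0 ≤ f ω) {m : ℝ}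
    (hm : 0 < m) (h : ∫ ω, f ω ∂μ ≤ m) : ∫ ω, Real.sqrt (f ω) ∂μ ≤ Real.sqrt m := by
  have hs := Real.sqrt_pos.2 hm
  have hi : Integrable (fun ω => (f ω / Real.sqrt m + Real.sqrt m) / 2) μ :=
    ((hf.div_const _).add (integrable_const _)).div_const 2
  calc ∫ ω, Real.sqrt (f ω) ∂μ ≤ ∫ ω, (f ω / Real.sqrt m + Real.sqrt m) / 2 ∂μ :=
        integral_mono_of_nonneg (Filter.Eventually.of_forall fun ω => Real.sqrt_nonneg _) hi
          (Filter.Eventually.of_forall fun ω => sqrt_le_tangent (hf0 ω) hm)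
    _ = ((∫ ω, f ω ∂μ) / Real.sqrt m + Real.sqrt m) / 2 := by
        rw [integral_div, integral_add (hf.div_const _) (integrable_const _), integral_div]
        simp
    _ ≤ (m / Real.sqrt m + Real.sqrt m) / 2 := by gcongr
    _ = Real.sqrt m := by rw [Real.div_sqrt]; ring

/-- The arithmetic behind the final constants. It is applied with `B = β₁`, `ℓ = log K`,
`L = log (K T)`, `τ = log T`, `k = K`, `dd = d` and `M = max √Q̄ 1`, so that `5 L M²` bounds the
expected total entropy; `cV` and `cE` are the constants of the variance and of the exploration. -/
theorem final_arithmetic {B ℓ L M τ k dd cV cE : ℝ} (hB : 0 < B) (hℓ : 1 / 2 ≤ ℓ) (hL : ℓ ≤ L)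
    (hL1 : 1 ≤ L) (hM : 1 ≤ M) (hτ : 1 / 2 ≤ τ) (hk : 0 ≤ k) (hdd : 1 ≤ dd)
    (hkd : k * dd * τ ≤ 2 * B) (hcV : 0 ≤ cV) (hcE : 0 ≤ cE) :
    B * ℓ + 2 * B * Real.sqrt ℓ * Real.sqrt (5 * L * M ^ 2)
      + (4 * cV * (k ^ 2 * dd) + k * cE * B)
        * ((1 + τ) / B * Real.sqrt (1 + ℓ⁻¹ * (5 * L * M ^ 2)))
      + k * cE
      ≤ (7 + 576 * cV + 44 * cE) * (B * Real.sqrt ℓ * Real.sqrt L * M) := by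
  have hℓ0 : 0 < ℓ := by linarith
  have hL0 : 0 < L := by linarith
  have hM0 : 0 < M := by linarith
  set Λ := Real.sqrt ℓ * Real.sqrt L * M with hΛ
  have sℓ : Real.sqrt ℓ ^ 2 = ℓ := Real.sq_sqrt hℓ0.le
  have sL : Real.sqrt L ^ 2 = L := Real.sq_sqrt hL0.le
  have hsℓ := Real.sqrt_nonneg ℓ
  have hsL := Real.sqrt_nonneg L
  have hΛℓ : ℓ ≤ Λ := by
    have h1 : Real.sqrt ℓ ≤ Real.sqrt L := Real.sqrt_le_sqrt hL
    calc ℓ = Real.sqrt ℓ * Real.sqrt ℓ * 1 := by rw [← sq, sℓ, mul_one]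
      _ ≤ Λ := by rw [hΛ]; gcongr
  have hΛ0 : 0 < Λ := by linarith
  -- the penalty term
  have t2 : Real.sqrt ℓ * Real.sqrt (5 * L * M ^ 2) ≤ 3 * Λ := by
    have : Real.sqrt (5 * L * M ^ 2) ≤ 3 * (Real.sqrt L * M) := by
      refine Real.sqrt_le_iff.2 ⟨by positivity, ?_⟩
      rw [mul_pow, mul_pow, sL]
      nlinarith [mul_pos hL0 (pow_pos hM0 2)]
    calc _ ≤ Real.sqrt ℓ * (3 * (Real.sqrt L * M)) := by gcongr
      _ = 3 * Λ := by rw [hΛ]; ring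
  -- the sum of the inverse learning rates
  have t3 : Real.sqrt (1 + ℓ⁻¹ * (5 * L * M ^ 2)) ≤ 6 * Λ := by
    refine Real.sqrt_le_iff.2 ⟨by positivity, ?_⟩
    have e : (6 * Λ) ^ 2 = 36 * (ℓ * L * M ^ 2) := by
      rw [hΛ]; rw [mul_pow, mul_pow, mul_pow, sℓ, sL]; ring
    have h1 : ℓ⁻¹ ≤ 2 := by
      rw [inv_le_comm₀ hℓ0 (by norm_num)]; linarith
    have hM2 : 1 ≤ M ^ 2 := one_le_pow₀ hM
    have h2 : 1 ≤ L * M ^ 2 := one_le_mul_of_one_le_of_one_le hL1 hM2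
    -- `ℓ⁻¹ ≤ 4 ℓ` because `ℓ ≥ 1 / 2`
    have h3 : ℓ⁻¹ * (5 * L * M ^ 2) ≤ 4 * ℓ * (5 * L * M ^ 2) := by
      gcongr; linarith
    have h4 : 1 / 2 * (L * M ^ 2) ≤ ℓ * (L * M ^ 2) := by gcongr
    rw [e]
    nlinarith
  have t4 : (1 + τ) / B * Real.sqrt (1 + ℓ⁻¹ * (5 * L * M ^ 2)) ≤ 18 * (τ * Λ) / B := by
    calc _ ≤ (3 * τ) / B * (6 * Λ) := by gcongr; linarith
      _ = _ := by ring
  -- `k ≤ 4 B` absorbs one factor `K` of the variance term, and `k d τ ≤ 2 B` absorbs the others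
  have hkτ : k * τ ≤ 2 * B := by nlinarith [mul_nonneg hk (by linarith : 0 ≤ τ)]
  have hk4 : k ≤ 4 * B := by nlinarith
  have hV : (4 * cV * (k ^ 2 * dd)) * (18 * (τ * Λ) / B) ≤ 576 * cV * (B * Λ) := by
    have h1 : k ^ 2 * dd * τ ≤ 8 * B ^ 2 := by
      have := mul_le_mul hk4 hkd (by positivity) (by positivity)
      nlinarith
    have h2 : (4 * cV * (k ^ 2 * dd)) * (18 * (τ * Λ) / B)
        = 72 * cV * Λ / B * (k ^ 2 * dd * τ) := by ring
    rw [h2]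
    calc _ ≤ 72 * cV * Λ / B * (8 * B ^ 2) := by gcongr
      _ = 576 * cV * (B * Λ) := by field_simp; ring
  have hE : (k * cE * B) * (18 * (τ * Λ) / B) ≤ 36 * cE * (B * Λ) := by
    have h2 : (k * cE * B) * (18 * (τ * Λ) / B) = 18 * cE * Λ * (k * τ) := by field_simp
    rw [h2]
    calc _ ≤ 18 * cE * Λ * (2 * B) := by gcongr
      _ = _ := by ring
  have hE2 : k * cE ≤ 8 * cE * (B * Λ) := by
    have h1 : 1 / 2 ≤ Λ := hℓ.trans hΛℓ
    calc k * cE ≤ 4 * B * cE := by gcongr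
      _ = 8 * cE * B * (1 / 2) := by ring
      _ ≤ 8 * cE * B * Λ := by gcongr
      _ = _ := by ring
  have hsum : (4 * cV * (k ^ 2 * dd) + k * cE * B)
        * ((1 + τ) / B * Real.sqrt (1 + ℓ⁻¹ * (5 * L * M ^ 2)))
      ≤ (4 * cV * (k ^ 2 * dd) + k * cE * B) * (18 * (τ * Λ) / B) := by
    gcongr
  have h1 : B * ℓ ≤ B * Λ := by gcongr
  have h2 : B * (Real.sqrt ℓ * Real.sqrt (5 * L * M ^ 2)) ≤ B * (3 * Λ) := by gcongr
  have e : B * Real.sqrt ℓ * Real.sqrt L * M = B * Λ := by rw [hΛ]; ring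
  rw [e]
  rw [add_mul] at hsum
  nlinarith

namespace Trial.IsAdmissible

variable {Ω : Type*} {K d : ℕ} {mΩ : MeasurableSpace Ω} {R : Trial Ω K d}
  {P : Params} {D : Measure (Ctx d)} {G : Filtration ℕ mΩ} {μ : Measure Ω} {CX CΘ CE Cl : ℝ}
  [IsProbabilityMeasure μ] [IsProbabilityMeasure D]

/-- The regret against any classifier, in terms of the total entropy. -/
theorem regretAgainst_le_entropy (h : R.IsAdmissible P D G μ CX CΘ CE Cl)
    {astar ρ : Ctx d → Fin K} (hopt : R.IsOptimal P.T μ astar) (hρ : Measurable ρ) :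
    R.regretAgainst P.T μ ρ
      ≤ P.beta1 * Real.log K
        + 2 * P.beta1 * Real.sqrt (Real.log K) * ∫ ω, Real.sqrt (R.totalEntropy P ω) ∂μ
        + (4 * (Real.exp (2 * CX) * Cl ^ 2) * (K ^ 2 * d) + K * (CX * CΘ) * P.beta1)
          * ∫ ω, ∑ t ∈ Finset.range P.T, 1 / betaAt P (R.data ω) t ∂μ
        + K * (CX * CΘ) := by
  have S := h.setting
  have hT : (0 : ℝ) < P.T := by have := S.two_le_T; positivity
  have h1 := h.regretAgainst_le hopt hρ
  have h2 := h.sum_integral_regretDir_le hopt.1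
  have h3 : ∑ t ∈ Finset.range P.T, ∑ a,
        ∫ ω, inner ℝ (regretDir D P astar a (R.hist P t ω)) (R.θ t a ω) ∂μ
      ≤ ∑ t ∈ Finset.range P.T, ∑ a,
        ∫ ω, inner ℝ (regretDir D P astar a (R.hist P t ω)) (R.estimate P t a ω) ∂μ
        + K * (CX * CΘ) := by
    have h4 : ∑ t ∈ Finset.range P.T, ∑ a,
        ∫ ω, inner ℝ (regretDir D P astar a (R.hist P t ω)) (R.θ t a ω) ∂μ
        ≤ ∑ t ∈ Finset.range P.T, ∑ a : Fin K,
        (∫ ω, inner ℝ (regretDir D P astar a (R.hist P t ω)) (R.estimate P t a ω) ∂μ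
          + CX * CΘ / P.T) :=
      Finset.sum_le_sum fun t ht => Finset.sum_le_sum fun a _ =>
        h.integral_inner_θ_le (Finset.mem_range.1 ht) a (measurable_regretDir hopt.1 a)
          (norm_regretDir_le S a)
    refine h4.trans (le_of_eq ?_)
    simp only [Finset.sum_add_distrib, Finset.sum_const, Finset.card_univ, Fintype.card_fin,
      Finset.card_range, nsmul_eq_mul]
    field_simp
  linarith

/-- The bound on the regret against any classifier. -/
theorem regretAgainst_le_bound (h : R.IsAdmissible P D G μ CX CΘ CE Cl)
    {astar ρ : Ctx d → Fin K} (hopt : R.IsOptimal P.T μ astar) (hρ : Measurable ρ) :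
    R.regretAgainst P.T μ ρ
      ≤ (7 + 576 * (Real.exp (2 * CX) * Cl ^ 2) + 44 * (CX * CΘ))
        * (P.beta1 * Real.sqrt (Real.log K) * Real.sqrt (Real.log (K * P.T))
          * max (Real.sqrt (R.Qbar P D μ astar)) 1) := by
  have S := h.setting
  have hB := S.beta1_pos
  have hK := S.K_pos
  have hT : (2 : ℝ) ≤ P.T := by exact_mod_cast S.two_le_T
  have hlog2 := Real.log_two_gt_d9
  have hℓ : Real.log 2 ≤ Real.log K := Real.log_le_log (by norm_num) hK
  have hτ := S.log_T_pos
  have hL : Real.log (K * P.T) = Real.log K + Real.log P.T :=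
    Real.log_mul (by linarith) (by linarith)
  have hQ := h.Qbar_nonneg hopt.1
  set M := max (Real.sqrt (R.Qbar P D μ astar)) 1 with hMdef
  have hM : 1 ≤ M := le_max_right _ _
  have hQM : R.Qbar P D μ astar ≤ M ^ 2 := by
    rw [← Real.sq_sqrt hQ]
    exact pow_le_pow_left₀ (Real.sqrt_nonneg _) (le_max_left _ _) 2
  have hM2 : 1 ≤ M ^ 2 := one_le_pow₀ hM
  have hL1 : 1 ≤ Real.log (K * P.T) := by linarith
  have hS : ∫ ω, R.totalEntropy P ω ∂μ ≤ 5 * Real.log (K * P.T) * M ^ 2 := by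
    refine (h.integral_totalEntropy_le hopt.1).trans ?_
    set L := Real.log (K * P.T)
    have h1 : 2 * (L + 1) * R.Qbar P D μ astar ≤ 2 * (L + 1) * M ^ 2 := by gcongr
    -- `2 log 2 ≤ L` leaves just enough room for the additive constants
    have h2 : 4 / 3 ≤ L := by linarith
    nlinarith
  have hm : 0 < 5 * Real.log (K * P.T) * M ^ 2 := by positivity
  have h1 := integral_sqrt_le h.integrable_totalEntropy h.totalEntropy_nonneg hm hS
  have hlK := h.log_K_pos
  have h2 : ∫ ω, Real.sqrt (1 + (Real.log K)⁻¹ * R.totalEntropy P ω) ∂μ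
      ≤ Real.sqrt (1 + (Real.log K)⁻¹ * (5 * Real.log (K * P.T) * M ^ 2)) := by
    have hi := h.integrable_totalEntropy.const_mul (Real.log K)⁻¹
    refine integral_sqrt_le ((integrable_const (1 : ℝ)).add hi) (fun ω => ?_) (by positivity) ?_
    · have := mul_nonneg (inv_nonneg.2 hlK.le) (h.totalEntropy_nonneg ω)
      simp only [Pi.add_apply]; linarith
    · rw [integral_add' (integrable_const _) hi, integral_const_mul]
      simp only [integral_const, probReal_univ, one_smul]
      gcongr
  have h3 : ∫ ω, ∑ t ∈ Finset.range P.T, 1 / betaAt P (R.data ω) t ∂μ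
      ≤ (1 + Real.log P.T) / P.beta1
        * Real.sqrt (1 + (Real.log K)⁻¹ * (5 * Real.log (K * P.T) * M ^ 2)) := by
    have hi : Integrable (fun ω => Real.sqrt (1 + (Real.log K)⁻¹ * R.totalEntropy P ω)) μ := by
      have hi1 := (integrable_const (1 : ℝ)).add
        (h.integrable_totalEntropy.const_mul (Real.log K)⁻¹)
      refine hi1.mono' (((h.measurable_totalEntropy.const_mul _).const_add
        1).sqrt.aestronglyMeasurable) (Filter.Eventually.of_forall fun ω => ?_)
      have h0 := mul_nonneg (inv_nonneg.2 hlK.le) (h.totalEntropy_nonneg ω)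
      rw [Real.norm_of_nonneg (Real.sqrt_nonneg _)]
      exact Real.sqrt_le_self_iff.2 (Or.inr (by linarith))
    calc _ ≤ ∫ ω, (1 + Real.log P.T) / P.beta1
          * Real.sqrt (1 + (Real.log K)⁻¹ * R.totalEntropy P ω) ∂μ :=
          integral_mono (integrable_finsetSum _ fun t ht =>
            h.integrable_inv_beta (Finset.mem_range.1 ht)) (hi.const_mul _) h.sum_inv_beta_le
      _ ≤ _ := by
          rw [integral_const_mul]
          have : 0 ≤ Real.log P.T := by linarith
          gcongr
  have hCX := S.CX_pos
  have hCΘ := h.CΘ_pos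
  refine (h.regretAgainst_le_entropy hopt hρ).trans (le_trans ?_ (final_arithmetic
    (B := P.beta1) (ℓ := Real.log K) (L := Real.log (K * P.T)) (M := M) (τ := Real.log P.T)
    (k := K) (dd := d) (cV := Real.exp (2 * CX) * Cl ^ 2) (cE := CX * CΘ) hB (by linarith)
    (by linarith) hL1 hM (by linarith) (by linarith) (by exact_mod_cast S.one_le_d) S.K_d_log_le
    (by positivity) (by positivity)))
  gcongr

theorem regret_le_bound (h : R.IsAdmissible P D G μ CX CΘ CE Cl)
    {astar : Ctx d → Fin K} (hopt : R.IsOptimal P.T μ astar) :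
    BddAbove (R.regretSet P.T μ) ∧ R.regret P.T μ
      ≤ (7 + 576 * (Real.exp (2 * CX) * Cl ^ 2) + 44 * (CX * CΘ))
        * (P.beta1 * Real.sqrt (Real.log K) * Real.sqrt (Real.log (K * P.T))
          * max (Real.sqrt (R.Qbar P D μ astar)) 1) := by
  have hub : ∀ r ∈ R.regretSet P.T μ, r
      ≤ (7 + 576 * (Real.exp (2 * CX) * Cl ^ 2) + 44 * (CX * CΘ))
        * (P.beta1 * Real.sqrt (Real.log K) * Real.sqrt (Real.log (K * P.T))
          * max (Real.sqrt (R.Qbar P D μ astar)) 1) := by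
    rintro r ⟨ρ, hρ, rfl⟩
    exact h.regretAgainst_le_bound hopt hρ
  exact ⟨⟨_, hub⟩, csSup_le ⟨_, astar, hopt.1, rfl⟩ hub⟩

end Trial.IsAdmissible

end BoBW

theorem mainTheorem1 (CX CΘ CE Cl : ℝ) (hCX : 0 < CX) (hCΘ : 0 < CΘ) (hCE : 0 < CE)
    (hCl : CX ≤ 2 * Cl) :
    ∃ c₀ : ℝ, 0 < c₀ ∧
      ∀ (K d T : ℕ), 2 ≤ K → 1 ≤ d → 2 ≤ T →
      ∀ (D : MeasureTheory.Measure (BoBW.Ctx d)) [MeasureTheory.IsProbabilityMeasure D],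
      (∀ᵐ x ∂D, ‖x‖ ≤ CX) → (BoBW.secondMoment D).PosDef →
      ∀ (δ β₁ : ℝ) (P : BoBW.Params),
      δ = 1 / (2 * Cl * CX) → 0 < β₁ → P = ⟨T, δ, BoBW.lambdaMin D, β₁⟩ →
      BoBW.gammaOf K P β₁ ≤ 1 →
      ∀ (Ω : Type*) [mΩ : MeasurableSpace Ω] (μ : MeasureTheory.Measure Ω)
        [MeasureTheory.IsProbabilityMeasure μ] (G : MeasureTheory.Filtration ℕ mΩ)
        (R : BoBW.Trial Ω K d),
      R.IsBoBWRealFTRL P D G μ →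
      (∀ t < T, ∀ a, ∀ᵐ ω ∂μ, ‖R.θ t a ω‖ ≤ CΘ) →
      (∀ t < T, ∀ a, ∀ᵐ ω ∂μ, |R.ε t a ω| ≤ CE) →
      (∀ t < T, ∀ a, ∀ᵐ ω ∂μ, |R.loss t a ω| ≤ Cl) →
      ∀ astar : BoBW.Ctx d → Fin K, R.IsOptimal T μ astar →
      ∀ Δ C : ℝ, 0 < Δ → 0 ≤ C → R.SelfBounding P D μ astar Δ C →
      BddAbove (R.regretSet T μ) ∧
      R.regret T μ ≤
        c₀ * ((K * Real.log T / β₁ *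
                (Real.log T / (δ * BoBW.lambdaMin D * Real.log K) + d)
              + β₁ * Real.sqrt (Real.log K))
            * Real.sqrt (Real.log (K * T))
            * max (Real.sqrt (R.Qbar P D μ astar)) 1) := by
  refine ⟨7 + 576 * (Real.exp (2 * CX) * Cl ^ 2) + 44 * (CX * CΘ), by positivity, ?_⟩
  intro K d T hK hd hT D _ hbd hpos δ β₁ P hδ hβ₁ hP hγ Ω mΩ μ _ G R hplay hθ hε hloss astar hopt
    Δ C _ _ _
  subst hP
  have h : R.IsAdmissible ⟨T, δ, BoBW.lambdaMin D, β₁⟩ D G μ CX CΘ CE Cl :=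
    { setting := ⟨hK, hd, hT, hCX, hCl, hbd, hpos, hδ, rfl, hβ₁, hγ⟩
      play := hplay
      CΘ_pos := hCΘ
      norm_θ := hθ
      abs_ε := hε
      abs_loss := hloss }
  obtain ⟨hbdd, hreg⟩ := h.regret_le_bound hopt
  refine ⟨hbdd, hreg.trans ?_⟩
  have hδ0 : 0 < δ := h.setting.delta_pos
  have hlam : 0 < BoBW.lambdaMin D := h.setting.lam_pos
  have hlogT : 0 < Real.log T := h.setting.log_T_pos'
  have hlogK : 0 < Real.log K := h.log_K_pos
  -- `γ₁ ≤ 1` has been used to absorb all terms into this one, so the other term can be dropped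
  have hfirst : β₁ * Real.sqrt (Real.log K) ≤ K * Real.log T / β₁ *
      (Real.log T / (δ * BoBW.lambdaMin D * Real.log K) + d) + β₁ * Real.sqrt (Real.log K) :=
    le_add_of_nonneg_left (by positivity)
  refine mul_le_mul_of_nonneg_left ?_ (by positivity)
  refine mul_le_mul_of_nonneg_right (mul_le_mul_of_nonneg_right hfirst (Real.sqrt_nonneg _)) ?_
  exact le_max_of_le_right zero_le_one
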